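/- Let $D=\mathbb{C}[x_1,\dots,x_n]\langle\partial_1,\dots,\partial_n\rangle$ be the Weyl algebra. Let $F_d(D)$ be the operators of order at most $d$ and let $V_k(D)$ be the filtration along $x_1=\dots=x_n=0$, in which $x_i$ has weight $-1$ and $\partial_i$ has weight $1$; put $F_{d,k}(D)=F_d(D)\cap V_k(D)$ for $d,k\in\mathbb{Z}$. Let $I$ be a left ideal of $D$ and let $M=D/I$ carry the quotient filtration $F_d(M)=(F_d(D)+I)/I$ and the quotient bifiltration $F_{d,k}(M)=(F_{d,k}(D)+I)/I$. Suppose that (a) there is $w\in\mathbb{Z}_{>0}^n$ such that $M$ is homogeneous for $W=(-w,w)$, i.e. $I$ is generated by elements that are homogeneous for the grading of $D$ in which $x_i$ has degree $-w_i$ and $\partial_i$ has degree $w_i$; (b) $M$ is nicely bifiltered: $\bigl(\bigcup_{d'}F_{d',k}(M)\bigr)\cap\bigl(\bigcup_{k'}F_{d,k'}(M)\bigr)=F_{d,k}(M)$ for all $d,k$. Then the following modules have the same codimension: 1. $M$, whose codimension is by definition that of $\mathrm{gr}^F(M)=\bigoplus_d F_d(M)/F_{d-1}(M)$ over the commutative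 ring $\mathrm{gr}^F(D)$; 2. $\mathrm{gr}^F(\mathbf{R}_V(M))=\bigoplus_{d,k}F_{d,k}(M)/F_{d-1,k}(M)$ over the commutative ring $\mathrm{gr}^F(\mathbf{R}_V(D))=\bigoplus_{d,k}F_{d,k}(D)/F_{d-1,k}(D)$; 3. $\mathrm{gr}^V(\mathbf{R}_F(M))=\bigoplus_{d,k}F_{d,k}(M)/F_{d,k-1}(M)$ over $B=\mathrm{gr}^V(\mathbf{R}_F(D))=\bigoplus_{d,k}F_{d,k}(D)/F_{d,k-1}(D)$. The ring $B$ is generated by the classes of $x_i$, $\partial_i$, $h$ in bidegrees $(0,-1)$, $(1,1)$, $(1,0)$ (where $h$ is the class of $1\in F_{1,0}(D)$), with $[\partial_i,x_i]=h$ and all other commutators of generators zero. The codimension of this module is that of its associated graded module $\mathrm{gr}^{(u,v,t)}$ over the commutative ring $\mathrm{gr}^{(u,v,t)}(B)$, where $(u,v,t)\in\mathbb{N}^{2n+1}$ is any weight vector for $(x,\partial,h)$ with $u_i+v_i>t$ for all $i$, and the filtration on the (cyclic) module is the quotient of the one on $B$; the value is the same for every such $(u,v,t)$; 4. $\mathrm{bigr}(M)=\bigoplus_{d,k}F_{d,k}(M)/(F_{d-1,k}(M)+F_{d,k-1}(M))$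 over the commutative ring $\mathrm{bigr}(D)=\bigoplus_{d,k}F_{d,k}(D)/(F_{d-1,k}(D)+F_{d,k-1}(D))$. Here the codimension of a module over a commutative ring is the height of its annihilator (it is $\infty$ for the zero module). -/

import Mathlib

noncomputable section

open scoped DirectSum

namespace BifilteredWeyl

/-! ## Graded rings and modules attached to a family of subspaces -/

/-- A family of pairs of subspaces `F' i ≤ F i` of a `ℂ`-algebra `A`, indexed by an additive
group `ι`, such that the multiplication of `A` induces a ring structure on `⨁ i, F i / F' i`. -/
structure GradingData (ι : Type*) [AddCommGroup ι] (A : Type*) [Ring A] [Algebra ℂ A] where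
  F : ι → Submodule ℂ A
  F' : ι → Submodule ℂ A
  one_mem : 1 ∈ F 0
  mul_mem : ∀ {i j a b}, a ∈ F i → b ∈ F j → a * b ∈ F (i + j)
  mul_mem_left : ∀ {i j a b}, a ∈ F' i → b ∈ F j → a * b ∈ F' (i + j)
  mul_mem_right : ∀ {i j a b}, a ∈ F i → b ∈ F' j → a * b ∈ F' (i + j)

namespace GradingData

variable {ι : Type*} [AddCommGroup ι] {A : Type*} [Ring A] [Algebra ℂ A]
variable (P : GradingData ι A)

/-- The component `F i / F' i` (that is, `F i / (F i ∩ F' i)`). -/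
def Piece (i : ι) : Type _ := P.F i ⧸ (P.F' i).comap (P.F i).subtype

instance (i : ι) : AddCommGroup (P.Piece i) :=
  inferInstanceAs (AddCommGroup (P.F i ⧸ (P.F' i).comap (P.F i).subtype))

instance (i : ι) : Module ℂ (P.Piece i) :=
  inferInstanceAs (Module ℂ (P.F i ⧸ (P.F' i).comap (P.F i).subtype))

/-- The class of `a ∈ F i` in `F i / F' i`. -/
def cls {i : ι} (a : A) (ha : a ∈ P.F i) : P.Piece i :=
  Submodule.Quotient.mk (p := (P.F' i).comap (P.F i).subtype) ⟨a, ha⟩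

theorem cls_eq {i : ι} {a b : A} {ha : a ∈ P.F i} {hb : b ∈ P.F i} (h : a - b ∈ P.F' i) :
    P.cls a ha = P.cls b hb :=
  (Submodule.Quotient.eq _).2 h

theorem sub_mem_of_cls {i : ι} {a b : P.F i}
    (h : (Submodule.quotientRel ((P.F' i).comap (P.F i).subtype)) a b) :
    (a : A) - b ∈ P.F' i := by
  have := (Submodule.quotientRel_def _).1 h
  simpa using this

theorem mk_cls_congr {i j : ι} {a b : A} {ha : a ∈ P.F i} {hb : b ∈ P.F j} (hij : i = j)
    (hab : a = b) :
    (GradedMonoid.mk i (P.cls a ha) : GradedMonoid P.Piece) = GradedMonoid.mk j (P.cls b hb) := by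
  subst hij; subst hab; rfl

theorem mul_congr {i j : ι} {a a' b b' : A} (ha : a ∈ P.F i) (hb' : b' ∈ P.F j)
    (h : a - a' ∈ P.F' i) (k : b - b' ∈ P.F' j) : a * b - a' * b' ∈ P.F' (i + j) := by
  have e : a * b - a' * b' = a * (b - b') + (a - a') * b' := by noncomm_ring
  rw [e]
  exact add_mem (P.mul_mem_right ha k) (P.mul_mem_left h hb')

/-- The multiplication `F i / F' i × F j / F' j → F (i+j) / F' (i+j)` induced by that of `A`. -/
def pieceMul {i j : ι} : P.Piece i → P.Piece j → P.Piece (i + j) :=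
  Quotient.map₂ (fun a b => ⟨(a : A) * b, P.mul_mem a.2 b.2⟩) (by
    intro a a' h b b' k
    refine (Submodule.quotientRel_def _).2 ?_
    exact P.mul_congr a.2 b'.2 (P.sub_mem_of_cls h) (P.sub_mem_of_cls k))

theorem pieceMul_cls {i j : ι} {a b : A} (ha : a ∈ P.F i) (hb : b ∈ P.F j) :
    P.pieceMul (P.cls a ha) (P.cls b hb) = P.cls (a * b) (P.mul_mem ha hb) := rfl

theorem exists_cls {i : ι} (x : P.Piece i) : ∃ (a : A) (ha : a ∈ P.F i), P.cls a ha = x := by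
  obtain ⟨⟨a, ha⟩, rfl⟩ := Submodule.Quotient.mk_surjective _ x
  exact ⟨a, ha, rfl⟩

theorem cls_add {i : ι} {a b : A} (ha : a ∈ P.F i) (hb : b ∈ P.F i) :
    P.cls a ha + P.cls b hb = P.cls (a + b) (add_mem ha hb) := rfl

theorem cls_zero (i : ι) : P.cls (0 : A) (zero_mem (P.F i)) = 0 := rfl

theorem algebraMap_mem (r : ℂ) : algebraMap ℂ A r ∈ P.F 0 := by
  rw [Algebra.algebraMap_eq_smul_one]
  exact Submodule.smul_mem _ _ P.one_mem

instance : GradedMonoid.GOne P.Piece where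
  one := P.cls 1 P.one_mem

instance : GradedMonoid.GMul P.Piece where
  mul := P.pieceMul

instance : GradedMonoid.GMonoid P.Piece where
  one_mul := by
    rintro ⟨i, x⟩
    obtain ⟨a, ha, rfl⟩ := P.exists_cls x
    exact P.mk_cls_congr (zero_add i) (one_mul a)
  mul_one := by
    rintro ⟨i, x⟩
    obtain ⟨a, ha, rfl⟩ := P.exists_cls x
    exact P.mk_cls_congr (add_zero i) (mul_one a)
  mul_assoc := by
    rintro ⟨i, x⟩ ⟨j, y⟩ ⟨k, z⟩
    obtain ⟨a, ha, rfl⟩ := P.exists_cls x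
    obtain ⟨b, hb, rfl⟩ := P.exists_cls y
    obtain ⟨c, hc, rfl⟩ := P.exists_cls z
    exact P.mk_cls_congr (add_assoc i j k) (mul_assoc a b c)

instance : DirectSum.GRing P.Piece where
  mul_zero := by
    intro i j x
    obtain ⟨a, ha, rfl⟩ := P.exists_cls x
    exact P.cls_eq (by simp)
  zero_mul := by
    intro i j x
    obtain ⟨a, ha, rfl⟩ := P.exists_cls x
    exact P.cls_eq (by simp)
  mul_add := by
    intro i j x y z
    obtain ⟨a, ha, rfl⟩ := P.exists_cls x
    obtain ⟨b, hb, rfl⟩ := P.exists_cls y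
    obtain ⟨c, hc, rfl⟩ := P.exists_cls z
    exact P.cls_eq (by simp [mul_add])
  add_mul := by
    intro i j x y z
    obtain ⟨a, ha, rfl⟩ := P.exists_cls x
    obtain ⟨b, hb, rfl⟩ := P.exists_cls y
    obtain ⟨c, hc, rfl⟩ := P.exists_cls z
    exact P.cls_eq (by simp [add_mul])
  natCast m := m • P.cls 1 P.one_mem
  natCast_zero := zero_smul _ _
  natCast_succ m := succ_nsmul _ _
  intCast m := m • P.cls 1 P.one_mem
  intCast_ofNat m := natCast_zsmul _ _
  intCast_negSucc_ofNat m := negSucc_zsmul _ _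

instance : DirectSum.GAlgebra ℂ P.Piece where
  toFun :=
    { toFun := fun r => P.cls (algebraMap ℂ A r) (P.algebraMap_mem r)
      map_zero' := P.cls_eq (by simp)
      map_add' := fun r s => P.cls_eq (by simp) }
  map_one := P.cls_eq (by simp)
  map_mul r s := P.mk_cls_congr (zero_add 0).symm (map_mul _ r s)
  commutes := by
    rintro r ⟨i, x⟩
    obtain ⟨a, ha, rfl⟩ := P.exists_cls x
    exact P.mk_cls_congr ((zero_add i).trans (add_zero i).symm) (Algebra.commutes r a)
  smul_def := by
    rintro r ⟨i, x⟩
    obtain ⟨a, ha, rfl⟩ := P.exists_cls x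
    exact P.mk_cls_congr (ha := Submodule.smul_mem _ r ha) (zero_add i).symm
      (Algebra.smul_def r a)

/-- The condition that the graded ring is commutative. -/
class IsComm : Prop where
  comm : ∀ {i j : ι} {a b : A}, a ∈ P.F i → b ∈ P.F j → a * b - b * a ∈ P.F' (i + j)

instance [P.IsComm] : DirectSum.GCommRing P.Piece where
  mul_comm := by
    rintro ⟨i, x⟩ ⟨j, y⟩
    obtain ⟨a, ha, rfl⟩ := P.exists_cls x
    obtain ⟨b, hb, rfl⟩ := P.exists_cls y
    have h : P.cls (a * b) (P.mul_mem ha hb) =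
        P.cls (b * a) (by rw [add_comm]; exact P.mul_mem hb ha) :=
      P.cls_eq (IsComm.comm ha hb)
    have h1 : (GradedMonoid.mk (i + j) (P.cls (a * b) (P.mul_mem ha hb)) :
        GradedMonoid P.Piece) = GradedMonoid.mk (j + i) (P.cls (b * a) (P.mul_mem hb ha)) := by
      rw [h]
      exact P.mk_cls_congr (add_comm i j) rfl
    exact h1

/-! ### Cyclic modules -/

section Cyclic

variable {M : Type*} [AddCommGroup M] [Module A M]

/-- For a subspace `U` of `A` and `m : M`, the subgroup `U • m` of `M`.  When `M = A / I` and
`m` is the class of `1`, this is `(U + I) / I`. -/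
def _root_.BifilteredWeyl.quotFilt (U : Submodule ℂ A) (m : M) : AddSubgroup M :=
  U.toAddSubgroup.map (LinearMap.toSpanSingleton A M m).toAddMonoidHom

theorem mem_quotFilt {U : Submodule ℂ A} {m x : M} :
    x ∈ quotFilt U m ↔ ∃ a ∈ U, a • m = x := by
  simp [quotFilt]

variable (m : M)

/-- The component `(F i • m) / (F' i • m)` of the graded module. -/
def ModPiece (i : ι) : Type _ :=
  quotFilt (P.F i) m ⧸ (quotFilt (P.F' i) m).addSubgroupOf (quotFilt (P.F i) m)

instance (i : ι) : AddCommGroup (P.ModPiece m i) :=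
  inferInstanceAs
    (AddCommGroup (quotFilt (P.F i) m ⧸ (quotFilt (P.F' i) m).addSubgroupOf (quotFilt (P.F i) m)))

/-- The class of `x ∈ F i • m` in `(F i • m) / (F' i • m)`. -/
def modCls {i : ι} (x : M) (hx : x ∈ quotFilt (P.F i) m) : P.ModPiece m i :=
  QuotientAddGroup.mk ⟨x, hx⟩

theorem modCls_eq {i : ι} {x y : M} {hx : x ∈ quotFilt (P.F i) m}
    {hy : y ∈ quotFilt (P.F i) m} (h : x - y ∈ quotFilt (P.F' i) m) :
    P.modCls m x hx = P.modCls m y hy := by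
  refine QuotientAddGroup.eq.2 ?_
  rw [AddSubgroup.mem_addSubgroupOf]
  have := neg_mem h
  simpa [sub_eq_add_neg, add_comm] using this

theorem exists_modCls {i : ι} (x : P.ModPiece m i) :
    ∃ (y : M) (hy : y ∈ quotFilt (P.F i) m), P.modCls m y hy = x := by
  obtain ⟨⟨a, ha⟩, rfl⟩ := QuotientAddGroup.mk_surjective x
  exact ⟨a, ha, rfl⟩

theorem mk_modCls_congr {i j : ι} {x y : M} {hx : x ∈ quotFilt (P.F i) m}
    {hy : y ∈ quotFilt (P.F j) m} (hij : i = j) (hxy : x = y) :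
    (GradedMonoid.mk i (P.modCls m x hx) : GradedMonoid (P.ModPiece m)) =
      GradedMonoid.mk j (P.modCls m y hy) := by
  subst hij; subst hxy; rfl

theorem smul_mem {i j : ι} {a : A} {x : M} (ha : a ∈ P.F i) (hx : x ∈ quotFilt (P.F j) m) :
    a • x ∈ quotFilt (P.F (i + j)) m := by
  obtain ⟨b, hb, rfl⟩ := mem_quotFilt.1 hx
  exact mem_quotFilt.2 ⟨a * b, P.mul_mem ha hb, mul_smul _ _ _⟩

theorem smul_mem_left {i j : ι} {a : A} {x : M} (ha : a ∈ P.F' i)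
    (hx : x ∈ quotFilt (P.F j) m) : a • x ∈ quotFilt (P.F' (i + j)) m := by
  obtain ⟨b, hb, rfl⟩ := mem_quotFilt.1 hx
  exact mem_quotFilt.2 ⟨a * b, P.mul_mem_left ha hb, mul_smul _ _ _⟩

theorem smul_mem_right {i j : ι} {a : A} {x : M} (ha : a ∈ P.F i)
    (hx : x ∈ quotFilt (P.F' j) m) : a • x ∈ quotFilt (P.F' (i + j)) m := by
  obtain ⟨b, hb, rfl⟩ := mem_quotFilt.1 hx
  exact mem_quotFilt.2 ⟨a * b, P.mul_mem_right ha hb, mul_smul _ _ _⟩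

/-- The action `F i / F' i × (F j • m) / (F' j • m) → (F (i+j) • m) / (F' (i+j) • m)`. -/
def pieceSMul {i j : ι} : P.Piece i → P.ModPiece m j → P.ModPiece m (i + j) :=
  Quotient.map₂ (fun a x => ⟨(a : A) • (x : M), P.smul_mem m a.2 x.2⟩) (by
    intro a a' h x x' k
    have h1 := P.sub_mem_of_cls h
    have k1 : (x' : M) - x ∈ quotFilt (P.F' j) m := by
      have := QuotientAddGroup.leftRel_apply.1 k
      rw [AddSubgroup.mem_addSubgroupOf] at this
      simpa [sub_eq_add_neg, add_comm] using this
    refine QuotientAddGroup.leftRel_apply.2 ?_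
    rw [AddSubgroup.mem_addSubgroupOf]
    have e : -((a : A) • (x : M)) + (a' : A) • (x' : M) =
        (a : A) • ((x' : M) - x) - ((a : A) - a') • (x' : M) := by
      rw [smul_sub, sub_smul]; abel
    change -((a : A) • (x : M)) + (a' : A) • (x' : M) ∈ _
    rw [e]
    exact sub_mem (P.smul_mem_right m a.2 k1) (P.smul_mem_left m h1 x'.2))

instance : DirectSum.Gmodule P.Piece (P.ModPiece m) where
  smul := P.pieceSMul m
  one_smul := by
    rintro ⟨i, x⟩
    obtain ⟨y, hy, rfl⟩ := P.exists_modCls m x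
    exact P.mk_modCls_congr m (zero_add i) (one_smul A y)
  mul_smul := by
    rintro ⟨i, x⟩ ⟨j, y⟩ ⟨k, z⟩
    obtain ⟨a, ha, rfl⟩ := P.exists_cls x
    obtain ⟨b, hb, rfl⟩ := P.exists_cls y
    obtain ⟨c, hc, rfl⟩ := P.exists_modCls m z
    exact P.mk_modCls_congr m (add_assoc i j k) (mul_smul a b c)
  smul_add := by
    intro i j x y z
    obtain ⟨a, ha, rfl⟩ := P.exists_cls x
    obtain ⟨b, hb, rfl⟩ := P.exists_modCls m y
    obtain ⟨c, hc, rfl⟩ := P.exists_modCls m z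
    exact P.modCls_eq m (by simp [smul_add])
  smul_zero := by
    intro i j x
    obtain ⟨a, ha, rfl⟩ := P.exists_cls x
    exact P.modCls_eq m (by simp)
  add_smul := by
    intro i j x y z
    obtain ⟨a, ha, rfl⟩ := P.exists_cls x
    obtain ⟨b, hb, rfl⟩ := P.exists_cls y
    obtain ⟨c, hc, rfl⟩ := P.exists_modCls m z
    exact P.modCls_eq m (by simp [add_smul])
  zero_smul := by
    intro i j z
    obtain ⟨c, hc, rfl⟩ := P.exists_modCls m z
    exact P.modCls_eq m (by simp)

end Cyclic

/-! ### The graded ring and its cyclic graded modules -/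

variable [DecidableEq ι]

/-- The associated graded ring `⨁ i, F i / F' i`. -/
abbrev Gr : Type _ := ⨁ i, P.Piece i

/-- The homogeneous element of degree `i` of the graded ring defined by `a ∈ F i`. -/
def hom (i : ι) (a : A) (ha : a ∈ P.F i) : P.Gr := DirectSum.of P.Piece i (P.cls a ha)

theorem hom_congr {i j : ι} {a b : A} {ha : a ∈ P.F i} {hb : b ∈ P.F j} (hij : i = j)
    (hab : a = b) : P.hom i a ha = P.hom j b hb := by
  subst hij; subst hab; rfl

theorem hom_mul {i j : ι} {a b : A} (ha : a ∈ P.F i) (hb : b ∈ P.F j) :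
    P.hom i a ha * P.hom j b hb = P.hom (i + j) (a * b) (P.mul_mem ha hb) :=
  DirectSum.of_mul_of _ _

theorem hom_sub {i : ι} {a b : A} (ha : a ∈ P.F i) (hb : b ∈ P.F i) :
    P.hom i a ha - P.hom i b hb = P.hom i (a - b) (sub_mem ha hb) :=
  (map_sub (DirectSum.of P.Piece i) _ _).symm

theorem hom_commutator {i j : ι} {a b : A} (ha : a ∈ P.F i) (hb : b ∈ P.F j) :
    P.hom i a ha * P.hom j b hb - P.hom j b hb * P.hom i a ha =
      P.hom (i + j) (a * b - b * a)
        (sub_mem (P.mul_mem ha hb) (add_comm j i ▸ P.mul_mem hb ha)) := by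
  rw [hom_mul, hom_mul, P.hom_congr (hb := add_comm j i ▸ P.mul_mem hb ha) (add_comm j i) rfl,
    hom_sub]

theorem hom_mul_comm {i j : ι} {a b : A} (ha : a ∈ P.F i) (hb : b ∈ P.F j) (h : a * b = b * a) :
    P.hom i a ha * P.hom j b hb = P.hom j b hb * P.hom i a ha := by
  rw [hom_mul, hom_mul]
  exact P.hom_congr (add_comm i j) h

theorem hom_eq_zero {i : ι} {a : A} (ha : a ∈ P.F i) (h : a = 0) : P.hom i a ha = 0 := by
  subst h
  exact map_zero (DirectSum.of P.Piece i)

variable {M : Type*} [AddCommGroup M] [Module A M] (m : M)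

/-- The graded module `⨁ i, (F i • m) / (F' i • m)` over `⨁ i, F i / F' i`. -/
abbrev GrMod : Type _ := ⨁ i, P.ModPiece m i

/-- The class of `m` in degree `0` of the graded module. -/
def grGen : P.GrMod m :=
  DirectSum.of (P.ModPiece m) 0 (P.modCls m m (mem_quotFilt.2 ⟨1, P.one_mem, one_smul _ _⟩))

/-- The codimension of the graded module over the (commutative) graded ring: the height of its
annihilator. -/
def codimGr [P.IsComm] : ℕ∞ := (Module.annihilator P.Gr (P.GrMod m)).height

end GradingData

/-! ## Filtrations defined by weights on generators -/

section WeightFiltration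

variable {σ A : Type*} [Ring A] [Algebra ℂ A] (g : σ → A) (w : σ → ℤ)

/-- The filtration obtained by giving weight `w s` to the element `g s`: step `d` is spanned by
the products of the `g s` of total weight at most `d`. -/
def weightFilt (d : ℤ) : Submodule ℂ A :=
  Submodule.span ℂ {a | ∃ l : List σ, (l.map w).sum ≤ d ∧ (l.map g).prod = a}

theorem prod_mem_weightFilt {d : ℤ} (l : List σ) (h : (l.map w).sum ≤ d) :
    (l.map g).prod ∈ weightFilt g w d :=
  Submodule.subset_span ⟨l, h, rfl⟩

theorem weightFilt_mono {d e : ℤ} (h : d ≤ e) : weightFilt g w d ≤ weightFilt g w e := by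
  refine Submodule.span_mono ?_
  rintro a ⟨l, hl, rfl⟩
  exact ⟨l, hl.trans h, rfl⟩

theorem one_mem_weightFilt {d : ℤ} (h : 0 ≤ d) : (1 : A) ∈ weightFilt g w d := by
  simpa using prod_mem_weightFilt g w (d := d) [] (by simpa using h)

theorem gen_mem_weightFilt {d : ℤ} (s : σ) (h : w s ≤ d) : g s ∈ weightFilt g w d := by
  simpa using prod_mem_weightFilt g w (d := d) [s] (by simpa using h)

theorem mul_mem_weightFilt {d e : ℤ} {a b : A} (ha : a ∈ weightFilt g w d)
    (hb : b ∈ weightFilt g w e) : a * b ∈ weightFilt g w (d + e) := by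
  have h := Submodule.mul_mem_mul ha hb
  rw [weightFilt, weightFilt, Submodule.span_mul_span] at h
  refine Submodule.span_mono ?_ h
  rintro _ ⟨_, ⟨l, hl, rfl⟩, _, ⟨l', hl', rfl⟩, rfl⟩
  exact ⟨l ++ l', by simpa using add_le_add hl hl', by simp⟩

theorem mul_mem_weightFilt' {d e f : ℤ} {a b : A} (ha : a ∈ weightFilt g w d)
    (hb : b ∈ weightFilt g w e) (h : d + e ≤ f) : a * b ∈ weightFilt g w f :=
  weightFilt_mono g w h (mul_mem_weightFilt g w ha hb)

theorem comm_mem_weightFilt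
    (hg : ∀ s t, g s * g t - g t * g s ∈ weightFilt g w (w s + w t - 1)) {d e : ℤ} {a b : A}
    (ha : a ∈ weightFilt g w d) (hb : b ∈ weightFilt g w e) :
    a * b - b * a ∈ weightFilt g w (d + e - 1) := by
  have h1 : ∀ (s : σ) (l : List σ), g s * (l.map g).prod - (l.map g).prod * g s ∈
      weightFilt g w (w s + (l.map w).sum - 1) := by
    intro s l
    induction l with
    | nil => simp
    | cons t l ih =>
      have e1 : g s * ((t :: l).map g).prod - ((t :: l).map g).prod * g s =
          (g s * g t - g t * g s) * (l.map g).prod +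
            g t * (g s * (l.map g).prod - (l.map g).prod * g s) := by
        simp only [List.map_cons, List.prod_cons]; noncomm_ring
      rw [e1]
      refine add_mem (mul_mem_weightFilt' g w (hg s t) (prod_mem_weightFilt g w l le_rfl) ?_)
        (mul_mem_weightFilt' g w (gen_mem_weightFilt g w t le_rfl) ih ?_) <;>
      · simp only [List.map_cons, List.sum_cons]; linarith
  have h2 : ∀ (l k : List σ), (l.map g).prod * (k.map g).prod - (k.map g).prod * (l.map g).prod ∈
      weightFilt g w ((l.map w).sum + (k.map w).sum - 1) := by
    intro l k
    induction l with
    | nil => simp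
    | cons t l ih =>
      have e1 : ((t :: l).map g).prod * (k.map g).prod - (k.map g).prod * ((t :: l).map g).prod =
          g t * ((l.map g).prod * (k.map g).prod - (k.map g).prod * (l.map g).prod) +
            (g t * (k.map g).prod - (k.map g).prod * g t) * (l.map g).prod := by
        simp only [List.map_cons, List.prod_cons]; noncomm_ring
      rw [e1]
      refine add_mem (mul_mem_weightFilt' g w (gen_mem_weightFilt g w t le_rfl) ih ?_)
        (mul_mem_weightFilt' g w (h1 t k) (prod_mem_weightFilt g w l le_rfl) ?_) <;>
      · simp only [List.map_cons, List.sum_cons]; linarith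
  induction ha using Submodule.span_induction with
  | zero => simp
  | add x y _ _ hx hy =>
    have : (x + y) * b - b * (x + y) = (x * b - b * x) + (y * b - b * y) := by noncomm_ring
    rw [this]; exact add_mem hx hy
  | smul c x _ hx =>
    have : (c • x) * b - b * (c • x) = c • (x * b - b * x) := by
      rw [smul_mul_assoc, mul_smul_comm, smul_sub]
    rw [this]; exact Submodule.smul_mem _ _ hx
  | mem x hx =>
    obtain ⟨l, hl, rfl⟩ := hx
    induction hb using Submodule.span_induction with
    | zero => simp
    | add x y _ _ hx hy =>
      have : (l.map g).prod * (x + y) - (x + y) * (l.map g).prod =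
        ((l.map g).prod * x - x * (l.map g).prod) + ((l.map g).prod * y - y * (l.map g).prod) := by
        noncomm_ring
      rw [this]; exact add_mem hx hy
    | smul c x _ hx =>
      have : (l.map g).prod * (c • x) - (c • x) * (l.map g).prod =
          c • ((l.map g).prod * x - x * (l.map g).prod) := by
        rw [smul_mul_assoc, mul_smul_comm, smul_sub]
      rw [this]; exact Submodule.smul_mem _ _ hx
    | mem x hx =>
      obtain ⟨k, hk, rfl⟩ := hx
      exact weightFilt_mono g w (by linarith) (h2 l k)

/-- The graded ring `⨁ d, F d / F (d-1)` of the filtration `F` defined by weights. -/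
def weightGr : GradingData ℤ A where
  F d := weightFilt g w d
  F' d := weightFilt g w (d - 1)
  one_mem := one_mem_weightFilt g w le_rfl
  mul_mem ha hb := mul_mem_weightFilt g w ha hb
  mul_mem_left ha hb := mul_mem_weightFilt' g w ha hb (by linarith)
  mul_mem_right ha hb := mul_mem_weightFilt' g w ha hb (by linarith)

end WeightFiltration

/-! ## The Weyl algebra and its filtrations -/

/-- The defining relations of the Weyl algebra; `Sum.inl i` is `x_i` and `Sum.inr i` is `∂_i`. -/
inductive WeylRel (n : ℕ) : FreeAlgebra ℂ (Fin n ⊕ Fin n) → FreeAlgebra ℂ (Fin n ⊕ Fin n) → Prop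
  | x_comm (i j : Fin n) : WeylRel n
      (FreeAlgebra.ι ℂ (Sum.inl i) * FreeAlgebra.ι ℂ (Sum.inl j))
      (FreeAlgebra.ι ℂ (Sum.inl j) * FreeAlgebra.ι ℂ (Sum.inl i))
  | d_comm (i j : Fin n) : WeylRel n
      (FreeAlgebra.ι ℂ (Sum.inr i) * FreeAlgebra.ι ℂ (Sum.inr j))
      (FreeAlgebra.ι ℂ (Sum.inr j) * FreeAlgebra.ι ℂ (Sum.inr i))
  | d_x (i j : Fin n) : WeylRel n
      (FreeAlgebra.ι ℂ (Sum.inr i) * FreeAlgebra.ι ℂ (Sum.inl j))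
      (FreeAlgebra.ι ℂ (Sum.inl j) * FreeAlgebra.ι ℂ (Sum.inr i) + if i = j then 1 else 0)

/-- The Weyl algebra `D = ℂ[x_1, …, x_n]⟨∂_1, …, ∂_n⟩`. -/
abbrev Weyl (n : ℕ) : Type := RingQuot (WeylRel n)

variable {n : ℕ}

/-- The generators of the Weyl algebra: `gen (Sum.inl i) = x_i` and `gen (Sum.inr i) = ∂_i`. -/
def gen (s : Fin n ⊕ Fin n) : Weyl n := RingQuot.mkAlgHom ℂ (WeylRel n) (FreeAlgebra.ι ℂ s)

theorem gen_x_comm (i j : Fin n) :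
    gen (Sum.inl i) * gen (Sum.inl j) = gen (Sum.inl j) * gen (Sum.inl i) := by
  simpa [gen] using RingQuot.mkAlgHom_rel ℂ (WeylRel.x_comm i j)

theorem gen_d_comm (i j : Fin n) :
    gen (Sum.inr i) * gen (Sum.inr j) = gen (Sum.inr j) * gen (Sum.inr i) := by
  simpa [gen] using RingQuot.mkAlgHom_rel ℂ (WeylRel.d_comm i j)

theorem gen_d_x (i j : Fin n) :
    gen (Sum.inr i) * gen (Sum.inl j) =
      gen (Sum.inl j) * gen (Sum.inr i) + if i = j then 1 else 0 := by
  have h := RingQuot.mkAlgHom_rel ℂ (WeylRel.d_x i j)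
  split_ifs at h ⊢ <;> simpa [gen] using h

/-- The weights of the `F`-filtration: `0` for `x_i`, `1` for `∂_i`. -/
def wF : Fin n ⊕ Fin n → ℤ := Sum.elim (fun _ => 0) (fun _ => 1)

/-- The weights of the `V`-filtration along `x_1 = ⋯ = x_n = 0`: `-1` for `x_i`, `1` for `∂_i`. -/
def wV : Fin n ⊕ Fin n → ℤ := Sum.elim (fun _ => -1) (fun _ => 1)

variable (n) in
/-- `F_d(D)`, the operators of order at most `d`. -/
def filtF (d : ℤ) : Submodule ℂ (Weyl n) := weightFilt gen wF d

variable (n) in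
/-- `V_k(D)`. -/
def filtV (k : ℤ) : Submodule ℂ (Weyl n) := weightFilt gen wV k

variable (n) in
/-- The bifiltration `F_{d,k}(D) = F_d(D) ∩ V_k(D)`. -/
def filtFV (d k : ℤ) : Submodule ℂ (Weyl n) := filtF n d ⊓ filtV n k

theorem filtFV_mono {d d' k k' : ℤ} (hd : d ≤ d') (hk : k ≤ k') :
    filtFV n d k ≤ filtFV n d' k' :=
  inf_le_inf (weightFilt_mono _ _ hd) (weightFilt_mono _ _ hk)

theorem mul_mem_filtFV {d d' k k' e f : ℤ} {a b : Weyl n} (ha : a ∈ filtFV n d k)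
    (hb : b ∈ filtFV n d' k') (he : d + d' ≤ e) (hf : k + k' ≤ f) : a * b ∈ filtFV n e f :=
  ⟨mul_mem_weightFilt' _ _ ha.1 hb.1 he, mul_mem_weightFilt' _ _ ha.2 hb.2 hf⟩

theorem one_mem_filtFV {d k : ℤ} (hd : 0 ≤ d) (hk : 0 ≤ k) : (1 : Weyl n) ∈ filtFV n d k :=
  ⟨one_mem_weightFilt _ _ hd, one_mem_weightFilt _ _ hk⟩

theorem gen_mem_filtFV (s : Fin n ⊕ Fin n) : gen s ∈ filtFV n (wF s) (wV s) :=
  ⟨gen_mem_weightFilt _ _ s le_rfl, gen_mem_weightFilt _ _ s le_rfl⟩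

theorem comm_mem_filtF {d d' : ℤ} {a b : Weyl n} (ha : a ∈ filtF n d) (hb : b ∈ filtF n d') :
    a * b - b * a ∈ filtF n (d + d' - 1) := by
  refine comm_mem_weightFilt gen wF ?_ ha hb
  rintro (i | i) (j | j)
  · simp [gen_x_comm i j]
  · rw [gen_d_x j i]
    split_ifs
    · simpa [wF] using one_mem_weightFilt (A := Weyl n) gen wF (d := 0) le_rfl
    · simp
  · rw [gen_d_x i j]
    split_ifs
    · simpa [wF] using one_mem_weightFilt (A := Weyl n) gen wF (d := 0) le_rfl
    · simp
  · simp [gen_d_comm i j]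

theorem comm_mem_filtFV {d d' k k' : ℤ} {a b : Weyl n} (ha : a ∈ filtFV n d k)
    (hb : b ∈ filtFV n d' k') : a * b - b * a ∈ filtFV n (d + d' - 1) (k + k') :=
  ⟨comm_mem_filtF ha.1 hb.1, sub_mem (mul_mem_weightFilt _ _ ha.2 hb.2)
    (mul_mem_weightFilt' _ _ hb.2 ha.2 (by linarith))⟩

/-! ## The graded rings -/

variable (n) in
/-- `gr^F(D) = ⨁_d F_d(D) / F_{d-1}(D)`. -/
abbrev grF : GradingData ℤ (Weyl n) := weightGr gen wF

instance : (grF n).IsComm where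
  comm ha hb := comm_mem_filtF ha hb

variable (n) in
/-- `gr^F(R_V(D)) = ⨁_{d,k} F_{d,k}(D) / F_{d-1,k}(D)`: the Rees algebra
`R_V(D) = ⨁_k V_k(D) θ^k` carries the filtration `F_d(R_V(D)) = ⨁_k F_{d,k}(D) θ^k`. -/
def grFReesV : GradingData (ℤ × ℤ) (Weyl n) where
  F i := filtFV n i.1 i.2
  F' i := filtFV n (i.1 - 1) i.2
  one_mem := one_mem_filtFV le_rfl le_rfl
  mul_mem ha hb := mul_mem_filtFV ha hb le_rfl le_rfl
  mul_mem_left ha hb := mul_mem_filtFV ha hb (by simp only [Prod.fst_add]; linarith) le_rfl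
  mul_mem_right ha hb := mul_mem_filtFV ha hb (by simp only [Prod.fst_add]; linarith) le_rfl

instance : (grFReesV n).IsComm where
  comm ha hb := comm_mem_filtFV ha hb

variable (n) in
/-- `gr^V(R_F(D)) = ⨁_{d,k} F_{d,k}(D) / F_{d,k-1}(D)`: the Rees algebra
`R_F(D) = ⨁_d F_d(D) τ^d` carries the filtration `V_k(R_F(D)) = ⨁_d F_{d,k}(D) τ^d`. -/
def grVReesF : GradingData (ℤ × ℤ) (Weyl n) where
  F i := filtFV n i.1 i.2
  F' i := filtFV n i.1 (i.2 - 1)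
  one_mem := one_mem_filtFV le_rfl le_rfl
  mul_mem ha hb := mul_mem_filtFV ha hb le_rfl le_rfl
  mul_mem_left ha hb := mul_mem_filtFV ha hb le_rfl (by simp only [Prod.snd_add]; linarith)
  mul_mem_right ha hb := mul_mem_filtFV ha hb le_rfl (by simp only [Prod.snd_add]; linarith)

variable (n) in
/-- `bigr(D) = ⨁_{d,k} F_{d,k}(D) / (F_{d-1,k}(D) + F_{d,k-1}(D))`. -/
def bigr : GradingData (ℤ × ℤ) (Weyl n) where
  F i := filtFV n i.1 i.2
  F' i := filtFV n (i.1 - 1) i.2 ⊔ filtFV n i.1 (i.2 - 1)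
  one_mem := one_mem_filtFV le_rfl le_rfl
  mul_mem ha hb := mul_mem_filtFV ha hb le_rfl le_rfl
  mul_mem_left := by
    intro i j a b ha hb
    obtain ⟨c, hc, d, hd, rfl⟩ := Submodule.mem_sup.1 ha
    rw [add_mul]
    exact Submodule.add_mem_sup (mul_mem_filtFV hc hb (by simp only [Prod.fst_add]; linarith) le_rfl)
      (mul_mem_filtFV hd hb le_rfl (by simp only [Prod.snd_add]; linarith))
  mul_mem_right := by
    intro i j a b ha hb
    obtain ⟨c, hc, d, hd, rfl⟩ := Submodule.mem_sup.1 hb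
    rw [mul_add]
    exact Submodule.add_mem_sup (mul_mem_filtFV ha hc (by simp only [Prod.fst_add]; linarith) le_rfl)
      (mul_mem_filtFV ha hd le_rfl (by simp only [Prod.snd_add]; linarith))

instance : (bigr n).IsComm where
  comm ha hb := Submodule.mem_sup_left (comm_mem_filtFV ha hb)

/-! ### The graded ring `gr^V(R_F(D))` is a homogenized Weyl algebra -/

theorem gen_mem_grVReesF (s : Fin n ⊕ Fin n) : gen s ∈ (grVReesF n).F (wF s, wV s) :=
  gen_mem_filtFV s

theorem one_mem_grVReesF : 1 ∈ (grVReesF n).F (1, 0) :=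
  one_mem_filtFV zero_le_one le_rfl

/-- The generators `x_i`, `∂_i`, `h` of `gr^V(R_F(D))`: the classes of `x_i` in bidegree `(0,-1)`,
of `∂_i τ` in bidegree `(1,1)` and of `τ` in bidegree `(1,0)`. -/
def hgen : (Fin n ⊕ Fin n) ⊕ Unit → (grVReesF n).Gr :=
  Sum.elim (fun s => (grVReesF n).hom (wF s, wV s) (gen s) (gen_mem_grVReesF s))
    (fun _ => (grVReesF n).hom (1, 0) 1 one_mem_grVReesF)

/-- A weight vector `(u, v, t) ∈ ℕ^{2n+1}` with `u_i + v_i > t` for all `i`. -/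
structure HWeight (n : ℕ) where
  u : Fin n → ℕ
  v : Fin n → ℕ
  t : ℕ
  lt : ∀ i, t < u i + v i

/-- The weights `u_i` of `x_i`, `v_i` of `∂_i` and `t` of `h`. -/
def HWeight.weight (ω : HWeight n) : (Fin n ⊕ Fin n) ⊕ Unit → ℤ :=
  Sum.elim (Sum.elim (fun i => ω.u i) (fun i => ω.v i)) (fun _ => ω.t)

theorem hgen_h_comm (s : Fin n ⊕ Fin n) :
    hgen (n := n) (Sum.inr ()) * hgen (Sum.inl s) = hgen (Sum.inl s) * hgen (Sum.inr ()) :=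
  (grVReesF n).hom_mul_comm one_mem_grVReesF (gen_mem_grVReesF s) (by rw [one_mul, mul_one])

theorem hgen_x_comm (i j : Fin n) :
    hgen (Sum.inl (Sum.inl i)) * hgen (Sum.inl (Sum.inl j)) =
      hgen (Sum.inl (Sum.inl j)) * hgen (Sum.inl (Sum.inl i)) :=
  (grVReesF n).hom_mul_comm (gen_mem_grVReesF _) (gen_mem_grVReesF _) (gen_x_comm i j)

theorem hgen_d_comm (i j : Fin n) :
    hgen (Sum.inl (Sum.inr i)) * hgen (Sum.inl (Sum.inr j)) =
      hgen (Sum.inl (Sum.inr j)) * hgen (Sum.inl (Sum.inr i)) :=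
  (grVReesF n).hom_mul_comm (gen_mem_grVReesF _) (gen_mem_grVReesF _) (gen_d_comm i j)

theorem hgen_d_x (i j : Fin n) :
    hgen (Sum.inl (Sum.inr i)) * hgen (Sum.inl (Sum.inl j)) -
      hgen (Sum.inl (Sum.inl j)) * hgen (Sum.inl (Sum.inr i)) =
      if i = j then hgen (Sum.inr ()) else 0 := by
  refine ((grVReesF n).hom_commutator (gen_mem_grVReesF _) (gen_mem_grVReesF _)).trans ?_
  split_ifs with h
  · exact GradingData.hom_congr _ (by simp [wF, wV])
      (by rw [gen_d_x, if_pos h, add_sub_cancel_left])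
  · exact GradingData.hom_eq_zero _ _ (by rw [gen_d_x, if_neg h, add_zero, sub_self])

/-- `gr^{(u,v,t)}(gr^V(R_F(D)))`, the graded ring of the filtration of `gr^V(R_F(D))` giving the
weights `u_i`, `v_i`, `t` to the generators `x_i`, `∂_i`, `h`. -/
abbrev grH (ω : HWeight n) : GradingData ℤ (grVReesF n).Gr := weightGr hgen ω.weight

instance (ω : HWeight n) : (grH ω).IsComm where
  comm := by
    intro i j a b ha hb
    refine comm_mem_weightFilt hgen ω.weight ?_ ha hb
    rintro ((i | i) | ⟨⟩) ((j | j) | ⟨⟩)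
    · simp [hgen_x_comm i j]
    · refine neg_mem_iff.1 ?_
      rw [neg_sub, hgen_d_x j i]
      split_ifs with h
      · subst h
        refine gen_mem_weightFilt hgen ω.weight _ ?_
        have := ω.lt j
        simp only [HWeight.weight, Sum.elim_inl, Sum.elim_inr]
        omega
      · exact zero_mem _
    · rw [← hgen_h_comm]; simp
    · rw [hgen_d_x i j]
      split_ifs with h
      · subst h
        refine gen_mem_weightFilt hgen ω.weight _ ?_
        have := ω.lt i
        simp only [HWeight.weight, Sum.elim_inl, Sum.elim_inr]
        omega
      · exact zero_mem _
    · simp [hgen_d_comm i j]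
    · rw [← hgen_h_comm]; simp
    · rw [← hgen_h_comm]; simp
    · rw [← hgen_h_comm]; simp
    · simp

/-! ## The module `M = D / I` -/

/-- The left `D`-module `M = D / I`, for a left ideal `I`. -/
abbrev QuotMod (I : Submodule (Weyl n) (Weyl n)) : Type := Weyl n ⧸ I

/-- The generator of `M = D / I`, the class of `1`. -/
def unitCls (I : Submodule (Weyl n) (Weyl n)) : QuotMod I := Submodule.Quotient.mk 1

/-- The quotient bifiltration `F_{d,k}(M) = (F_{d,k}(D) + I) / I` of `M = D / I`. -/
def bifilt (I : Submodule (Weyl n) (Weyl n)) (d k : ℤ) : AddSubgroup (QuotMod I) :=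
  quotFilt (filtFV n d k) (unitCls I)

/-- `M = D / I` is nicely bifiltered:
`(⋃_{d'} F_{d',k}(M)) ∩ (⋃_{k'} F_{d,k'}(M)) = F_{d,k}(M)` for all `d`, `k`. -/
def IsNicelyBifiltered (I : Submodule (Weyl n) (Weyl n)) : Prop :=
  ∀ d k : ℤ, (⋃ d' : ℤ, (bifilt I d' k : Set (QuotMod I))) ∩
    (⋃ k' : ℤ, (bifilt I d k' : Set (QuotMod I))) = bifilt I d k

/-- The homogeneous component of degree `j` of `D` for the grading in which `x_i` has degree
`-w_i` and `∂_i` has degree `w_i`. -/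
def gradW (w : Fin n → ℤ) (j : ℤ) : Submodule ℂ (Weyl n) :=
  Submodule.span ℂ {a | ∃ l : List (Fin n ⊕ Fin n),
    (l.map (Sum.elim (fun i => -w i) w)).sum = j ∧ (l.map gen).prod = a}

/-- `M = D / I` is homogeneous for the weights `(-w, w)`: the left ideal `I` is generated by
homogeneous elements. -/
def IsWHomogeneous (w : Fin n → ℤ) (I : Submodule (Weyl n) (Weyl n)) : Prop :=
  Submodule.span (Weyl n) {P | P ∈ I ∧ ∃ j, P ∈ gradW w j} = I

/-- The codimension of `M = D / I`: that of `gr^F(M)` over `gr^F(D)`. -/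
def codim (I : Submodule (Weyl n) (Weyl n)) : ℕ∞ := (grF n).codimGr (unitCls I)

/-- The codimension of `gr^F(R_V(M)) = ⨁_{d,k} F_{d,k}(M) / F_{d-1,k}(M)` over
`gr^F(R_V(D))`. -/
def codimGrFReesV (I : Submodule (Weyl n) (Weyl n)) : ℕ∞ := (grFReesV n).codimGr (unitCls I)

/-- The module `gr^V(R_F(M)) = ⨁_{d,k} F_{d,k}(M) / F_{d,k-1}(M)` over `gr^V(R_F(D))`. -/
abbrev GrVReesFMod (I : Submodule (Weyl n) (Weyl n)) : Type := (grVReesF n).GrMod (unitCls I)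

/-- The codimension of `gr^V(R_F(M))`, computed with the weight vector `(u,v,t)`: the codimension
of `gr^{(u,v,t)}(gr^V(R_F(M)))` over `gr^{(u,v,t)}(gr^V(R_F(D)))`, for the filtration of the cyclic
module `gr^V(R_F(M))` that is the quotient of the `(u,v,t)`-filtration of the ring. -/
def codimGrVReesF (I : Submodule (Weyl n) (Weyl n)) (ω : HWeight n) : ℕ∞ :=
  (grH ω).codimGr (M := GrVReesFMod I) ((grVReesF n).grGen (unitCls I))

/-- The codimension of `bigr(M) = ⨁_{d,k} F_{d,k}(M) / (F_{d-1,k}(M) + F_{d,k-1}(M))` over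
`bigr(D)`. -/
def codimBigr (I : Submodule (Weyl n) (Weyl n)) : ℕ∞ := (bigr n).codimGr (unitCls I)

end BifilteredWeyl

end

/-!
The four graded rings are polynomial rings, and each codimension is the height of an explicit ideal
of initial forms.

Let `S = ℂ[x, ξ]`.  The ordered monomials `x^a ∂^b` form a basis of `D` (`quant`), and each step of
the filtrations `F`, `V` and of the bifiltration is spanned by a set of them.  Hence
`gr^F(D)` and `bigr(D)` are `S`, `gr^F(R_V(D))` is `S[θ]`, and `B = gr^V(R_F(D))` has the basis
`x^a ∂^b h^c`, so that `gr^{(u,v,t)}(B)` is `S[h]` (`MonomialPresentation`).  All the graded modules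
are cyclic, so their annihilators are annihilators of the generator, which are spaces of initial
forms `initSpace` of the ideal `I`, or of the annihilator `K` of the generator of `gr^V(R_F(M))`
(`Compat.exists_ideal`).

Write `J₁`, `J₂`, `J₃`, `J₄` for the four ideals.  Niceness of the bifiltration yields
* `J₄ = in_V(J₁)` (`initSpace_initSpace`);
* `J₄[θ]` is the space of initial forms of `J₂` for the weight `-1` of `θ`, and, exchanging the roles
  of `F` and `V`, `J₄[h]` is the space of initial forms of `K` for the weight `-1` of `h`
  (`initSpace_rees`).

By construction `J₃ = in_{(u,v,t)}(K)`.  These weights are not positive, so passing to initial forms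
need not preserve the height in general.  It does here because of homogeneity: `I` contains the
`(-w, w)`-homogeneous components of its elements (`part_mem_symbols`), so every space above is
homogeneous for a combination `N * ordF + a * ordV - 2 * ordW`, and for large `N` all variables have
positive weight (`combInt`).  For a positive grading the pieces of bounded weight are
finite-dimensional, and a space of initial forms has the same Hilbert function as the space itself
(`finrank_initial_eq`).  The height of a homogeneous ideal is determined by its Hilbert function
(`height_eq_of_finrank_eq`): the growth of `k[τ]/J` is of degree `|τ|` minus the height of `J`.
Finally `J₄[θ]` and `J₄[h]` have the height of `J₄` (`height_map_C`).
-/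

noncomputable section

namespace BifilteredWeyl

open MvPolynomial

open scoped DirectSum

/-! ### Restriction of polynomials to sets of monomials -/

section Part

variable {k τ : Type*} [Field k]

/-- The linear projection of a polynomial to the span of the monomials in `X`. -/
def part (X : Set (τ →₀ ℕ)) : MvPolynomial τ k →ₗ[k] MvPolynomial τ k :=
  (basisMonomials τ k).constr k (fun μ => by
    classical exact if μ ∈ X then monomial μ 1 else 0)

open Classical in
theorem part_monomial (X : Set (τ →₀ ℕ)) (μ : τ →₀ ℕ) (c : k) :
    part X (monomial μ c) = if μ ∈ X then monomial μ c else 0 := by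
  have h : (monomial μ c : MvPolynomial τ k) = c • monomial μ 1 := by simp [smul_monomial]
  have h1 : part X (monomial μ (1 : k)) = if μ ∈ X then monomial μ 1 else 0 := by
    have := (basisMonomials τ k).constr_basis k (fun μ : τ →₀ ℕ =>
      if μ ∈ X then (monomial μ 1 : MvPolynomial τ k) else 0) μ
    rw [coe_basisMonomials] at this
    exact this
  rw [h, map_smul, h1]
  split_ifs <;> simp

open Classical in
theorem coeff_part (X : Set (τ →₀ ℕ)) (f : MvPolynomial τ k) (μ : τ →₀ ℕ) :
    coeff μ (part X f) = if μ ∈ X then coeff μ f else 0 := by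
  induction f using MvPolynomial.induction_on' with
  | monomial ν c =>
    rw [part_monomial]
    by_cases h : ν = μ
    · subst h; split_ifs <;> simp
    · split_ifs <;> simp [coeff_monomial, h]
  | add f g hf hg => rw [map_add, coeff_add, hf, hg, coeff_add]; split_ifs <;> simp

theorem mem_restrictSupport_iff_coeff {X : Set (τ →₀ ℕ)} {f : MvPolynomial τ k} :
    f ∈ restrictSupport k X ↔ ∀ μ, μ ∉ X → coeff μ f = 0 := by
  rw [mem_restrictSupport_iff]
  constructor
  · intro h μ hμ
    by_contra hc
    exact hμ (h (by simpa using hc))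
  · intro h μ hμ
    by_contra hc
    simp [h μ hc] at hμ

theorem part_mem (X : Set (τ →₀ ℕ)) (f : MvPolynomial τ k) : part X f ∈ restrictSupport k X := by
  classical
  rw [mem_restrictSupport_iff_coeff]
  intro μ hμ
  rw [coeff_part, if_neg hμ]

theorem part_eq_self_iff {X : Set (τ →₀ ℕ)} {f : MvPolynomial τ k} :
    part X f = f ↔ f ∈ restrictSupport k X := by
  classical
  rw [mem_restrictSupport_iff_coeff]
  constructor
  · intro h μ hμ
    rw [← h, coeff_part, if_neg hμ]
  · intro h
    ext μ
    rw [coeff_part]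
    split_ifs with hμ
    · rfl
    · exact (h μ hμ).symm

theorem part_part (X Y : Set (τ →₀ ℕ)) (f : MvPolynomial τ k) :
    part X (part Y f) = part (X ∩ Y) f := by
  classical
  ext μ
  simp only [coeff_part, Set.mem_inter_iff]
  split_ifs <;> simp_all

theorem part_eq_zero_iff {X : Set (τ →₀ ℕ)} {f : MvPolynomial τ k} :
    part X f = 0 ↔ ∀ μ ∈ X, coeff μ f = 0 := by
  classical
  constructor
  · intro h μ hμ
    have := congrArg (coeff μ) h
    rwa [coeff_part, if_pos hμ, coeff_zero] at this
  · intro h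
    ext μ
    rw [coeff_part, coeff_zero]
    split_ifs with hμ
    · exact h μ hμ
    · rfl

theorem part_mem_of_mem {X Y : Set (τ →₀ ℕ)} {f : MvPolynomial τ k}
    (hf : f ∈ restrictSupport k Y) : part X f ∈ restrictSupport k (X ∩ Y) := by
  rw [← part_eq_self_iff.2 hf, part_part]
  exact part_mem _ _

/-- A polynomial is the sum of its parts on the fibres of a function of the exponents. -/
theorem sum_part_fiber {ι : Type*} [DecidableEq ι] (ω : (τ →₀ ℕ) → ι) (f : MvPolynomial τ k) :
    ∑ i ∈ f.support.image ω, part {μ | ω μ = i} f = f := by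
  classical
  ext μ
  simp only [coeff_sum, coeff_part, Set.mem_ofPred_eq]
  by_cases h : μ ∈ f.support
  · rw [Finset.sum_eq_single (ω μ)]
    · simp
    · intro i _ hi
      rw [if_neg (Ne.symm hi)]
    · intro h'
      exact absurd (Finset.mem_image_of_mem ω h) h'
  · rw [notMem_support_iff.1 h]
    simp

instance finite_restrictSupport {X : Set (τ →₀ ℕ)} [Finite X] :
    Module.Finite k (restrictSupport k X) :=
  Module.Finite.of_basis (basisRestrictSupport k X)

theorem finrank_restrictSupport {X : Set (τ →₀ ℕ)} [Finite X] :
    Module.finrank k (restrictSupport k X) = Nat.card X := by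
  have := Fintype.ofFinite X
  rw [Module.finrank_eq_card_basis (basisRestrictSupport k X), Nat.card_eq_fintype_card]

end Part

/-- Rank–nullity for the restriction of a linear map to a subspace. -/
theorem finrank_eq_map_add_inf_ker {k V W : Type*} [Field k] [AddCommGroup V] [Module k V]
    [AddCommGroup W] [Module k W] (f : V →ₗ[k] W) (U : Submodule k V) [Module.Finite k U] :
    Module.finrank k U = Module.finrank k (U.map f) +
      Module.finrank k (U ⊓ LinearMap.ker f : Submodule k V) := by
  have h := LinearMap.finrank_range_add_finrank_ker (f.domRestrict U)
  have e : LinearMap.ker (f.domRestrict U) = (U ⊓ LinearMap.ker f).comap U.subtype := by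
    ext x; simp
  rw [LinearMap.range_domRestrict, e,
    (Submodule.comapSubtypeEquivOfLe (inf_le_left : U ⊓ LinearMap.ker f ≤ U)).finrank_eq] at h
  exact h.symm

/-! ### Growth functions of quotients of polynomial rings -/

section Growth

variable {k τ : Type*} [Field k] (wt : τ → ℕ)

/-- The exponents of weight at most `m`. -/
def weightLE (m : ℕ) : Set (τ →₀ ℕ) := {μ | Finsupp.weight wt μ ≤ m}

/-- The growth function of `k[τ] / J`: the dimension of the image of the space of polynomials of
weight at most `m`. -/
def hilb (J : Ideal (MvPolynomial τ k)) (m : ℕ) : ℕ :=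
  Module.finrank k ((restrictSupport k (weightLE wt m)).map (Ideal.Quotient.mkₐ k J).toLinearMap)

theorem weightLE_mono {m m' : ℕ} (h : m ≤ m') : weightLE wt m ⊆ weightLE wt m' :=
  fun _ hμ => le_trans hμ h

theorem mul_mem_weightLE {m m' : ℕ} {f g : MvPolynomial τ k}
    (hf : f ∈ restrictSupport k (weightLE wt m)) (hg : g ∈ restrictSupport k (weightLE wt m')) :
    f * g ∈ restrictSupport k (weightLE wt (m + m')) := by
  open scoped Pointwise in
  have h := Submodule.mul_mem_mul hf hg
  rw [← restrictSupport_add] at h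
  refine restrictSupport_mono k ?_ h
  rintro _ ⟨μ, hμ, ν, hν, rfl⟩
  change Finsupp.weight wt (μ + ν) ≤ _
  rw [map_add]
  exact add_le_add hμ hν

theorem exists_mem_weightLE (f : MvPolynomial τ k) :
    ∃ m, f ∈ restrictSupport k (weightLE wt m) := by
  refine ⟨f.support.sup (Finsupp.weight wt), fun μ hμ => ?_⟩
  exact Finset.le_sup (f := Finsupp.weight wt) hμ

theorem map_factor {J J' : Ideal (MvPolynomial τ k)} (h : J ≤ J') (m : ℕ) :
    ((restrictSupport k (weightLE wt m)).map (Ideal.Quotient.mkₐ k J).toLinearMap).map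
      (Ideal.Quotient.factorₐ k h).toLinearMap =
    (restrictSupport k (weightLE wt m)).map (Ideal.Quotient.mkₐ k J').toLinearMap := by
  rw [← Submodule.map_comp]
  rfl

variable [Finite τ]

theorem finite_weightLE (hwt : ∀ t, wt t ≠ 0) (m : ℕ) : Finite (weightLE wt m) :=
  (Finsupp.finite_of_nat_weight_le wt hwt m).to_subtype

theorem card_weightLE_le (hwt : ∀ t, wt t ≠ 0) (m : ℕ) :
    Nat.card (weightLE wt m) ≤ (m + 1) ^ Nat.card τ := by
  classical
  have := Fintype.ofFinite τ
  have hf := finite_weightLE wt hwt m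
  have hle : ∀ μ : weightLE wt m, ∀ t, μ.1 t < m + 1 := fun μ t =>
    Nat.lt_succ_of_le ((Finsupp.le_weight wt (hwt t) μ.1).trans μ.2)
  have h := Nat.card_le_card_of_injective
    (fun (μ : weightLE wt m) (t : τ) => (⟨μ.1 t, hle μ t⟩ : Fin (m + 1))) (by
      intro μ ν h
      ext t
      have := congrFun h t
      simpa using this)
  simpa [Nat.card_fun] using h

theorem hilb_le (hwt : ∀ t, wt t ≠ 0) (J : Ideal (MvPolynomial τ k)) (m : ℕ) :
    hilb wt J m ≤ (m + 1) ^ Nat.card τ := by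
  have hf := finite_weightLE wt hwt m
  refine (Submodule.finrank_map_le _ _).trans ?_
  rw [finrank_restrictSupport]
  exact card_weightLE_le wt hwt m

theorem hilb_mono (hwt : ∀ t, wt t ≠ 0) (J : Ideal (MvPolynomial τ k)) {m m' : ℕ} (h : m ≤ m') :
    hilb wt J m ≤ hilb wt J m' := by
  have hf := finite_weightLE wt hwt m'
  exact Submodule.finrank_mono (Submodule.map_mono (restrictSupport_mono k (weightLE_mono wt h)))

theorem hilb_anti (hwt : ∀ t, wt t ≠ 0) {J J' : Ideal (MvPolynomial τ k)} (h : J ≤ J') (m : ℕ) :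
    hilb wt J' m ≤ hilb wt J m := by
  have hf := finite_weightLE wt hwt m
  rw [hilb, ← map_factor wt h]
  exact Submodule.finrank_map_le _ _

/-- If `f ∈ P` has weight at most `e` and is a nonzerodivisor modulo `Q ≤ P`, then multiplication by
`f` embeds `k[τ]/Q` into the kernel of `k[τ]/Q → k[τ]/P`, and shifts weights by at most `e`. -/
theorem hilb_add_le (hwt : ∀ t, wt t ≠ 0) {Q P : Ideal (MvPolynomial τ k)} [Q.IsPrime] (h : Q ≤ P)
    {f : MvPolynomial τ k} (hfP : f ∈ P) (hfQ : f ∉ Q) {e : ℕ}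
    (hfe : f ∈ restrictSupport k (weightLE wt e)) (m : ℕ) :
    hilb wt Q m + hilb wt P (m + e) ≤ hilb wt Q (m + e) := by
  have hf := finite_weightLE wt hwt m
  have hf := finite_weightLE wt hwt (m + e)
  set U := (restrictSupport k (weightLE wt (m + e))).map (Ideal.Quotient.mkₐ k Q).toLinearMap
  have h1 := finrank_eq_map_add_inf_ker (Ideal.Quotient.factorₐ k h).toLinearMap U
  rw [map_factor wt h] at h1
  change hilb wt Q (m + e) = hilb wt P (m + e) + _ at h1
  rw [h1, add_comm]
  refine Nat.add_le_add_left ?_ _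
  let φ : (MvPolynomial τ k ⧸ Q) →ₗ[k] (MvPolynomial τ k ⧸ Q) :=
    LinearMap.mulLeft k (Ideal.Quotient.mk Q f)
  have hφ : Function.Injective φ := by
    exact mul_right_injective₀ (by simpa [Ideal.Quotient.eq_zero_iff_mem] using hfQ)
  rw [hilb, (Submodule.equivMapOfInjective φ hφ _).finrank_eq]
  refine Submodule.finrank_mono ?_
  rintro _ ⟨_, ⟨g, hg, rfl⟩, rfl⟩
  refine ⟨⟨f * g, ?_, ?_⟩, ?_⟩
  · rw [add_comm m e]; exact mul_mem_weightLE wt hfe hg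
  · simp [φ]
  · have : Ideal.Quotient.mk P f = 0 := Ideal.Quotient.eq_zero_iff_mem.2 hfP
    simp [φ, this]

end Growth

/-! ### The growth of a quotient is bounded in terms of the height -/

section GrowthHeight

variable {k τ : Type*} [Field k] (wt : τ → ℕ)

/-- The growth of `k[τ] / J` is at most that of a polynomial of degree `|τ| - r`. -/
def GrowthLE (J : Ideal (MvPolynomial τ k)) (r : ℕ) : Prop :=
  ∃ C, ∀ m, hilb wt J m * (m + 1) ^ r ≤ C * (m + 1) ^ Nat.card τ

/-- For a prime ideal, each step in a chain of primes lowers the degree of growth. -/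
theorem growthLE_of_isPrime [Finite τ] (hwt : ∀ t, wt t ≠ 0) (r : ℕ) (P : Ideal (MvPolynomial τ k))
    [hP : P.IsPrime] (hr : r ≤ P.height) : GrowthLE wt P r := by
  induction r generalizing P with
  | zero => exact ⟨1, fun m => by simpa using hilb_le wt hwt P m⟩
  | succ r ih =>
    have h : ¬ P.height ≤ (r : ℕ∞) := by
      intro h
      have := hr.trans h
      norm_cast at this
      omega
    rw [Ideal.height_le_iff] at h
    push Not at h
    obtain ⟨Q, hQ, hQP, hrQ⟩ := h
    obtain ⟨C, hC⟩ := ih Q hrQ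
    obtain ⟨f, hfP, hfQ⟩ := SetLike.exists_of_lt hQP
    obtain ⟨e, he⟩ := exists_mem_weightLE wt f
    -- Iterating the shift by `e` gives a factor `j + 1`, hence one more power of `m` for `j = m`.
    have key : ∀ m j : ℕ, (j + 1) * hilb wt P m ≤ hilb wt Q (m + j * e) := by
      intro m j
      induction j with
      | zero => simpa using hilb_anti wt hwt hQP.le m
      | succ j ihj =>
        have h1 := hilb_add_le wt hwt hQP.le hfP hfQ he (m + j * e)
        have h2 := hilb_mono wt hwt P (m := m) (m' := m + j * e + e) (by omega)
        have h3 : m + (j + 1) * e = m + j * e + e := by ring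
        rw [h3]
        calc (j + 1 + 1) * hilb wt P m = (j + 1) * hilb wt P m + hilb wt P m := by ring
          _ ≤ _ := by omega
    refine ⟨C * (1 + e) ^ Nat.card τ, fun m => ?_⟩
    calc hilb wt P m * (m + 1) ^ (r + 1) = ((m + 1) * hilb wt P m) * (m + 1) ^ r := by ring
      _ ≤ hilb wt Q (m + m * e) * (m + m * e + 1) ^ r := by
        gcongr
        · exact key m m
        · omega
      _ ≤ C * (m + m * e + 1) ^ Nat.card τ := hC _
      _ ≤ C * ((1 + e) * (m + 1)) ^ Nat.card τ := by
        gcongr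
        nlinarith
      _ = C * (1 + e) ^ Nat.card τ * (m + 1) ^ Nat.card τ := by rw [mul_pow]; ring

attribute [local instance] MvPolynomial.weightedGradedAlgebra

theorem weightedHomogeneousComponent_eq_part (f : MvPolynomial τ k) (i : ℕ) :
    weightedHomogeneousComponent wt i f = part {μ | Finsupp.weight wt μ = i} f := by
  classical
  ext μ
  rw [coeff_weightedHomogeneousComponent, coeff_part]
  simp only [Set.mem_ofPred_eq]
  congr

/-- An ideal containing all the weighted homogeneous parts of its elements is homogeneous. -/
theorem isHomogeneous_of_part_mem {J : Ideal (MvPolynomial τ k)}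
    (h : ∀ f ∈ J, ∀ i : ℕ, part {μ | Finsupp.weight wt μ = i} f ∈ J) :
    J.IsHomogeneous (weightedHomogeneousSubmodule k wt) := by
  intro i f hf
  have := h f hf i
  rw [← weightedHomogeneousComponent_eq_part, ← weightedDecomposition.decompose'_apply] at this
  exact this

theorem part_mem_of_isHomogeneous {J : Ideal (MvPolynomial τ k)}
    (h : J.IsHomogeneous (weightedHomogeneousSubmodule k wt)) {f : MvPolynomial τ k} (hf : f ∈ J)
    (i : ℕ) : part {μ | Finsupp.weight wt μ = i} f ∈ J := by
  rw [← weightedHomogeneousComponent_eq_part]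
  exact weightedHomogeneousComponent_mem_of_mem k wt h hf i

theorem part_preimage_eq_sum {ι : Type*} [DecidableEq ι] (ω : (τ →₀ ℕ) → ι) (Z : Set ι)
    [DecidablePred (· ∈ Z)] (f : MvPolynomial τ k) :
    part {μ | ω μ ∈ Z} f =
      ∑ i ∈ (f.support.image ω).filter (· ∈ Z), part {μ | ω μ = i} f := by
  conv_lhs => rw [← sum_part_fiber ω f, map_sum]
  rw [Finset.sum_filter]
  refine Finset.sum_congr rfl fun i _ => ?_
  rw [part_part]
  split_ifs with h
  · congr 1
    congr 1
    ext μ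
    simp only [Set.mem_inter_iff, Set.mem_ofPred_eq]
    exact ⟨fun h => h.2, fun h' => ⟨h' ▸ h, h'⟩⟩
  · rw [part_eq_zero_iff]
    rintro μ ⟨h1, h2⟩
    simp only [Set.mem_ofPred_eq] at h1 h2
    exact absurd (h2 ▸ h1) h

theorem part_weightLE_mem {J : Ideal (MvPolynomial τ k)}
    (h : J.IsHomogeneous (weightedHomogeneousSubmodule k wt)) {f : MvPolynomial τ k} (hf : f ∈ J)
    (m : ℕ) : part (weightLE wt m) f ∈ J := by
  classical
  have := part_preimage_eq_sum (Finsupp.weight wt) {i | i ≤ m} f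
  change part (weightLE wt m) f = _ at this
  rw [this]
  exact sum_mem fun i _ => part_mem_of_isHomogeneous wt h hf i

/-- Multiplication by a homogeneous element of weight `e` shifts the truncation by `e`. -/
theorem part_weightLE_mul {a : MvPolynomial τ k} {e : ℕ}
    (ha : a ∈ weightedHomogeneousSubmodule k wt e) (t : MvPolynomial τ k) (m : ℕ) :
    part (weightLE wt m) (a * t) = a * part {μ | e + Finsupp.weight wt μ ≤ m} t := by
  classical
  induction t using MvPolynomial.induction_on' with
  | add p q hp hq => rw [mul_add, map_add, map_add, mul_add, hp, hq]
  | monomial ν c =>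
    have h1 : a * monomial ν c ∈ weightedHomogeneousSubmodule k wt (e + Finsupp.weight wt ν) :=
      IsWeightedHomogeneous.mul ha (isWeightedHomogeneous_monomial wt ν c rfl)
    rw [part_monomial]
    simp only [Set.mem_ofPred_eq]
    split_ifs with h
    · rw [part_eq_self_iff, mem_restrictSupport_iff_coeff]
      intro μ hμ
      by_contra hc
      have := h1 hc
      exact hμ (this.trans_le h)
    · rw [mul_zero, part_eq_zero_iff]
      intro μ hμ
      by_contra hc
      have := h1 hc
      exact h (this.symm.trans_le hμ)

/-- The ideal quotient `(J : a)`. -/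
def colonElem (J : Ideal (MvPolynomial τ k)) (a : MvPolynomial τ k) : Ideal (MvPolynomial τ k) :=
  Submodule.comap (LinearMap.mulLeft (MvPolynomial τ k) a) J

theorem mem_colonElem {J : Ideal (MvPolynomial τ k)} {a t : MvPolynomial τ k} :
    t ∈ colonElem J a ↔ a * t ∈ J := Iff.rfl

theorem le_colonElem (J : Ideal (MvPolynomial τ k)) (a : MvPolynomial τ k) : J ≤ colonElem J a :=
  fun _ h => J.mul_mem_left a h

theorem colonElem_isHomogeneous {J : Ideal (MvPolynomial τ k)}
    (h : J.IsHomogeneous (weightedHomogeneousSubmodule k wt)) {a : MvPolynomial τ k} {e : ℕ}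
    (ha : a ∈ weightedHomogeneousSubmodule k wt e) :
    (colonElem J a).IsHomogeneous (weightedHomogeneousSubmodule k wt) := by
  have hT : ∀ f ∈ colonElem J a, ∀ m : ℕ,
      part {μ | e + Finsupp.weight wt μ ≤ m} f ∈ colonElem J a := by
    intro f hf m
    rw [mem_colonElem, ← part_weightLE_mul wt ha]
    exact part_weightLE_mem wt h hf m
  refine isHomogeneous_of_part_mem wt fun f hf i => ?_
  -- The part of weight `i` is the difference of two truncations.
  have e1 : part {μ | Finsupp.weight wt μ = i} f =
      part {μ | e + Finsupp.weight wt μ ≤ e + i} f -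
        part {μ | e + 1 + Finsupp.weight wt μ ≤ e + i} f := by
    classical
    ext μ
    simp only [coeff_sub, coeff_part, Set.mem_ofPred_eq]
    split_ifs <;> first | omega | simp
  have e2 : part {μ | e + 1 + Finsupp.weight wt μ ≤ e + i} f ∈ colonElem J a := by
    rcases Nat.eq_zero_or_pos (e + i) with h0 | h0
    · have : part {μ | e + 1 + Finsupp.weight wt μ ≤ e + i} f = 0 := by
        rw [part_eq_zero_iff]
        intro μ hμ
        simp only [Set.mem_ofPred_eq] at hμ
        omega
      rw [this]
      exact zero_mem _
    · have : {μ : τ →₀ ℕ | e + 1 + Finsupp.weight wt μ ≤ e + i} =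
          {μ | e + Finsupp.weight wt μ ≤ e + i - 1} := by
        ext μ
        simp only [Set.mem_ofPred_eq]
        omega
      rw [this]
      exact hT f hf _
  rw [e1]
  exact sub_mem (hT f hf _) e2

/-- The exact sequence `k[τ]/(J : a) → k[τ]/J → k[τ]/(J + (a)) → 0` bounds growth functions. -/
theorem hilb_le_add [Finite τ] (hwt : ∀ t, wt t ≠ 0) {J : Ideal (MvPolynomial τ k)}
    (h : J.IsHomogeneous (weightedHomogeneousSubmodule k wt)) {a : MvPolynomial τ k} {e : ℕ}
    (ha : a ∈ weightedHomogeneousSubmodule k wt e) (m : ℕ) :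
    hilb wt J m ≤ hilb wt (J ⊔ Ideal.span {a}) m + hilb wt (colonElem J a) m := by
  have hf := finite_weightLE wt hwt m
  set U := (restrictSupport k (weightLE wt m)).map (Ideal.Quotient.mkₐ k J).toLinearMap
  have hJ : J ≤ J ⊔ Ideal.span {a} := le_sup_left
  have h1 := finrank_eq_map_add_inf_ker (Ideal.Quotient.factorₐ k hJ).toLinearMap U
  rw [map_factor wt hJ] at h1
  change hilb wt J m = hilb wt _ m + _ at h1
  rw [h1]
  refine Nat.add_le_add_left ?_ _
  -- Multiplication by `a` maps `k[τ]/(J : a)` onto the kernel of `k[τ]/J → k[τ]/(J + (a))`.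
  let ψ : MvPolynomial τ k →ₗ[k] (MvPolynomial τ k ⧸ J) :=
    (Ideal.Quotient.mkₐ k J).toLinearMap ∘ₗ LinearMap.mulLeft k a
  let φ : (MvPolynomial τ k ⧸ colonElem J a) →ₗ[k] (MvPolynomial τ k ⧸ J) :=
    Submodule.liftQ ((colonElem J a).restrictScalars k) ψ (by
      intro t ht
      rw [LinearMap.mem_ker]
      exact Ideal.Quotient.eq_zero_iff_mem.2 ht)
  have hφ : ∀ t, φ (Ideal.Quotient.mk _ t) = Ideal.Quotient.mk J (a * t) := fun t => rfl
  rw [hilb]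
  refine le_trans ?_ (Submodule.finrank_map_le φ _)
  refine Submodule.finrank_mono ?_
  rintro _ ⟨⟨s, hs, rfl⟩, hs2⟩
  have hs3 : s ∈ J ⊔ Ideal.span {a} := by
    rw [← Ideal.Quotient.eq_zero_iff_mem]
    exact hs2
  obtain ⟨j, hj, b, hb, rfl⟩ := Submodule.mem_sup.1 hs3
  obtain ⟨t, rfl⟩ := Ideal.mem_span_singleton'.1 hb
  have hs4 : part (weightLE wt m) (j + t * a) = j + t * a := part_eq_self_iff.2 hs
  rw [map_add, mul_comm t a, part_weightLE_mul wt ha] at hs4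
  refine ⟨_, ⟨part {μ | e + Finsupp.weight wt μ ≤ m} t, ?_, rfl⟩, ?_⟩
  · refine restrictSupport_mono k ?_ (part_mem _ t)
    intro μ hμ
    exact (Nat.le_add_left _ e).trans hμ
  · refine (hφ _).trans ?_
    refine Ideal.Quotient.eq.2 ?_
    rw [mul_comm t a, ← hs4, sub_add_cancel_right, neg_mem_iff]
    exact part_weightLE_mem wt h hj m

theorem GrowthLE.mono_add {J J₁ J₂ : Ideal (MvPolynomial τ k)} {r : ℕ}
    (h : ∀ m, hilb wt J m ≤ hilb wt J₁ m + hilb wt J₂ m) (h₁ : GrowthLE wt J₁ r)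
    (h₂ : GrowthLE wt J₂ r) : GrowthLE wt J r := by
  obtain ⟨C₁, hC₁⟩ := h₁
  obtain ⟨C₂, hC₂⟩ := h₂
  refine ⟨C₁ + C₂, fun m => ?_⟩
  calc _ ≤ (hilb wt J₁ m + hilb wt J₂ m) * (m + 1) ^ r := by gcongr; exact h m
    _ = hilb wt J₁ m * (m + 1) ^ r + hilb wt J₂ m * (m + 1) ^ r := by ring
    _ ≤ C₁ * (m + 1) ^ Nat.card τ + C₂ * (m + 1) ^ Nat.card τ := add_le_add (hC₁ m) (hC₂ m)
    _ = _ := by ring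

theorem growthLE_top (r : ℕ) : GrowthLE wt (⊤ : Ideal (MvPolynomial τ k)) r := by
  refine ⟨0, fun m => ?_⟩
  have : Subsingleton (MvPolynomial τ k ⧸ (⊤ : Ideal (MvPolynomial τ k))) :=
    Ideal.Quotient.subsingleton_iff.2 rfl
  rw [hilb, Module.finrank_zero_of_subsingleton]
  simp

/-- A homogeneous ideal of height at least `r` has growth of degree at most `|τ| - r`: by
noetherian induction along `J + (a)` and `(J : a)`, one reduces to prime ideals. -/
theorem growthLE_of_isHomogeneous [Finite τ] (hwt : ∀ t, wt t ≠ 0) (r : ℕ)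
    (J : Ideal (MvPolynomial τ k))
    (hJ : J.IsHomogeneous (weightedHomogeneousSubmodule k wt)) (hr : r ≤ J.height) :
    GrowthLE wt J r := by
  induction J using WellFoundedGT.induction with
  | ind J ih =>
    by_cases hT : J = ⊤
    · rw [hT]; exact growthLE_top wt r
    by_cases hP : J.IsPrime
    · exact growthLE_of_isPrime wt hwt r J hr
    have h : ∃ a b, SetLike.IsHomogeneousElem (weightedHomogeneousSubmodule k wt) a ∧
        a * b ∈ J ∧ a ∉ J ∧ b ∉ J := by
      by_contra hc
      push Not at hc
      refine hP (hJ.isPrime_of_homogeneous_mem_or_mem hT ?_)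
      intro x y hx hy hxy
      by_contra hxy2
      push Not at hxy2
      exact hxy2.2 (hc x y hx hxy hxy2.1)
    obtain ⟨a, b, ⟨e, ha⟩, hab, haJ, hbJ⟩ := h
    have hlt1 : J < J ⊔ Ideal.span {a} := by
      refine lt_of_le_of_ne le_sup_left fun hh => haJ ?_
      rw [hh]
      exact Submodule.mem_sup_right (Ideal.mem_span_singleton_self a)
    have hlt2 : J < colonElem J a := by
      refine lt_of_le_of_ne (le_colonElem J a) fun hh => hbJ ?_
      rw [hh]
      exact hab
    have hhom1 : (J ⊔ Ideal.span {a}).IsHomogeneous (weightedHomogeneousSubmodule k wt) := by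
      refine hJ.sup (Ideal.homogeneous_span _ _ ?_)
      rintro x rfl
      exact ⟨e, ha⟩
    exact GrowthLE.mono_add wt (hilb_le_add wt hwt hJ ha)
      (ih _ hlt1 hhom1 (hr.trans (Ideal.height_mono hlt1.le)))
      (ih _ hlt2 (colonElem_isHomogeneous wt hJ ha) (hr.trans (Ideal.height_mono hlt2.le)))

end GrowthHeight

/-! ### Heights of extended ideals in polynomial rings -/

section Extend

variable {R : Type*} [CommRing R]

theorem liesOver_map_C (p : Ideal R) : (p.map Polynomial.C).LiesOver p := by
  refine ⟨?_⟩
  ext r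
  change r ∈ p ↔ Polynomial.C r ∈ p.map Polynomial.C
  rw [Ideal.mem_map_C_iff]
  refine ⟨fun h n => ?_, fun h => by simpa using h 0⟩
  rw [Polynomial.coeff_C]
  split_ifs
  · exact h
  · exact zero_mem p

variable [IsNoetherianRing R]

/-- The height of `p[X]` equals that of `p`, for `p` prime. -/
theorem height_map_C_of_isPrime (p : Ideal R) [p.IsPrime] :
    (p.map Polynomial.C).height = p.height := by
  have := liesOver_map_C p
  have : (p.map (algebraMap R (Polynomial R))).IsPrime := Ideal.isPrime_map_C_of_isPrime
  have h := Ideal.height_eq_height_add_of_liesOver_of_hasGoingDown p (p.map Polynomial.C)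
  rw [Polynomial.algebraMap_eq, Ideal.map_quotient_self] at h
  rw [h]
  have := Ideal.Quotient.isDomain (p.map Polynomial.C)
  rw [Ideal.height_bot, add_zero]

/-- The height of `J[X]` equals that of `J`. -/
theorem height_map_C (J : Ideal R) : (J.map Polynomial.C).height = J.height := by
  refine le_antisymm ?_ ?_
  · rw [J.height_eq_inf_minimalPrimes]
    refine le_iInf₂ fun p hp => ?_
    have := hp.isPrime
    rw [← height_map_C_of_isPrime p]
    exact Ideal.height_mono (Ideal.map_mono hp.le)
  · rw [(J.map Polynomial.C).height_eq_inf_minimalPrimes]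
    refine le_iInf₂ fun Q hQ => ?_
    have := hQ.isPrime
    have h1 : J ≤ Q.comap Polynomial.C := Ideal.map_le_iff_le_comap.1 hQ.le
    refine (Ideal.height_mono h1).trans ?_
    rw [← height_map_C_of_isPrime]
    exact Ideal.height_mono Ideal.map_comap_le

end Extend

/-! ### Heights of homogeneous ideals are determined by growth -/

section Lower

/-- A set of variables that is algebraically independent modulo a prime `P`, of cardinality at
least `|τ| - height P`. -/
theorem exists_independent_vars {k : Type*} [Field k] {τ : Type*} [Finite τ] :
    ∀ (P : Ideal (MvPolynomial τ k)) [P.IsPrime], ∃ T : Finset τ,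
      (Nat.card τ : ℕ∞) ≤ T.card + P.height ∧
      ∀ f ∈ P, f ∈ restrictSupport k {μ : τ →₀ ℕ | ∀ t, t ∉ T → μ t = 0} → f = 0 := by
  classical
  induction τ using Finite.induction_empty_option with
  | @of_equiv α β e ih =>
    intro P hP
    let E := renameEquiv k e
    obtain ⟨T, hT, hT2⟩ := ih (P.comap E)
    refine ⟨T.map e.toEmbedding, ?_, fun f hf hf2 => ?_⟩
    · have h1 : (P.comap E).height = P.height := RingEquiv.height_comap E.toRingEquiv P
      rw [Finset.card_map, ← h1, ← Nat.card_congr e]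
      exact hT
    · have h0 : E.symm f = 0 := by
        refine hT2 _ ?_ ?_
        · rw [Ideal.mem_comap, AlgEquiv.apply_symm_apply]; exact hf
        · rw [mem_restrictSupport_iff_coeff] at hf2 ⊢
          intro μ hμ
          by_contra hc
          have h1 : coeff μ (rename e.symm f) ≠ 0 := hc
          obtain ⟨ν, rfl, hν⟩ := coeff_rename_ne_zero _ _ _ h1
          refine hν (hf2 ν fun hν2 => hμ fun t ht => ?_)
          rw [← e.symm_apply_apply t, Finsupp.mapDomain_apply e.symm.injective]
          exact hν2 _ (by simpa using ht)
      simpa using h0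
  | h_empty =>
    intro P hP
    refine ⟨∅, by simp, fun f hf _ => ?_⟩
    by_contra hne
    have h1 : f = C (coeff 0 f) := eq_C_of_isEmpty f
    refine hP.ne_top (P.eq_top_of_isUnit_mem hf ?_)
    rw [h1]
    refine (isUnit_iff_ne_zero.2 fun h0 => hne ?_).map C
    rw [h1, h0, map_zero]
  | @h_option σ _ ih =>
    intro P hP
    let e := optionEquivLeft k σ
    let Q : Ideal (Polynomial (MvPolynomial σ k)) := P.comap e.symm
    have hQ : Q.IsPrime := Ideal.IsPrime.comap _
    have hht : Q.height = P.height := RingEquiv.height_comap e.symm.toRingEquiv P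
    let p : Ideal (MvPolynomial σ k) := Q.comap Polynomial.C
    have hp : p.IsPrime := Ideal.IsPrime.comap _
    have hpQ : p.map Polynomial.C ≤ Q := Ideal.map_comap_le
    obtain ⟨T, hT, hT2⟩ := ih p
    have hmem : ∀ f ∈ P, e f ∈ Q := fun f hf => by
      rw [Ideal.mem_comap, AlgEquiv.symm_apply_apply]; exact hf
    have hcoeff : ∀ (f : MvPolynomial (Option σ) k) (T' : Finset (Option σ)),
        (∀ t, some t ∈ T' → t ∈ T) →
        f ∈ restrictSupport k {μ : Option σ →₀ ℕ | ∀ t, t ∉ T' → μ t = 0} → ∀ c,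
        (e f).coeff c ∈ restrictSupport k {μ : σ →₀ ℕ | ∀ t, t ∉ T → μ t = 0} := by
      intro f T' hT' hf c
      rw [mem_restrictSupport_iff_coeff] at hf ⊢
      intro μ hμ
      have h1 := optionEquivLeft_coeff_some_coeff_none k σ (μ.optionElim c) f
      rw [Finsupp.some_optionElim, Finsupp.optionElim_apply_none] at h1
      rw [h1]
      refine hf _ fun h2 => hμ fun t ht => ?_
      rw [← Finsupp.optionElim_apply_some c μ t]
      exact h2 _ fun h3 => ht (hT' t h3)
    -- The additional variable is independent modulo `Q` when `Q` is extended from `p`; otherwise `Q`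
    -- has greater height than `p`.
    by_cases hc : Q = p.map Polynomial.C
    · refine ⟨Finset.insertNone T, ?_, fun f hf hf2 => ?_⟩
      · rw [← hht, hc, height_map_C_of_isPrime]
        simp only [Nat.card_eq_fintype_card, Fintype.card_option, Finset.card_insertNone] at hT ⊢
        push_cast
        rw [add_right_comm]
        gcongr
      · have h1 := hmem f hf
        rw [hc, Ideal.mem_map_C_iff] at h1
        have h2 : e f = 0 := by
          ext1 c
          exact hT2 _ (h1 c) (hcoeff f _ (by simp) hf2 c)
        simpa using h2
    · refine ⟨T.map Function.Embedding.some, ?_, fun f hf hf2 => ?_⟩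
      · have h1 : p.map Polynomial.C < Q := lt_of_le_of_ne hpQ (Ne.symm hc)
        have : (p.map Polynomial.C).IsPrime := Ideal.isPrime_map_C_of_isPrime
        have h2 := Ideal.height_add_one_le_of_lt_of_isPrime h1
        rw [height_map_C_of_isPrime, hht] at h2
        simp only [Nat.card_eq_fintype_card, Fintype.card_option, Finset.card_map] at hT ⊢
        push_cast
        calc (Fintype.card σ : ℕ∞) + 1 ≤ T.card + p.height + 1 := by gcongr
          _ = T.card + (p.height + 1) := add_assoc _ _ _
          _ ≤ _ := by gcongr
      · have h3 : ∀ c, c ≠ 0 → (e f).coeff c = 0 := by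
          intro c hc0
          ext μ
          have h1 := optionEquivLeft_coeff_some_coeff_none k σ (μ.optionElim c) f
          rw [Finsupp.some_optionElim, Finsupp.optionElim_apply_none] at h1
          rw [h1, coeff_zero]
          rw [mem_restrictSupport_iff_coeff] at hf2
          refine hf2 _ fun h2 => hc0 ?_
          rw [← Finsupp.optionElim_apply_none c μ]
          exact h2 none (by simp)
        have h4 : e f = Polynomial.C ((e f).coeff 0) := by
          ext1 c
          rw [Polynomial.coeff_C]
          split_ifs with h
          · rw [h]
          · exact h3 c h
        have h5 : (e f).coeff 0 = 0 := by
          refine hT2 _ ?_ (hcoeff f _ (by simp) hf2 0)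
          rw [Ideal.mem_comap, ← h4]
          exact hmem f hf
        have h6 : e f = 0 := by rw [h4, h5, map_zero]
        simpa using h6

variable {k τ : Type*} [Field k] [Finite τ] (wt : τ → ℕ)

/-- The growth of `k[τ]/P` is at least that of a polynomial ring in `|τ| - height P` variables. -/
theorem le_height_of_growthLE_of_isPrime (hwt : ∀ t, wt t ≠ 0) (P : Ideal (MvPolynomial τ k))
    [P.IsPrime] {r : ℕ} (h : GrowthLE wt P r) : (r : ℕ∞) ≤ P.height := by
  classical
  have := Fintype.ofFinite τ
  obtain ⟨T, hT, hT2⟩ := exists_independent_vars P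
  obtain ⟨C, hC⟩ := h
  set W := ∑ t, wt t + 1
  -- The monomials in the variables of `T` with exponents at most `j` are independent modulo `P`.
  have hcount : ∀ j : ℕ, (j + 1) ^ T.card ≤ hilb wt P (j * W) := by
    intro j
    let X : Set (τ →₀ ℕ) := {μ | (∀ t, t ∉ T → μ t = 0) ∧ ∀ t, μ t ≤ j}
    have hXT : X ⊆ {μ | ∀ t, t ∉ T → μ t = 0} := fun μ hμ => hμ.1
    have hX : X ⊆ weightLE wt (j * W) := by
      intro μ hμ
      change Finsupp.weight wt μ ≤ j * W
      rw [Finsupp.weight_eq_sum, mul_add, Finset.mul_sum]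
      refine le_add_right ?_
      exact Finset.sum_le_sum fun t _ => Nat.mul_le_mul_right _ (hμ.2 t)
    have hfin := finite_weightLE wt hwt (j * W)
    have hXfin : Finite X := Finite.Set.subset _ hX
    have h1 : (j + 1) ^ T.card ≤ Nat.card X := by
      have h2 := Nat.card_le_card_of_injective
        (fun (g : T → Fin (j + 1)) => (⟨Finsupp.equivFunOnFinite.symm
          (fun t => if h : t ∈ T then (g ⟨t, h⟩ : ℕ) else 0), by
            constructor
            · intro t ht
              simp [ht]
            · intro t
              simp only [Finsupp.equivFunOnFinite_symm_apply_apply]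
              split_ifs
              · exact Nat.lt_succ_iff.1 (g _).2
              · exact Nat.zero_le _⟩ : X)) (by
          intro g g' hgg
          funext t
          have h3 := congrArg (fun μ : X => μ.1 t.1) hgg
          simpa [Fin.ext_iff] using h3)
      simpa [Nat.card_fun] using h2
    refine h1.trans ?_
    rw [← finrank_restrictSupport (k := k)]
    have h3 : Disjoint (restrictSupport k X)
        (LinearMap.ker (Ideal.Quotient.mkₐ k P).toLinearMap) := by
      rw [Submodule.disjoint_def]
      intro f hf hf2
      refine hT2 f ?_ (restrictSupport_mono k hXT hf)
      exact Ideal.Quotient.eq_zero_iff_mem.1 hf2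
    have h4 := finrank_eq_map_add_inf_ker (Ideal.Quotient.mkₐ k P).toLinearMap (restrictSupport k X)
    rw [h3.eq_bot, finrank_bot, add_zero] at h4
    rw [h4]
    exact Submodule.finrank_mono (Submodule.map_mono (restrictSupport_mono k hX))
  have hle : T.card + r ≤ Nat.card τ := by
    by_contra hlt
    push Not at hlt
    set K := C * (W + 1) ^ Nat.card τ
    have h1 := hC (K * W)
    have h2 := hcount K
    have hW : 0 < W := Nat.succ_pos _
    have h3 : (K + 1) ^ (T.card + r) ≤ K * (K + 1) ^ Nat.card τ := by
      calc (K + 1) ^ (T.card + r) = (K + 1) ^ T.card * (K + 1) ^ r := pow_add _ _ _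
        _ ≤ hilb wt P (K * W) * (K * W + 1) ^ r := by
          gcongr
          exact Nat.le_mul_of_pos_right K hW
        _ ≤ C * (K * W + 1) ^ Nat.card τ := h1
        _ ≤ C * ((W + 1) * (K + 1)) ^ Nat.card τ := by
          gcongr
          nlinarith
        _ = _ := by rw [mul_pow]; ring
    have h4 : (K + 1) * (K + 1) ^ Nat.card τ ≤ (K + 1) ^ (T.card + r) := by
      rw [← pow_succ']
      exact Nat.pow_le_pow_right (Nat.succ_pos K) hlt
    have h5 := h4.trans h3
    have h6 : 0 < (K + 1) ^ Nat.card τ := by positivity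
    have := Nat.le_of_mul_le_mul_right h5 h6
    omega
  have h1 : ((T.card + r : ℕ) : ℕ∞) ≤ T.card + P.height := le_trans (by exact_mod_cast hle) hT
  push_cast at h1
  exact (ENat.add_le_add_iff_left (ENat.natCast_ne_top _)).1 h1

attribute [local instance] MvPolynomial.weightedGradedAlgebra

/-- The height of a homogeneous ideal is determined by the growth of the quotient ring. -/
theorem growthLE_iff_le_height (hwt : ∀ t, wt t ≠ 0) {J : Ideal (MvPolynomial τ k)}
    (hJ : J.IsHomogeneous (weightedHomogeneousSubmodule k wt)) (r : ℕ) :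
    GrowthLE wt J r ↔ (r : ℕ∞) ≤ J.height := by
  refine ⟨fun h => ?_, growthLE_of_isHomogeneous wt hwt r J hJ⟩
  rw [J.height_eq_inf_minimalPrimes]
  refine le_iInf₂ fun P hP => ?_
  have := hP.isPrime
  refine le_height_of_growthLE_of_isPrime wt hwt P ?_
  obtain ⟨C, hC⟩ := h
  exact ⟨C, fun m => le_trans (Nat.mul_le_mul_right _ (hilb_anti wt hwt hP.le m)) (hC m)⟩

/-- Homogeneous ideals with the same Hilbert function have the same height. -/
theorem height_eq_of_finrank_eq (hwt : ∀ t, wt t ≠ 0) {J J' : Ideal (MvPolynomial τ k)}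
    (hJ : J.IsHomogeneous (weightedHomogeneousSubmodule k wt))
    (hJ' : J'.IsHomogeneous (weightedHomogeneousSubmodule k wt))
    (h : ∀ m, Module.finrank k (J.restrictScalars k ⊓ restrictSupport k (weightLE wt m) :
        Submodule k (MvPolynomial τ k)) =
      Module.finrank k (J'.restrictScalars k ⊓ restrictSupport k (weightLE wt m) :
        Submodule k (MvPolynomial τ k))) :
    J.height = J'.height := by
  have hd : ∀ (L : Ideal (MvPolynomial τ k)) (m : ℕ),
      Module.finrank k (restrictSupport k (weightLE wt m)) = hilb wt L m +
        Module.finrank k (L.restrictScalars k ⊓ restrictSupport k (weightLE wt m) :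
          Submodule k (MvPolynomial τ k)) := by
    intro L m
    have hf := finite_weightLE wt hwt m
    have e : LinearMap.ker (Ideal.Quotient.mkₐ k L).toLinearMap = L.restrictScalars k := by
      ext f
      exact Ideal.Quotient.eq_zero_iff_mem
    rw [inf_comm, ← e]
    exact finrank_eq_map_add_inf_ker _ _
  have hh : hilb wt J = hilb wt J' := by
    funext m
    have h1 := hd J m
    rw [hd J' m, h m] at h1
    exact (Nat.add_right_cancel h1).symm
  refine ENat.eq_of_forall_natCast_le_iff fun r => ?_
  rw [← growthLE_iff_le_height wt hwt hJ, ← growthLE_iff_le_height wt hwt hJ', GrowthLE, GrowthLE,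
    hh]

end Lower

/-! ### Initial subspaces -/

section Initial

variable {k τ : Type*} [Field k]

/-- Passing from `K` to the space `K'` spanned by the top `ω`-forms of its elements preserves the
dimension of the part supported on a finite set `X` of monomials, if `K` is stable under truncation
to `X`. -/
theorem finrank_initial_eq {X : Set (τ →₀ ℕ)} (hX : X.Finite) (ω : (τ →₀ ℕ) → ℤ)
    {K K' : Submodule k (MvPolynomial τ k)} (hK : ∀ f ∈ K, part X f ∈ K)
    (hK' : ∀ f, f ∈ K' ↔ ∀ e : ℤ, part {μ | ω μ = e} f ∈ K ⊔ restrictSupport k {μ | ω μ ≤ e - 1}) :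
    Module.finrank k (K ⊓ restrictSupport k X : Submodule k (MvPolynomial τ k)) =
      Module.finrank k (K' ⊓ restrictSupport k X : Submodule k (MvPolynomial τ k)) := by
  classical
  let Y : ℤ → Set (τ →₀ ℕ) := fun e => X ∩ {μ | ω μ ≤ e}
  have hYX : ∀ e, Y e ⊆ X := fun e => Set.inter_subset_left
  have hfin : ∀ e, Finite (Y e) := fun e => (hX.subset (hYX e)).to_subtype
  have hfinU : ∀ (L : Submodule k (MvPolynomial τ k)) e,
      Module.Finite k (L ⊓ restrictSupport k (Y e) : Submodule k (MvPolynomial τ k)) :=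
    fun L e => Submodule.finiteDimensional_of_le inf_le_right
  have hker : ∀ (L : Submodule k (MvPolynomial τ k)) e,
      L ⊓ restrictSupport k (Y e) ⊓ LinearMap.ker (part {μ | ω μ = e}) =
        L ⊓ restrictSupport k (Y (e - 1)) := by
    intro L e
    ext f
    simp only [Submodule.mem_inf, LinearMap.mem_ker, part_eq_zero_iff, Set.mem_ofPred_eq,
      mem_restrictSupport_iff_coeff, and_assoc]
    refine and_congr_right fun _ => ⟨fun ⟨h1, h2⟩ μ hμ => ?_, fun h => ⟨fun μ hμ => h μ fun h' =>
      hμ ⟨h'.1, ?_⟩, fun μ hμ => h μ fun h' => ?_⟩⟩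
    · by_cases he : ω μ = e
      · exact h2 μ he
      · refine h1 μ fun h' => hμ ⟨h'.1, ?_⟩
        have h3 : ω μ ≤ e := h'.2
        change ω μ ≤ e - 1
        omega
    · have h3 : ω μ ≤ e - 1 := h'.2
      change ω μ ≤ e
      omega
    · have h3 : ω μ ≤ e - 1 := h'.2
      omega
  -- The parts of degree `e` of the elements of degree at most `e` are the same for `K` and `K'`.
  have hmap : ∀ e, (K ⊓ restrictSupport k (Y e)).map (part {μ | ω μ = e}) =
      (K' ⊓ restrictSupport k (Y e)).map (part {μ | ω μ = e}) := by
    intro e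
    apply le_antisymm
    · rintro _ ⟨u, ⟨hu1, hu2⟩, rfl⟩
      refine ⟨part {μ | ω μ = e} u, ⟨?_, ?_⟩, ?_⟩
      · refine (hK' _).2 fun e' => ?_
        rw [part_part]
        by_cases he : e' = e
        · subst he
          rw [Set.inter_self]
          have h1 : part {μ | ω μ = e'} u = u - part {μ | ω μ ≤ e' - 1} u := by
            have hu3 := mem_restrictSupport_iff_coeff.1 hu2
            ext μ
            simp only [coeff_part, coeff_sub, Set.mem_ofPred_eq]
            rcases lt_trichotomy (ω μ) e' with h | h | h
            · rw [if_neg h.ne, if_pos (by omega), sub_self]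
            · rw [if_pos h, if_neg (by omega), sub_zero]
            · rw [if_neg (by omega), if_neg (by omega), hu3 μ, sub_zero]
              rintro ⟨_, h4⟩
              have h4 : ω μ ≤ e' := h4
              omega
          rw [h1]
          exact sub_mem (Submodule.mem_sup_left hu1) (Submodule.mem_sup_right (part_mem _ _))
        · have : ({μ | ω μ = e'} ∩ {μ | ω μ = e} : Set (τ →₀ ℕ)) = ∅ := by
            ext μ
            simp only [Set.mem_inter_iff, Set.mem_ofPred_eq, Set.mem_empty_iff_false, iff_false]
            rintro ⟨h1, h2⟩
            exact he (h1.symm.trans h2)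
          have h0 : part ({μ | ω μ = e'} ∩ {μ | ω μ = e}) u = 0 := by
            rw [this, part_eq_zero_iff]
            exact fun μ hμ => hμ.elim
          rw [h0]
          exact zero_mem _
      · exact restrictSupport_mono k Set.inter_subset_right (part_mem_of_mem hu2)
      · rw [part_part, Set.inter_self]
    · rintro _ ⟨u, ⟨hu1, hu2⟩, rfl⟩
      obtain ⟨κ, hκ, ρ, hρ, h1⟩ := Submodule.mem_sup.1 ((hK' u).1 hu1 e)
      have h2 : part X κ = part {μ | ω μ = e} u - part X ρ := by
        have h3 : part X (part {μ | ω μ = e} u) = part {μ | ω μ = e} u := by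
          rw [part_eq_self_iff]
          exact restrictSupport_mono k (Set.inter_subset_right.trans (hYX e)) (part_mem_of_mem hu2)
        rw [← h3, ← h1, map_add, add_sub_cancel_right]
      refine ⟨part X κ, ⟨hK κ hκ, ?_⟩, ?_⟩
      · rw [h2]
        refine sub_mem (restrictSupport_mono k Set.inter_subset_right (part_mem_of_mem hu2)) ?_
        refine restrictSupport_mono k ?_ (part_mem_of_mem hρ)
        rintro μ ⟨h3, h4⟩
        have h4 : ω μ ≤ e - 1 := h4
        exact ⟨h3, show ω μ ≤ e by omega⟩
      · rw [h2, map_sub, part_part, Set.inter_self, sub_eq_self, part_eq_zero_iff]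
        intro μ hμ
        refine mem_restrictSupport_iff_coeff.1 (part_mem_of_mem (X := X) hρ) μ ?_
        rintro ⟨_, h4⟩
        have h4 : ω μ ≤ e - 1 := h4
        have h5 : ω μ = e := hμ
        omega
  have hstep : ∀ e, Module.finrank k (K ⊓ restrictSupport k (Y (e - 1)) :
        Submodule k (MvPolynomial τ k)) =
      Module.finrank k (K' ⊓ restrictSupport k (Y (e - 1)) : Submodule k (MvPolynomial τ k)) →
      Module.finrank k (K ⊓ restrictSupport k (Y e) : Submodule k (MvPolynomial τ k)) =
      Module.finrank k (K' ⊓ restrictSupport k (Y e) : Submodule k (MvPolynomial τ k)) := by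
    intro e h
    have := hfinU K e
    have := hfinU K' e
    rw [finrank_eq_map_add_inf_ker (part {μ | ω μ = e}) (K ⊓ restrictSupport k (Y e)),
      finrank_eq_map_add_inf_ker (part {μ | ω μ = e}) (K' ⊓ restrictSupport k (Y e)),
      hker, hker, hmap, h]
  obtain ⟨a, ha⟩ := (hX.image ω).bddBelow
  obtain ⟨b, hb⟩ := (hX.image ω).bddAbove
  have hlow : Y (a - 1) = ∅ := by
    ext μ
    simp only [Set.mem_empty_iff_false, iff_false]
    rintro ⟨h1, h2⟩
    have h2 : ω μ ≤ a - 1 := h2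
    have := ha (Set.mem_image_of_mem ω h1)
    omega
  have hhigh : Y (max a b) = X := by
    refine Set.inter_eq_left.2 fun μ hμ => ?_
    exact (hb (Set.mem_image_of_mem ω hμ)).trans (le_max_right a b)
  have hbase : restrictSupport k (Y (a - 1)) = ⊥ := by
    rw [hlow, eq_bot_iff]
    intro f hf
    rw [Submodule.mem_bot]
    ext μ
    exact mem_restrictSupport_iff_coeff.1 hf μ (Set.notMem_empty μ)
  have hind : ∀ e, a - 1 ≤ e →
      Module.finrank k (K ⊓ restrictSupport k (Y e) : Submodule k (MvPolynomial τ k)) =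
      Module.finrank k (K' ⊓ restrictSupport k (Y e) : Submodule k (MvPolynomial τ k)) := by
    intro e he
    induction e, he using Int.leInduction with
    | base => rw [hbase, inf_bot_eq, inf_bot_eq]
    | succ e _ ih => exact hstep (e + 1) (by rwa [add_sub_cancel_right])
  rw [← hhigh]
  exact hind _ (by have := le_max_left a b; omega)

end Initial

/-! ### Annihilators of cyclic graded modules -/

/-- Induction on exponents, adding one variable at a time. -/
@[elab_as_elim]
theorem exp_induction {τ : Type*} {motive : (τ →₀ ℕ) → Prop} (μ : τ →₀ ℕ) (zero : motive 0)
    (add_single : ∀ μ t, motive μ → motive (μ + Finsupp.single t 1)) : motive μ := by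
  induction μ using Finsupp.induction₂ with
  | zero => exact zero
  | add_single t b μ _ _ ih =>
    clear * - ih add_single
    induction b with
    | zero => simpa using ih
    | succ b ihb =>
      rw [Finsupp.single_add, ← add_assoc]
      exact add_single _ t ihb

namespace GradingData

section Annihilator

variable {ι : Type*} [AddCommGroup ι] {A : Type*} [Ring A] [Algebra ℂ A] (P : GradingData ι A)
variable {M : Type*} [AddCommGroup M] [Module A M] (m : M)

theorem smul_gen_mem {i : ι} {a : A} (ha : a ∈ P.F i) : a • m ∈ quotFilt (P.F i) m :=
  mem_quotFilt.2 ⟨a, ha, rfl⟩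

/-- The map `F i / F' i → (F i • m) / (F' i • m)` given by the action on the generator `m`. -/
def genMap (i : ι) : P.Piece i →+ P.ModPiece m i :=
  AddMonoidHom.mk' (Quotient.map (fun a => ⟨(a : A) • m, P.smul_gen_mem m a.2⟩) (by
    intro a b h
    refine QuotientAddGroup.leftRel_apply.2 ?_
    rw [AddSubgroup.mem_addSubgroupOf]
    have h1 : -((a : A) • m) + (b : A) • m = -(((a : A) - b) • m) := by
      rw [sub_smul]; abel
    change -((a : A) • m) + (b : A) • m ∈ _
    rw [h1]
    exact neg_mem (mem_quotFilt.2 ⟨_, P.sub_mem_of_cls h, rfl⟩))) (by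
    intro x y
    obtain ⟨a, ha, rfl⟩ := P.exists_cls x
    obtain ⟨b, hb, rfl⟩ := P.exists_cls y
    exact P.modCls_eq m (by simp [add_smul]))

theorem genMap_cls {i : ι} {a : A} (ha : a ∈ P.F i) :
    P.genMap m i (P.cls a ha) = P.modCls m (a • m) (P.smul_gen_mem m ha) := rfl

theorem modCls_eq_zero_iff {i : ι} {x : M} (hx : x ∈ quotFilt (P.F i) m) :
    P.modCls m x hx = 0 ↔ x ∈ quotFilt (P.F' i) m := by
  refine (QuotientAddGroup.eq_zero_iff _).trans ?_
  rw [AddSubgroup.mem_addSubgroupOf]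

theorem cls_eq_zero_iff {i : ι} {a : A} (ha : a ∈ P.F i) : P.cls a ha = 0 ↔ a ∈ P.F' i :=
  Submodule.Quotient.mk_eq_zero _

theorem genMap_cls_eq_zero_iff {i : ι} {a : A} (ha : a ∈ P.F i) :
    P.genMap m i (P.cls a ha) = 0 ↔ ∃ b ∈ P.F' i, (a - b) • m = 0 := by
  rw [genMap_cls, modCls_eq_zero_iff, mem_quotFilt]
  refine exists_congr fun b => and_congr_right fun _ => ?_
  rw [sub_smul, sub_eq_zero, eq_comm]

variable [DecidableEq ι]

theorem smul_grGen (x : P.Gr) (i : ι) : (x • P.grGen m) i = P.genMap m i (x i) := by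
  have h : (DirectSum.Gmodule.smulAddMonoidHom P.Piece (P.ModPiece m)).flip (P.grGen m) =
      DirectSum.toAddMonoid (fun i => (DirectSum.of (P.ModPiece m) i).comp (P.genMap m i)) := by
    refine DirectSum.addHom_ext fun j y => ?_
    obtain ⟨a, ha, rfl⟩ := P.exists_cls y
    rw [AddMonoidHom.flip_apply, grGen, DirectSum.Gmodule.smulAddMonoidHom_apply_of_of,
      DirectSum.toAddMonoid_of, AddMonoidHom.comp_apply, genMap_cls]
    exact DirectSum.of_eq_of_gradedMonoid_eq (P.mk_modCls_congr m (add_zero j) rfl)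
  have h1 : x • P.grGen m =
      DirectSum.toAddMonoid (fun i => (DirectSum.of (P.ModPiece m) i).comp (P.genMap m i)) x := by
    rw [← h]; rfl
  rw [h1]
  clear h1 h
  induction x using DirectSum.induction_on with
  | zero => simp
  | of j y =>
    rw [DirectSum.toAddMonoid_of, AddMonoidHom.comp_apply]
    by_cases hij : j = i
    · subst hij
      rw [DirectSum.of_eq_same, DirectSum.of_eq_same]
    · rw [DirectSum.of_eq_of_ne _ _ _ (Ne.symm hij), DirectSum.of_eq_of_ne _ _ _ (Ne.symm hij),
        map_zero]
  | add x y hx hy =>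
    rw [map_add, DirectSum.add_apply, hx, hy, DirectSum.add_apply, map_add]

theorem hom_smul_grGen {i : ι} {a : A} (ha : a ∈ P.F i) :
    P.hom i a ha • P.grGen m = DirectSum.of (P.ModPiece m) i (P.genMap m i (P.cls a ha)) := by
  refine DFinsupp.ext fun j => ?_
  change (P.hom i a ha • P.grGen m) j = _
  rw [smul_grGen, hom]
  by_cases hij : i = j
  · subst hij
    rw [DirectSum.of_eq_same, DirectSum.of_eq_same]
  · rw [DirectSum.of_eq_of_ne _ _ _ (Ne.symm hij), DirectSum.of_eq_of_ne _ _ _ (Ne.symm hij),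
      map_zero]

/-- The graded module is cyclic, so over a commutative graded ring its annihilator is that of the
generator. -/
theorem mem_annihilator_iff [P.IsComm] (x : P.Gr) :
    x ∈ Module.annihilator P.Gr (P.GrMod m) ↔ x • P.grGen m = 0 := by
  rw [Module.mem_annihilator]
  refine ⟨fun h => h _, fun h y => ?_⟩
  induction y using DirectSum.induction_on with
  | zero => exact smul_zero x
  | add y z hy hz => rw [smul_add, hy, hz, add_zero]
  | of j y =>
    obtain ⟨z, hz, rfl⟩ := P.exists_modCls m y
    obtain ⟨b, hb, rfl⟩ := mem_quotFilt.1 hz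
    have h1 : DirectSum.of (P.ModPiece m) j (P.modCls m (b • m) hz) = P.hom j b hb • P.grGen m := by
      rw [hom_smul_grGen]; rfl
    rw [h1, ← mul_smul, mul_comm, mul_smul, h, smul_zero]

end Annihilator

/-! ### Graded rings with a basis of monomials -/

/-- The linear map on polynomials induced by a map `κ` of exponents. -/
def _root_.BifilteredWeyl.expMap {k τ σ : Type*} [Field k] (κ : (τ →₀ ℕ) → (σ →₀ ℕ)) :
    MvPolynomial τ k →ₗ[k] MvPolynomial σ k :=
  (basisMonomials τ k).constr k (fun μ => monomial (κ μ) 1)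

section ExpMap

variable {k τ σ : Type*} [Field k] (κ : (τ →₀ ℕ) → (σ →₀ ℕ))

theorem _root_.BifilteredWeyl.constr_basisMonomials_monomial {V : Type*} [AddCommGroup V]
    [Module k V] (v : (τ →₀ ℕ) → V) (μ : τ →₀ ℕ) (c : k) :
    (basisMonomials τ k).constr k v (monomial μ c) = c • v μ := by
  have h : (monomial μ c : MvPolynomial τ k) = c • monomial μ 1 := by simp [smul_monomial]
  have := (basisMonomials τ k).constr_basis k v μ
  rw [coe_basisMonomials] at this
  rw [h, map_smul, this]

theorem _root_.BifilteredWeyl.expMap_monomial (μ : τ →₀ ℕ) (c : k) :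
    expMap κ (monomial μ c) = monomial (κ μ) c := by
  rw [expMap, constr_basisMonomials_monomial, smul_monomial, smul_eq_mul, mul_one]

theorem _root_.BifilteredWeyl.expMap_mem {X : Set (τ →₀ ℕ)} {Y : Set (σ →₀ ℕ)}
    (h : ∀ μ ∈ X, κ μ ∈ Y) {f : MvPolynomial τ k} (hf : f ∈ restrictSupport k X) :
    expMap κ f ∈ restrictSupport k Y := by
  rw [restrictSupport_eq_span] at hf
  induction hf using Submodule.span_induction with
  | mem x hx =>
    obtain ⟨μ, hμ, rfl⟩ := hx
    rw [expMap_monomial, monomial_mem_restrictSupport]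
    exact Or.inl (h μ hμ)
  | zero => rw [map_zero]; exact zero_mem _
  | add x y _ _ hx hy => rw [map_add]; exact add_mem hx hy
  | smul c x _ hx => rw [map_smul]; exact Submodule.smul_mem _ c hx

theorem _root_.BifilteredWeyl.coeff_expMap {X : Set (τ →₀ ℕ)} (hκ : Set.InjOn κ X) {μ : τ →₀ ℕ}
    (hμ : μ ∈ X) {f : MvPolynomial τ k} (hf : f ∈ restrictSupport k X) :
    coeff (κ μ) (expMap κ f) = coeff μ f := by
  classical
  rw [restrictSupport_eq_span] at hf
  induction hf using Submodule.span_induction with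
  | mem x hx =>
    obtain ⟨ν, hν, rfl⟩ := hx
    simp only [expMap_monomial, coeff_monomial, hκ.eq_iff hν hμ]
  | zero => rw [map_zero, coeff_zero, coeff_zero]
  | add x y _ _ hx hy => rw [map_add, coeff_add, coeff_add, hx, hy]
  | smul c x _ hx => rw [map_smul, coeff_smul, coeff_smul, hx]

end ExpMap

variable {ι : Type*} [AddCommGroup ι] {A : Type*} [Ring A] [Algebra ℂ A]

/-- A presentation of the graded ring of `P` by monomials.  The algebra `A` has a basis
`q (monomial s 1)` indexed by exponents `s : σ →₀ ℕ`, adapted to the subspaces `F i` and `F' i`;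
the exponents `μ : τ →₀ ℕ` of degree `i` correspond under `κ` to the basis elements of `F i` that
are not in `F' i`. -/
structure MonomialPresentation (P : GradingData ι A) (τ σ : Type*) where
  q : MvPolynomial σ ℂ ≃ₗ[ℂ] A
  κ : (τ →₀ ℕ) → (σ →₀ ℕ)
  deg : (τ →₀ ℕ) → ι
  E : ι → Set (σ →₀ ℕ)
  E' : ι → Set (σ →₀ ℕ)
  F_eq : ∀ i, P.F i = (restrictSupport ℂ (E i)).map q.toLinearMap
  F'_eq : ∀ i, P.F' i = (restrictSupport ℂ (E' i)).map q.toLinearMap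
  mem_E : ∀ μ, κ μ ∈ E (deg μ)
  notMem_E' : ∀ μ, κ μ ∉ E' (deg μ)
  injOn : ∀ i, Set.InjOn κ {μ | deg μ = i}
  exists_exp : ∀ i, ∀ s ∈ E i, s ∉ E' i → ∃ μ, deg μ = i ∧ κ μ = s

namespace MonomialPresentation

variable {P : GradingData ι A} {τ σ : Type*} (p : MonomialPresentation P τ σ)

theorem q_mem_F {i : ι} {g : MvPolynomial σ ℂ} : p.q g ∈ P.F i ↔ g ∈ restrictSupport ℂ (p.E i) := by
  rw [p.F_eq]
  exact ⟨fun ⟨x, hx, h⟩ => p.q.injective h ▸ hx, fun h => ⟨g, h, rfl⟩⟩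

theorem q_mem_F' {i : ι} {g : MvPolynomial σ ℂ} :
    p.q g ∈ P.F' i ↔ g ∈ restrictSupport ℂ (p.E' i) := by
  rw [p.F'_eq]
  exact ⟨fun ⟨x, hx, h⟩ => p.q.injective h ▸ hx, fun h => ⟨g, h, rfl⟩⟩

theorem expMap_part_mem (i : ι) (f : MvPolynomial τ ℂ) :
    p.q (expMap p.κ (part {μ | p.deg μ = i} f)) ∈ P.F i := by
  rw [q_mem_F]
  refine expMap_mem p.κ ?_ (part_mem _ f)
  rintro μ rfl
  exact p.mem_E μ

theorem q_monomial_mem (μ : τ →₀ ℕ) : p.q (monomial (p.κ μ) 1) ∈ P.F (p.deg μ) := by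
  rw [q_mem_F, monomial_mem_restrictSupport]
  exact Or.inl (p.mem_E μ)

variable [DecidableEq ι]

/-- The class in the graded ring of the basis element attached to an exponent. -/
def homMon (μ : τ →₀ ℕ) : P.Gr :=
  P.hom (p.deg μ) (p.q (monomial (p.κ μ) 1)) (p.q_monomial_mem μ)

/-- The linear map from polynomials to the graded ring determined by the presentation. -/
def toGr : MvPolynomial τ ℂ →ₗ[ℂ] P.Gr := (basisMonomials τ ℂ).constr ℂ p.homMon

theorem toGr_monomial (μ : τ →₀ ℕ) (c : ℂ) : p.toGr (monomial μ c) = c • p.homMon μ := by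
  rw [toGr, constr_basisMonomials_monomial]

theorem toGr_apply (f : MvPolynomial τ ℂ) (i : ι) :
    p.toGr f i = P.cls (p.q (expMap p.κ (part {μ | p.deg μ = i} f))) (p.expMap_part_mem i f) := by
  classical
  induction f using MvPolynomial.induction_on' with
  | add f g hf hg =>
    rw [map_add, DirectSum.add_apply, hf, hg, cls_add]
    exact P.cls_eq (by simp)
  | monomial μ c =>
    rw [toGr_monomial]
    by_cases h : p.deg μ = i
    · subst h
      have h1 : (c • p.homMon μ) (p.deg μ) = c • (p.homMon μ (p.deg μ)) := rfl
      rw [h1, homMon, hom, DirectSum.of_eq_same]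
      have h2 : c • P.cls (p.q (monomial (p.κ μ) 1)) (p.q_monomial_mem μ) =
          P.cls (c • p.q (monomial (p.κ μ) 1)) (Submodule.smul_mem _ c (p.q_monomial_mem μ)) := rfl
      rw [h2]
      refine P.cls_eq ?_
      rw [part_monomial, if_pos (by simp), expMap_monomial, ← map_smul, smul_monomial, smul_eq_mul,
        mul_one, sub_self]
      exact zero_mem _
    · have h1 : (c • p.homMon μ) i = c • (p.homMon μ i) := rfl
      rw [h1, homMon, hom, DirectSum.of_eq_of_ne _ _ _ (Ne.symm h), smul_zero]
      symm
      rw [cls_eq_zero_iff, part_monomial, if_neg (by simpa using h), map_zero, map_zero]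
      exact zero_mem _

theorem toGr_injective : Function.Injective p.toGr := by
  classical
  rw [injective_iff_map_eq_zero]
  intro f hf
  ext μ
  have h := p.toGr_apply f (p.deg μ)
  rw [hf] at h
  have h1 := (P.cls_eq_zero_iff _).1 h.symm
  rw [q_mem_F', mem_restrictSupport_iff_coeff] at h1
  have h2 := h1 _ (p.notMem_E' μ)
  rw [coeff_expMap p.κ (p.injOn (p.deg μ)) rfl (part_mem _ f), coeff_part, if_pos (by simp)] at h2
  rw [h2, coeff_zero]

theorem toGr_surjective : Function.Surjective p.toGr := by
  intro x
  induction x using DirectSum.induction_on with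
  | zero => exact ⟨0, map_zero _⟩
  | add x y hx hy =>
    obtain ⟨f, rfl⟩ := hx
    obtain ⟨g, rfl⟩ := hy
    exact ⟨f + g, map_add _ _ _⟩
  | of i x =>
    obtain ⟨a, ha, rfl⟩ := P.exists_cls x
    change P.hom i _ ha ∈ Set.range p.toGr
    let L : P.F i →ₗ[ℂ] P.Gr :=
      DirectSum.lof ℂ ι P.Piece i ∘ₗ ((P.F' i).comap (P.F i).subtype).mkQ
    have hL : ∀ b (hb : b ∈ P.F i), L ⟨b, hb⟩ = P.hom i b hb := fun b hb => rfl
    let N : Submodule ℂ A := ((LinearMap.range p.toGr).comap L).map (P.F i).subtype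
    have hN : P.F i ≤ N := by
      conv_lhs => rw [p.F_eq, restrictSupport_eq_span]
      rw [Submodule.map_span_le]
      rintro _ ⟨s, hs, rfl⟩
      have hm : p.q (monomial s 1) ∈ P.F i :=
        p.q_mem_F.2 ((monomial_mem_restrictSupport ℂ).2 (Or.inl hs))
      refine ⟨⟨p.q (monomial s 1), hm⟩, ?_, rfl⟩
      change L ⟨p.q (monomial s 1), hm⟩ ∈ LinearMap.range p.toGr
      rw [hL]
      by_cases hs' : s ∈ p.E' i
      · refine ⟨0, ?_⟩
        rw [map_zero]
        have h0 := (P.cls_eq_zero_iff hm).2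
          (p.q_mem_F'.2 ((monomial_mem_restrictSupport ℂ).2 (Or.inl hs')))
        rw [hom, h0, map_zero]
      · obtain ⟨μ, rfl, rfl⟩ := p.exists_exp i s hs hs'
        refine ⟨monomial μ 1, ?_⟩
        rw [toGr_monomial, one_smul]
        rfl
    obtain ⟨⟨b, hb⟩, hb2, rfl⟩ := hN ha
    exact hb2

/-- The linear isomorphism between polynomials and the graded ring. -/
def grEquiv : MvPolynomial τ ℂ ≃ₗ[ℂ] P.Gr :=
  LinearEquiv.ofBijective p.toGr ⟨p.toGr_injective, p.toGr_surjective⟩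

theorem grEquiv_apply (f : MvPolynomial τ ℂ) : p.grEquiv f = p.toGr f := rfl

variable {M : Type*} [AddCommGroup M] [Module A M]

/-- The annihilator of `m` in `A`, transported to polynomials. -/
def genKer (q : MvPolynomial σ ℂ ≃ₗ[ℂ] A) (m : M) : Submodule ℂ (MvPolynomial σ ℂ) where
  carrier := {g | q g • m = 0}
  add_mem' {a b} ha hb := by
    change q (a + b) • m = 0
    rw [map_add, add_smul, show q a • m = 0 from ha, show q b • m = 0 from hb, add_zero]
  zero_mem' := by
    change q 0 • m = 0
    rw [map_zero, zero_smul]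
  smul_mem' c a ha := by
    change q (c • a) • m = 0
    rw [map_smul, Algebra.smul_def, mul_smul, show q a • m = 0 from ha, smul_zero]

theorem mem_genKer {q : MvPolynomial σ ℂ ≃ₗ[ℂ] A} {m : M} {g : MvPolynomial σ ℂ} :
    g ∈ genKer q m ↔ q g • m = 0 := Iff.rfl

/-- The annihilator of the generator of the graded module, in terms of polynomials. -/
theorem toGr_smul_grGen_eq_zero_iff (m : M) (f : MvPolynomial τ ℂ) :
    p.toGr f • P.grGen m = 0 ↔ ∀ i, expMap p.κ (part {μ | p.deg μ = i} f) ∈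
      genKer p.q m ⊔ restrictSupport ℂ (p.E' i) := by
  have h : p.toGr f • P.grGen m = 0 ↔ ∀ i, (p.toGr f • P.grGen m) i = 0 :=
    ⟨fun h i => by rw [h]; rfl, fun h => DFinsupp.ext h⟩
  rw [h]
  refine forall_congr' fun i => ?_
  rw [smul_grGen, toGr_apply, genMap_cls_eq_zero_iff, Submodule.mem_sup]
  constructor
  · rintro ⟨b, hb, hb2⟩
    obtain ⟨g, rfl⟩ := p.q.surjective b
    rw [q_mem_F'] at hb
    rw [← map_sub] at hb2
    exact ⟨_, hb2, g, hb, sub_add_cancel _ _⟩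
  · rintro ⟨y, hy, z, hz, hyz⟩
    refine ⟨p.q z, p.q_mem_F'.2 hz, ?_⟩
    rw [← map_sub, ← hyz, add_sub_cancel_right]
    exact hy

/-- Compatibility of a presentation with multiplication by generators `g t` of degree `dg t`: one of
left and right multiplication by `g t` adds `t` to all exponents. -/
structure Compat (g : τ → A) (dg : τ → ι) : Prop where
  mem : ∀ t, g t ∈ P.F (dg t)
  one : p.q (monomial (p.κ 0) 1) = 1
  deg_zero : p.deg 0 = 0
  deg_add : ∀ μ t, p.deg (μ + Finsupp.single t 1) = dg t + p.deg μ
  mul : ∀ t, (∀ μ, g t * p.q (monomial (p.κ μ) 1) =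
      p.q (monomial (p.κ (μ + Finsupp.single t 1)) 1)) ∨
    (∀ μ, p.q (monomial (p.κ μ) 1) * g t = p.q (monomial (p.κ (μ + Finsupp.single t 1)) 1))

namespace Compat

variable {p} {g : τ → A} {dg : τ → ι}

theorem hom_mul_homMon (hp : p.Compat g dg) {t : τ} {μ : τ →₀ ℕ}
    (h : g t * p.q (monomial (p.κ μ) 1) =
    p.q (monomial (p.κ (μ + Finsupp.single t 1)) 1)) :
    P.hom (dg t) (g t) (hp.mem t) * p.homMon μ = p.homMon (μ + Finsupp.single t 1) := by
  rw [homMon, hom_mul]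
  exact P.hom_congr (hp.deg_add μ t).symm h

theorem homMon_mul_hom (hp : p.Compat g dg) {t : τ} {μ : τ →₀ ℕ}
    (h : p.q (monomial (p.κ μ) 1) * g t =
    p.q (monomial (p.κ (μ + Finsupp.single t 1)) 1)) :
    p.homMon μ * P.hom (dg t) (g t) (hp.mem t) = p.homMon (μ + Finsupp.single t 1) := by
  rw [homMon, hom_mul]
  exact P.hom_congr ((add_comm _ _).trans (hp.deg_add μ t).symm) h

theorem homMon_zero (hp : p.Compat g dg) : p.homMon 0 = 1 :=
  P.hom_congr hp.deg_zero hp.one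

/-- The ring homomorphism to a commutative graded ring sending variables to classes of generators. -/
def algHom (hp : p.Compat g dg) [P.IsComm] : MvPolynomial τ ℂ →ₐ[ℂ] P.Gr :=
  aeval fun t => P.hom (dg t) (g t) (hp.mem t)

theorem algHom_eq_toGr (hp : p.Compat g dg) [P.IsComm] (f : MvPolynomial τ ℂ) :
    hp.algHom f = p.toGr f := by
  have h1 : ∀ μ : τ →₀ ℕ, hp.algHom (monomial μ 1) = p.homMon μ := by
    intro μ
    induction μ using exp_induction with
    | zero => rw [hp.homMon_zero, monomial_zero', map_one, map_one]
    | add_single μ t ih =>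
      have e : (monomial (μ + Finsupp.single t 1) 1 : MvPolynomial τ ℂ) = monomial μ 1 * X t := by
        rw [X, monomial_mul, mul_one]
      have e2 : hp.algHom (X t) = P.hom (dg t) (g t) (hp.mem t) := aeval_X _ t
      rw [e, map_mul, ih, e2]
      rcases hp.mul t with h | h
      · rw [mul_comm]
        exact hp.hom_mul_homMon (h μ)
      · exact hp.homMon_mul_hom (h μ)
  induction f using MvPolynomial.induction_on' with
  | monomial μ c =>
    have e : (monomial μ c : MvPolynomial τ ℂ) = c • monomial μ 1 := by simp [smul_monomial]
    rw [toGr_monomial, ← h1, e, map_smul]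
  | add f g hf hg => rw [map_add, map_add, hf, hg]

variable {M : Type*} [AddCommGroup M] [Module A M]

/-- The codimension of a cyclic graded module is the height of an explicit ideal of polynomials. -/
theorem exists_ideal (hp : p.Compat g dg) [P.IsComm] (m : M) : ∃ J : Ideal (MvPolynomial τ ℂ),
    J.height = P.codimGr m ∧ ∀ f, f ∈ J ↔ ∀ i, expMap p.κ (part {μ | p.deg μ = i} f) ∈
      genKer p.q m ⊔ restrictSupport ℂ (p.E' i) := by
  have hbij : Function.Bijective hp.algHom := by
    have : (hp.algHom : MvPolynomial τ ℂ → P.Gr) = p.toGr := funext hp.algHom_eq_toGr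
    rw [this]
    exact ⟨p.toGr_injective, p.toGr_surjective⟩
  let E := RingEquiv.ofBijective hp.algHom.toRingHom hbij
  refine ⟨(Module.annihilator P.Gr (P.GrMod m)).comap E, ?_, fun f => ?_⟩
  · rw [RingEquiv.height_comap]
    rfl
  · rw [Ideal.mem_comap, mem_annihilator_iff, ← p.toGr_smul_grGen_eq_zero_iff,
      ← hp.algHom_eq_toGr]
    rfl

end Compat

end MonomialPresentation
end GradingData

/-! ### The Poincaré–Birkhoff–Witt basis of the Weyl algebra -/

section CommEval

variable {υ A : Type*} [Ring A] [Algebra ℂ A]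

/-- The algebra generated by commuting elements is commutative. -/
abbrev adjoinCommRing (a : υ → A) (h : ∀ i j, a i * a j = a j * a i) :
    CommRing (Algebra.adjoin ℂ (Set.range a)) :=
  { (inferInstance : Ring (Algebra.adjoin ℂ (Set.range a))) with
    mul_comm := (Algebra.isMulCommutative_adjoin ℂ (s := Set.range a) (by
      rintro _ ⟨i, rfl⟩ _ ⟨j, rfl⟩
      exact h i j)).is_comm.comm }

/-- Evaluation of polynomials at a family of commuting elements of a noncommutative algebra. -/
def commEval (a : υ → A) (h : ∀ i j, a i * a j = a j * a i) : MvPolynomial υ ℂ →ₐ[ℂ] A :=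
  letI := adjoinCommRing a h
  (Algebra.adjoin ℂ (Set.range a)).val.comp
    (aeval fun i => (⟨a i, Algebra.subset_adjoin ⟨i, rfl⟩⟩ : Algebra.adjoin ℂ (Set.range a)))

theorem commEval_X (a : υ → A) (h : ∀ i j, a i * a j = a j * a i) (i : υ) :
    commEval a h (X i) = a i := by
  let := adjoinCommRing a h
  change ((aeval (R := ℂ) (fun i => (⟨a i, Algebra.subset_adjoin ⟨i, rfl⟩⟩ :
    Algebra.adjoin ℂ (Set.range a))) (X i) : Algebra.adjoin ℂ (Set.range a)) : A) = a i
  rw [aeval_X]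

end CommEval

variable {n : ℕ}

/-- Evaluation of polynomials at the `x_i`. -/
def xEval : MvPolynomial (Fin n) ℂ →ₐ[ℂ] Weyl n := commEval (fun i => gen (Sum.inl i)) gen_x_comm

/-- Evaluation of polynomials at the `∂_i`. -/
def dEval : MvPolynomial (Fin n) ℂ →ₐ[ℂ] Weyl n := commEval (fun i => gen (Sum.inr i)) gen_d_comm

theorem xEval_X (i : Fin n) : xEval (X i) = gen (Sum.inl i) := commEval_X _ _ i

theorem dEval_X (i : Fin n) : dEval (X i) = gen (Sum.inr i) := commEval_X _ _ i

/-- Leibniz' rule. -/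
theorem gen_mul_xEval (i : Fin n) (f : MvPolynomial (Fin n) ℂ) :
    gen (Sum.inr i) * xEval f = xEval f * gen (Sum.inr i) + xEval (pderiv i f) := by
  induction f using MvPolynomial.induction_on with
  | C c =>
    have h : (C c : MvPolynomial (Fin n) ℂ) = algebraMap ℂ _ c := rfl
    rw [pderiv_C, map_zero, add_zero, h, AlgHom.commutes, Algebra.commutes]
  | add f g hf hg => simp only [map_add, mul_add, add_mul, hf, hg]; abel
  | mul_X f j hf =>
    have h := gen_d_x i j
    rw [pderiv_mul, map_add, map_mul, map_mul, map_mul, ← mul_assoc, hf, xEval_X, add_mul, mul_assoc,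
      h, mul_add, mul_assoc, pderiv_X]
    by_cases hij : i = j
    · subst hij
      simp only [if_true, Pi.single_eq_same, map_one]
      abel
    · rw [if_neg hij, Pi.single_eq_of_ne (Ne.symm hij), map_zero]
      abel

/-- The ordered monomial `x^a ∂^b` with exponents `μ = (a, b)`. -/
def ordMon (μ : Fin n ⊕ Fin n →₀ ℕ) : Weyl n :=
  xEval (monomial (Finsupp.sumFinsuppAddEquivProdFinsupp μ).1 1) *
    dEval (monomial (Finsupp.sumFinsuppAddEquivProdFinsupp μ).2 1)

/-- The linear map sending `x^a ξ^b` to `x^a ∂^b`. -/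
def quantMap : MvPolynomial (Fin n ⊕ Fin n) ℂ →ₗ[ℂ] Weyl n :=
  (basisMonomials _ ℂ).constr ℂ ordMon

theorem quantMap_monomial (μ : Fin n ⊕ Fin n →₀ ℕ) (c : ℂ) :
    quantMap (monomial μ c) = c • ordMon μ := constr_basisMonomials_monomial _ _ _

theorem sumFinsupp_single_inl (i : Fin n) : Finsupp.sumFinsuppAddEquivProdFinsupp
    (Finsupp.single (Sum.inl i : Fin n ⊕ Fin n) 1) = (Finsupp.single i 1, (0 : Fin n →₀ ℕ)) := by
  classical
  ext j
  · simp [Finsupp.single_apply]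
  · simp

theorem sumFinsupp_single_inr (i : Fin n) : Finsupp.sumFinsuppAddEquivProdFinsupp
    (Finsupp.single (Sum.inr i : Fin n ⊕ Fin n) 1) = ((0 : Fin n →₀ ℕ), Finsupp.single i 1) := by
  classical
  ext j
  · simp
  · simp [Finsupp.single_apply]

theorem ordMon_zero : ordMon (n := n) 0 = 1 := by
  rw [ordMon, map_zero]
  simp

theorem x_mul_ordMon (i : Fin n) (μ : Fin n ⊕ Fin n →₀ ℕ) :
    gen (Sum.inl i) * ordMon μ = ordMon (μ + Finsupp.single (Sum.inl i) 1) := by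
  rw [ordMon, ordMon, map_add, sumFinsupp_single_inl, ← xEval_X, ← mul_assoc, ← map_mul, X,
    monomial_mul, mul_one, Prod.fst_add, Prod.snd_add, add_zero, add_comm]

theorem ordMon_mul_d (i : Fin n) (μ : Fin n ⊕ Fin n →₀ ℕ) :
    ordMon μ * gen (Sum.inr i) = ordMon (μ + Finsupp.single (Sum.inr i) 1) := by
  rw [ordMon, ordMon, map_add, sumFinsupp_single_inr, ← dEval_X, mul_assoc, ← map_mul, X,
    monomial_mul, mul_one, Prod.fst_add, Prod.snd_add, add_zero]

theorem d_mul_ordMon (i : Fin n) (μ : Fin n ⊕ Fin n →₀ ℕ) :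
    gen (Sum.inr i) * ordMon μ = ordMon (μ + Finsupp.single (Sum.inr i) 1) +
      (μ (Sum.inl i) : ℂ) • ordMon (μ - Finsupp.single (Sum.inl i) 1) := by
  have h1 : Finsupp.sumFinsuppAddEquivProdFinsupp (μ - Finsupp.single (Sum.inl i) 1) =
      ((Finsupp.sumFinsuppAddEquivProdFinsupp μ).1 - Finsupp.single i 1,
        (Finsupp.sumFinsuppAddEquivProdFinsupp μ).2) := by
    classical
    ext j
    · simp [Finsupp.single_apply]
    · simp
  rw [← ordMon_mul_d, ordMon, ordMon, h1, ← mul_assoc, gen_mul_xEval, add_mul, mul_assoc, mul_assoc]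
  congr 1
  · rw [← dEval_X, ← map_mul, ← map_mul, mul_comm]
  · rw [pderiv_monomial, one_mul, ← smul_mul_assoc, ← map_smul, smul_monomial, smul_eq_mul, mul_one]
    rfl

theorem x_mul_quantMap (i : Fin n) (f : MvPolynomial (Fin n ⊕ Fin n) ℂ) :
    gen (Sum.inl i) * quantMap f = quantMap (X (Sum.inl i) * f) := by
  induction f using MvPolynomial.induction_on' with
  | monomial μ c =>
    rw [quantMap_monomial, mul_smul_comm, x_mul_ordMon, X, monomial_mul, one_mul, quantMap_monomial,
      add_comm]
  | add f g hf hg => rw [map_add, mul_add, hf, hg, mul_add, map_add]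

theorem d_mul_quantMap (i : Fin n) (f : MvPolynomial (Fin n ⊕ Fin n) ℂ) :
    gen (Sum.inr i) * quantMap f = quantMap (X (Sum.inr i) * f + pderiv (Sum.inl i) f) := by
  induction f using MvPolynomial.induction_on' with
  | monomial μ c =>
    rw [quantMap_monomial, mul_smul_comm, d_mul_ordMon, X, monomial_mul, one_mul, pderiv_monomial,
      map_add, quantMap_monomial, quantMap_monomial, smul_add, smul_smul, add_comm μ]
  | add f g hf hg =>
    rw [map_add quantMap f g, mul_add, hf, hg, ← map_add quantMap, mul_add, map_add (pderiv _)]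
    congr 1
    abel

theorem pderiv_comm {σ : Type*} (i j : σ) (f : MvPolynomial σ ℂ) :
    pderiv i (pderiv j f) = pderiv j (pderiv i f) := by
  classical
  have h : ⁅pderiv (R := ℂ) i, pderiv (R := ℂ) j⁆ = 0 := by
    refine derivation_ext fun t => ?_
    rw [Derivation.commutator_apply, pderiv_X, pderiv_X, Derivation.coe_zero, Pi.zero_apply]
    simp [Pi.single_apply, apply_ite]
  have := congrArg (fun D => D f) h
  simpa [Derivation.commutator_apply, sub_eq_zero] using this

/-- The action of the Weyl algebra on polynomials in `x` and `ξ`, where `∂_i` acts as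
`ξ_i + ∂/∂x_i`; the image of `1` under a differential operator is its full symbol. -/
def weylRep : Weyl n →ₐ[ℂ] Module.End ℂ (MvPolynomial (Fin n ⊕ Fin n) ℂ) :=
  RingQuot.liftAlgHom ℂ ⟨FreeAlgebra.lift ℂ (Sum.elim (fun i => LinearMap.mulLeft ℂ (X (Sum.inl i)))
    (fun i => LinearMap.mulLeft ℂ (X (Sum.inr i)) + (pderiv (Sum.inl i)).toLinearMap)), by
    rintro a b h
    refine LinearMap.ext fun f => ?_
    cases h with
    | x_comm i j =>
      simp [mul_left_comm]
    | d_comm i j =>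
      have h1 : pderiv (Sum.inl i) (pderiv (Sum.inl j) f) =
          pderiv (Sum.inl j) (pderiv (Sum.inl i) f) := pderiv_comm _ _ _
      simp [pderiv_X, h1]
      ring
    | d_x i j =>
      by_cases hij : i = j
      · subst hij
        simp
        ring
      · simp [pderiv_X, hij]
        ring⟩

theorem weylRep_gen (s : Fin n ⊕ Fin n) (f : MvPolynomial (Fin n ⊕ Fin n) ℂ) :
    weylRep (gen s) f = Sum.elim (fun i => X (Sum.inl i) * f)
      (fun i => X (Sum.inr i) * f + pderiv (Sum.inl i) f) s := by
  rw [weylRep, gen, RingQuot.liftAlgHom_mkAlgHom_apply, FreeAlgebra.lift_ι_apply]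
  rcases s with i | i <;> rfl

/-- Induction principle for the Weyl algebra, by left multiplication by generators. -/
theorem weyl_induction {motive : Weyl n → Prop} (P : Weyl n) (one : motive 1)
    (add : ∀ P Q, motive P → motive Q → motive (P + Q))
    (smul : ∀ (c : ℂ) P, motive P → motive (c • P))
    (mul : ∀ s P, motive P → motive (gen s * P)) : motive P := by
  have key : ∀ a : FreeAlgebra ℂ (Fin n ⊕ Fin n), ∀ P, motive P →
      motive (RingQuot.mkAlgHom ℂ (WeylRel n) a * P) := by
    intro a
    induction a using FreeAlgebra.induction with
    | grade0 c =>
      intro P hP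
      rw [AlgHom.commutes, ← Algebra.smul_def]
      exact smul c P hP
    | grade1 s => exact fun P hP => mul s P hP
    | mul a b ha hb =>
      intro P hP
      rw [map_mul, mul_assoc]
      exact ha _ (hb _ hP)
    | add a b ha hb =>
      intro P hP
      rw [map_add, add_mul]
      exact add _ _ (ha _ hP) (hb _ hP)
  obtain ⟨a, rfl⟩ := RingQuot.mkAlgHom_surjective ℂ (WeylRel n) P
  have := key a 1 one
  rwa [mul_one] at this

theorem quantMap_one : quantMap (n := n) 1 = 1 := by
  have h : (1 : MvPolynomial (Fin n ⊕ Fin n) ℂ) = monomial 0 1 := rfl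
  rw [h, quantMap_monomial, one_smul, ordMon_zero]

theorem quantMap_weylRep (P : Weyl n) : quantMap (weylRep P 1) = P := by
  induction P using weyl_induction with
  | one => rw [map_one weylRep, Module.End.one_apply, quantMap_one]
  | add P Q hP hQ => rw [map_add, LinearMap.add_apply, map_add, hP, hQ]
  | smul c P hP => rw [map_smul, LinearMap.smul_apply, map_smul, hP]
  | mul s P hP =>
    rw [map_mul, Module.End.mul_apply, weylRep_gen]
    rcases s with i | i
    · rw [Sum.elim_inl, ← x_mul_quantMap, hP]
    · rw [Sum.elim_inr, ← d_mul_quantMap, hP]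

/-- The action on `1` inverts `quantMap`; this direction gives the linear independence of the ordered
monomials. -/
theorem weylRep_quantMap (f : MvPolynomial (Fin n ⊕ Fin n) ℂ) : weylRep (quantMap f) 1 = f := by
  have hx : ∀ (i : Fin n) (g : MvPolynomial (Fin n ⊕ Fin n) ℂ),
      weylRep (quantMap (X (Sum.inl i) * g)) 1 = X (Sum.inl i) * weylRep (quantMap g) 1 := by
    intro i g
    rw [← x_mul_quantMap, map_mul, Module.End.mul_apply, weylRep_gen]
    rfl
  have hd : ∀ (i : Fin n) (g : MvPolynomial (Fin n ⊕ Fin n) ℂ),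
      weylRep (quantMap (X (Sum.inr i) * g + pderiv (Sum.inl i) g)) 1 =
      X (Sum.inr i) * weylRep (quantMap g) 1 + pderiv (Sum.inl i) (weylRep (quantMap g) 1) := by
    intro i g
    rw [← d_mul_quantMap, map_mul, Module.End.mul_apply, weylRep_gen]
    rfl
  -- The polynomials in `ξ` are killed by `∂/∂x_i`.
  have h1 : ∀ h : MvPolynomial (Fin n) ℂ, weylRep (quantMap (rename Sum.inr h)) 1 =
      rename Sum.inr h := by
    intro h
    induction h using MvPolynomial.induction_on with
    | C c =>
      have e : (rename Sum.inr (C c) : MvPolynomial (Fin n ⊕ Fin n) ℂ) = c • 1 := by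
        rw [rename_C, smul_eq_C_mul, mul_one]
      rw [e, map_smul, quantMap_one, map_smul, map_one weylRep]
      rfl
    | add f g hf hg => rw [map_add, map_add, map_add, LinearMap.add_apply, hf, hg]
    | mul_X f i hf =>
      have h0 : ∀ g : MvPolynomial (Fin n) ℂ, pderiv (Sum.inl i : Fin n ⊕ Fin n)
          (rename Sum.inr g) = 0 := by
        intro g
        refine pderiv_eq_zero_of_notMem_vars fun hv => ?_
        have := Finset.mem_of_subset (vars_rename _ g) hv
        simp at this
      have h2 := hd i (rename Sum.inr f)
      rw [h0, add_zero, hf, h0, add_zero] at h2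
      rw [map_mul, rename_X, mul_comm, h2]
  have h2 : ∀ g h : MvPolynomial (Fin n) ℂ,
      weylRep (quantMap (rename Sum.inl g * rename Sum.inr h)) 1 =
        rename Sum.inl g * rename Sum.inr h := by
    intro g h
    induction g using MvPolynomial.induction_on with
    | C c => rw [rename_C, ← smul_eq_C_mul, map_smul, map_smul, LinearMap.smul_apply, h1]
    | add f g hf hg => rw [map_add, add_mul, map_add, map_add, LinearMap.add_apply, hf, hg]
    | mul_X f i hf =>
      rw [map_mul (rename Sum.inl), rename_X, mul_comm (rename Sum.inl f), mul_assoc, hx, hf]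
  induction f using MvPolynomial.induction_on' with
  | add f g hf hg => rw [map_add, map_add, LinearMap.add_apply, hf, hg]
  | monomial μ c =>
    have e : (monomial μ c : MvPolynomial (Fin n ⊕ Fin n) ℂ) =
        rename Sum.inl (monomial (Finsupp.sumFinsuppAddEquivProdFinsupp μ).1 c) *
          rename Sum.inr (monomial (Finsupp.sumFinsuppAddEquivProdFinsupp μ).2 1) := by
      rw [rename_monomial, rename_monomial, monomial_mul, mul_one]
      congr 2
      refine Finsupp.ext fun j => ?_
      rcases j with j | j
      · rw [Finsupp.add_apply, Finsupp.mapDomain_apply Sum.inl_injective,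
          Finsupp.mapDomain_of_notMem_range _ _ (by simp)]
        simp
      · rw [Finsupp.add_apply, Finsupp.mapDomain_apply Sum.inr_injective,
          Finsupp.mapDomain_of_notMem_range _ _ (by simp)]
        simp
    rw [e]
    exact h2 _ _

/-- The ordered monomials form a basis of the Weyl algebra. -/
def quant : MvPolynomial (Fin n ⊕ Fin n) ℂ ≃ₗ[ℂ] Weyl n :=
  LinearEquiv.ofBijective quantMap
    ⟨fun f g h => by rw [← weylRep_quantMap f, ← weylRep_quantMap g, h],
      fun P => ⟨_, quantMap_weylRep P⟩⟩

theorem quant_monomial (μ : Fin n ⊕ Fin n →₀ ℕ) (c : ℂ) :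
    quant (monomial μ c) = c • ordMon μ := quantMap_monomial μ c

/-! ### The filtrations in terms of ordered monomials -/

section WeightFilt

variable {υ σ A : Type*} [Ring A] [Algebra ℂ A]

theorem mul_mem_map_of_monomial (q : MvPolynomial σ ℂ ≃ₗ[ℂ] A) {X Y : Set (σ →₀ ℕ)} (a : A)
    (h : ∀ μ ∈ X, a * q (monomial μ 1) ∈ (restrictSupport ℂ Y).map q.toLinearMap) {x : A}
    (hx : x ∈ (restrictSupport ℂ X).map q.toLinearMap) :
    a * x ∈ (restrictSupport ℂ Y).map q.toLinearMap := by
  obtain ⟨f, hf, rfl⟩ := hx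
  rw [restrictSupport_eq_span] at hf
  induction hf using Submodule.span_induction with
  | mem x hx =>
    obtain ⟨μ, hμ, rfl⟩ := hx
    exact h μ hμ
  | zero => rw [map_zero, mul_zero]; exact zero_mem _
  | add x y _ _ hx hy => rw [map_add, mul_add]; exact add_mem hx hy
  | smul c x _ hx => rw [map_smul, mul_smul_comm]; exact Submodule.smul_mem _ c hx

/-- A family of subspaces stable under left multiplication by generators contains all products of
generators. -/
theorem prod_mem_of_step (g : υ → A) (w : υ → ℤ) (G : ℤ → Submodule ℂ A) (one : 1 ∈ G 0)
    (step : ∀ s d x, x ∈ G d → g s * x ∈ G (w s + d)) (l : List υ) :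
    (l.map g).prod ∈ G (l.map w).sum := by
  induction l with
  | nil => simpa using one
  | cons s l ih => simpa using step s _ _ ih

/-- The filtration defined by weights is spanned by ordered monomials, provided that straightening
does not raise the weight. -/
theorem weightFilt_eq_map (g : υ → A) (w : υ → ℤ) (q : MvPolynomial σ ℂ ≃ₗ[ℂ] A)
    (W : (σ →₀ ℕ) → ℤ) (one : q (monomial 0 1) = 1) (W_zero : W 0 = 0)
    (left : ∀ s μ, g s * q (monomial μ 1) ∈
      (restrictSupport ℂ {ν | W ν ≤ w s + W μ}).map q.toLinearMap)
    (mem : ∀ μ, q (monomial μ 1) ∈ weightFilt g w (W μ)) (d : ℤ) :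
    weightFilt g w d = (restrictSupport ℂ {μ | W μ ≤ d}).map q.toLinearMap := by
  apply le_antisymm
  · refine Submodule.span_le.2 ?_
    rintro _ ⟨l, hl, rfl⟩
    have h := prod_mem_of_step g w
      (fun d => (restrictSupport ℂ {μ | W μ ≤ d}).map q.toLinearMap) ?_ ?_ l
    · exact Submodule.map_mono (restrictSupport_mono ℂ fun μ hμ => le_trans hμ hl) h
    · refine ⟨monomial 0 1, ?_, one⟩
      refine (monomial_mem_restrictSupport ℂ).2 (Or.inl ?_)
      exact W_zero.le
    · intro s d x hx
      refine mul_mem_map_of_monomial q (g s) (fun μ hμ => ?_) hx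
      refine Submodule.map_mono (restrictSupport_mono ℂ fun ν hν => ?_) (left s μ)
      have hμ : W μ ≤ d := hμ
      have hν : W ν ≤ w s + W μ := hν
      change W ν ≤ w s + d
      omega
  · rw [restrictSupport_eq_span, Submodule.map_span_le]
    rintro _ ⟨μ, hμ, rfl⟩
    exact weightFilt_mono g w hμ (mem μ)

end WeightFilt

theorem weight_add_single {τ : Type*} (w : τ → ℤ) (μ : τ →₀ ℕ) (t : τ) :
    Finsupp.weight w (μ + Finsupp.single t 1) = w t + Finsupp.weight w μ := by
  rw [map_add, Finsupp.weight_single, one_smul, add_comm]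

theorem weight_sub_single {τ : Type*} (w : τ → ℤ) {μ : τ →₀ ℕ} {t : τ} (h : μ t ≠ 0) :
    Finsupp.weight w (μ - Finsupp.single t 1) = Finsupp.weight w μ - w t := by
  have h1 := weight_add_single w (μ - Finsupp.single t 1) t
  rw [Finsupp.sub_add_single_one_cancel h] at h1
  omega

/-- The exponents of the ordered monomials occurring in `gen s * x^a ∂^b`. -/
def leftMulExps (s : Fin n ⊕ Fin n) (μ : Fin n ⊕ Fin n →₀ ℕ) : Set (Fin n ⊕ Fin n →₀ ℕ) :=
  {ν | ν = μ + Finsupp.single s 1 ∨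
    ∃ i, s = Sum.inr i ∧ μ (Sum.inl i) ≠ 0 ∧ ν = μ - Finsupp.single (Sum.inl i) 1}

theorem gen_mul_quant_mem (s : Fin n ⊕ Fin n) (μ : Fin n ⊕ Fin n →₀ ℕ) :
    gen s * quant (monomial μ 1) ∈
      (restrictSupport ℂ (leftMulExps s μ)).map quant.toLinearMap := by
  have hm : ∀ ν ∈ leftMulExps s μ,
      ordMon ν ∈ (restrictSupport ℂ (leftMulExps s μ)).map quant.toLinearMap := fun ν hν =>
    ⟨monomial ν 1, (monomial_mem_restrictSupport ℂ).2 (Or.inl hν),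
      (quant_monomial ν 1).trans (one_smul ℂ _)⟩
  rw [quant_monomial, one_smul]
  rcases s with i | i
  · rw [x_mul_ordMon]
    exact hm _ (Or.inl rfl)
  · rw [d_mul_ordMon]
    refine add_mem (hm _ (Or.inl rfl)) ?_
    by_cases h : μ (Sum.inl i) = 0
    · rw [h, Nat.cast_zero, zero_smul]
      exact zero_mem _
    · exact Submodule.smul_mem _ _ (hm _ (Or.inr ⟨i, rfl, h, rfl⟩))

theorem weight_le_of_mem_leftMulExps {w : Fin n ⊕ Fin n → ℤ}
    (hw : ∀ i, 0 ≤ w (Sum.inl i) + w (Sum.inr i)) {s : Fin n ⊕ Fin n}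
    {μ ν : Fin n ⊕ Fin n →₀ ℕ} (h : ν ∈ leftMulExps s μ) :
    Finsupp.weight w ν ≤ w s + Finsupp.weight w μ := by
  rcases h with rfl | ⟨i, rfl, h, rfl⟩
  · exact (weight_add_single w μ s).le
  · rw [weight_sub_single w h]
    have := hw i
    omega

theorem weight_eq_of_mem_leftMulExps {w : Fin n ⊕ Fin n → ℤ}
    (hw : ∀ i, w (Sum.inl i) + w (Sum.inr i) = 0) {s : Fin n ⊕ Fin n}
    {μ ν : Fin n ⊕ Fin n →₀ ℕ} (h : ν ∈ leftMulExps s μ) :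
    Finsupp.weight w ν = w s + Finsupp.weight w μ := by
  rcases h with rfl | ⟨i, rfl, h, rfl⟩
  · exact weight_add_single w μ s
  · rw [weight_sub_single w h]
    have := hw i
    omega

theorem quant_monomial_zero : quant (n := n) (monomial 0 1) = 1 := by
  rw [quant_monomial, one_smul, ordMon_zero]

theorem gen_mul_or_mul_gen (s : Fin n ⊕ Fin n) :
    (∀ μ, gen s * quant (monomial μ 1) = quant (monomial (μ + Finsupp.single s 1) 1)) ∨
    (∀ μ, quant (monomial μ 1) * gen s = quant (monomial (μ + Finsupp.single s 1) 1)) := by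
  simp only [quant_monomial, one_smul]
  rcases s with i | i
  · exact Or.inl (x_mul_ordMon i)
  · exact Or.inr (ordMon_mul_d i)

/-- A basis of monomials built one generator at a time lies in the steps of the filtration. -/
theorem monomial_mem_weightFilt {τ A : Type*} [Ring A] [Algebra ℂ A] (g : τ → A) (w : τ → ℤ)
    (e : (τ →₀ ℕ) → A) (one : e 0 = 1)
    (mul : ∀ t, (∀ μ, g t * e μ = e (μ + Finsupp.single t 1)) ∨
      (∀ μ, e μ * g t = e (μ + Finsupp.single t 1))) (μ : τ →₀ ℕ) :
    e μ ∈ weightFilt g w (Finsupp.weight w μ) := by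
  induction μ using exp_induction with
  | zero => rw [one, map_zero]; exact one_mem_weightFilt g w le_rfl
  | add_single μ t ih =>
    rw [weight_add_single]
    rcases mul t with h | h
    · rw [← h]
      exact mul_mem_weightFilt g w (gen_mem_weightFilt g w t le_rfl) ih
    · rw [← h]
      exact mul_mem_weightFilt' g w ih (gen_mem_weightFilt g w t le_rfl) (add_comm _ _).le

theorem weightFilt_gen_eq {w : Fin n ⊕ Fin n → ℤ} (hw : ∀ i, 0 ≤ w (Sum.inl i) + w (Sum.inr i))
    (d : ℤ) : weightFilt gen w d =
      (restrictSupport ℂ {μ | Finsupp.weight w μ ≤ d}).map (quant (n := n)).toLinearMap := by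
  refine weightFilt_eq_map gen w quant _ quant_monomial_zero (map_zero _) (fun s μ => ?_)
    (fun μ => ?_) d
  · exact Submodule.map_mono (restrictSupport_mono ℂ fun ν hν => weight_le_of_mem_leftMulExps hw hν)
      (gen_mul_quant_mem s μ)
  · exact monomial_mem_weightFilt gen w (fun μ => quant (monomial μ 1)) quant_monomial_zero
      gen_mul_or_mul_gen μ

/-- The order of `x^a ∂^b`. -/
abbrev ordF (μ : Fin n ⊕ Fin n →₀ ℕ) : ℤ := Finsupp.weight wF μ

/-- The `V`-order of `x^a ∂^b`. -/
abbrev ordV (μ : Fin n ⊕ Fin n →₀ ℕ) : ℤ := Finsupp.weight wV μ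

theorem filtF_eq (d : ℤ) : filtF n d =
    (restrictSupport ℂ {μ | ordF μ ≤ d}).map (quant (n := n)).toLinearMap :=
  weightFilt_gen_eq (fun i => by simp [wF]) d

theorem filtV_eq (d : ℤ) : filtV n d =
    (restrictSupport ℂ {μ | ordV μ ≤ d}).map (quant (n := n)).toLinearMap :=
  weightFilt_gen_eq (fun i => by simp [wV]) d

/-- The exponents with `p ≤ d` and `v ≤ k`. -/
def bounded {σ : Type*} (p v : (σ →₀ ℕ) → ℤ) (d k : ℤ) : Set (σ →₀ ℕ) := {μ | p μ ≤ d ∧ v μ ≤ k}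

theorem bounded_mono {σ : Type*} {p v : (σ →₀ ℕ) → ℤ} {d k d' k' : ℤ} (hd : d ≤ d') (hk : k ≤ k') :
    bounded p v d k ⊆ bounded p v d' k' := fun _ h => ⟨h.1.trans hd, h.2.trans hk⟩

theorem restrictSupport_inter {k σ : Type*} [Field k] (X Y : Set (σ →₀ ℕ)) :
    restrictSupport k (X ∩ Y) = restrictSupport k X ⊓ restrictSupport k Y := by
  ext f
  exact Set.subset_inter_iff

theorem restrictSupport_union {k σ : Type*} [Field k] (X Y : Set (σ →₀ ℕ)) :
    restrictSupport k (X ∪ Y) = restrictSupport k X ⊔ restrictSupport k Y := by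
  rw [restrictSupport_eq_span, restrictSupport_eq_span, restrictSupport_eq_span, Set.image_union,
    Submodule.span_union]

theorem filtFV_eq (d k : ℤ) : filtFV n d k =
    (restrictSupport ℂ (bounded ordF ordV d k)).map (quant (n := n)).toLinearMap := by
  have h : bounded (ordF (n := n)) ordV d k = {μ | ordF μ ≤ d} ∩ {μ | ordV μ ≤ k} := rfl
  rw [filtFV, filtF_eq, filtV_eq, h, restrictSupport_inter, Submodule.map_inf _ quant.injective]

/-! ### Monomial presentations of the graded rings -/

open GradingData

/-- `gr^F(D)` is a polynomial ring in `x` and `ξ`. -/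
def presF : MonomialPresentation (grF n) (Fin n ⊕ Fin n) (Fin n ⊕ Fin n) where
  q := quant
  κ := id
  deg := ordF
  E d := {μ | ordF μ ≤ d}
  E' d := {μ | ordF μ ≤ d - 1}
  F_eq d := filtF_eq d
  F'_eq d := filtF_eq (d - 1)
  mem_E μ := by
    change ordF μ ≤ ordF μ
    exact le_rfl
  notMem_E' μ h := by
    have h : ordF μ ≤ ordF μ - 1 := h
    omega
  injOn i := Set.injOn_id _
  exists_exp i s h h' := by
    have h : ordF s ≤ i := h
    have h' : ¬ ordF s ≤ i - 1 := h'
    exact ⟨s, by omega, rfl⟩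

theorem compatF : (presF (n := n)).Compat gen wF where
  mem t := gen_mem_weightFilt gen wF t le_rfl
  one := quant_monomial_zero
  deg_zero := map_zero _
  deg_add μ t := weight_add_single wF μ t
  mul := gen_mul_or_mul_gen

/-- `bigr(D)` is a polynomial ring in `x` and `ξ`. -/
def presBigr : MonomialPresentation (bigr n) (Fin n ⊕ Fin n) (Fin n ⊕ Fin n) where
  q := quant
  κ := id
  deg μ := (ordF μ, ordV μ)
  E i := bounded ordF ordV i.1 i.2
  E' i := bounded ordF ordV (i.1 - 1) i.2 ∪ bounded ordF ordV i.1 (i.2 - 1)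
  F_eq i := filtFV_eq i.1 i.2
  F'_eq i := by
    rw [restrictSupport_union, Submodule.map_sup, ← filtFV_eq, ← filtFV_eq]
    rfl
  mem_E μ := ⟨le_rfl, le_rfl⟩
  notMem_E' μ h := by
    rcases h with ⟨h, _⟩ | ⟨_, h⟩
    · have h : ordF μ ≤ ordF μ - 1 := h
      omega
    · have h : ordV μ ≤ ordV μ - 1 := h
      omega
  injOn i := Set.injOn_id _
  exists_exp i s h h' := by
    obtain ⟨h1, h2⟩ := h
    simp only [bounded, Set.mem_union, Set.mem_ofPred_eq, not_or, not_and, not_le] at h'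
    refine ⟨s, Prod.ext ?_ ?_, rfl⟩
    · by_contra hne
      exact absurd (h'.1 (by change ordF s ≠ i.1 at hne; omega)) (by omega)
    · by_contra hne
      exact absurd (h'.2 h1) (by change ordV s ≠ i.2 at hne; omega)

theorem compatBigr : (presBigr (n := n)).Compat gen (fun s => (wF s, wV s)) where
  mem t := gen_mem_filtFV t
  one := quant_monomial_zero
  deg_zero := Prod.ext (map_zero _) (map_zero _)
  deg_add μ t := Prod.ext (weight_add_single wF μ t) (weight_add_single wV μ t)
  mul := gen_mul_or_mul_gen

/-- An exponent in the variables `σ` and one additional variable is determined by its restriction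
to `σ` and its value at the additional variable. -/
theorem option_ext {σ : Type*} {μ ν : Option σ →₀ ℕ} (h : μ.some = ν.some) (h0 : μ none = ν none) :
    μ = ν := by
  rw [← Finsupp.optionElim_some μ, ← Finsupp.optionElim_some ν, h, h0]

theorem some_add_single_some {σ : Type*} (μ : Option σ →₀ ℕ) (s : σ) :
    (μ + Finsupp.single (some s) 1).some = μ.some + Finsupp.single s 1 := by
  rw [Finsupp.some_add, Finsupp.some_single_some]

theorem some_add_single_none {σ : Type*} (μ : Option σ →₀ ℕ) :
    (μ + Finsupp.single none 1).some = μ.some := by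
  rw [Finsupp.some_add, Finsupp.some_single_none, add_zero]

theorem gen_mul_or_mul_gen_option (t : Option (Fin n ⊕ Fin n)) :
    (∀ μ : Option (Fin n ⊕ Fin n) →₀ ℕ, t.elim 1 gen * quant (monomial μ.some 1) =
      quant (monomial (μ + Finsupp.single t 1).some 1)) ∨
    (∀ μ : Option (Fin n ⊕ Fin n) →₀ ℕ, quant (monomial μ.some 1) * t.elim 1 gen =
      quant (monomial (μ + Finsupp.single t 1).some 1)) := by
  rcases t with _ | s
  · exact Or.inl fun μ => by rw [Option.elim_none, one_mul, some_add_single_none]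
  · simp only [some_add_single_some, Option.elim_some]
    exact (gen_mul_or_mul_gen s).imp (fun h μ => h _) (fun h μ => h _)

/-- `gr^F(R_V(D))` is a polynomial ring in `x`, `ξ` and `θ`; the additional variable `none` stands for
`θ`, the class of `1 ∈ F_{0,1}(D)`. -/
def presFReesV : MonomialPresentation (grFReesV n) (Option (Fin n ⊕ Fin n)) (Fin n ⊕ Fin n) where
  q := quant
  κ := Finsupp.some
  deg μ := (ordF μ.some, ordV μ.some + μ none)
  E i := bounded ordF ordV i.1 i.2
  E' i := bounded ordF ordV (i.1 - 1) i.2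
  F_eq i := filtFV_eq i.1 i.2
  F'_eq i := filtFV_eq (i.1 - 1) i.2
  mem_E μ := ⟨le_rfl, by change ordV μ.some ≤ ordV μ.some + μ none; omega⟩
  notMem_E' μ h := by
    have h : ordF μ.some ≤ ordF μ.some - 1 := h.1
    omega
  injOn i := by
    rintro μ rfl ν hν h
    have h2 := congrArg Prod.snd hν
    simp only [h] at h2
    exact option_ext h (by omega)
  exists_exp i s h h' := by
    obtain ⟨h1, h2⟩ := h
    simp only [bounded, Set.mem_ofPred_eq, not_and, not_le] at h'
    refine ⟨s.optionElim (i.2 - ordV s).toNat, Prod.ext ?_ ?_, Finsupp.some_optionElim _ _⟩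
    · rw [Finsupp.some_optionElim]
      by_contra hne
      exact absurd (h' (by change ordF s ≠ i.1 at hne; omega)) (by omega)
    · rw [Finsupp.some_optionElim, Finsupp.optionElim_apply_none]
      change ordV s + _ = i.2
      omega

theorem presFReesV_deg (μ : Option (Fin n ⊕ Fin n) →₀ ℕ) :
    presFReesV.deg μ = (ordF μ.some, ordV μ.some + μ none) := rfl

theorem compatFReesV : (presFReesV (n := n)).Compat (fun t => t.elim 1 gen)
    (fun t => t.elim (0, 1) (fun s => (wF s, wV s))) where
  mem t := by
    rcases t with _ | s
    · exact one_mem_filtFV le_rfl zero_le_one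
    · exact gen_mem_filtFV s
  one := by
    change quant (monomial (Finsupp.some 0) 1) = 1
    rw [Finsupp.some_zero, quant_monomial_zero]
  deg_zero := by
    rw [presFReesV_deg, Finsupp.some_zero, ordF, ordV, map_zero, map_zero]
    rfl
  deg_add μ t := by
    rw [presFReesV_deg, presFReesV_deg]
    rcases t with _ | s
    · rw [some_add_single_none, Finsupp.add_apply, Finsupp.single_eq_same, Option.elim_none,
        Prod.mk_add_mk, zero_add]
      push_cast
      congr 1
      ring
    · rw [some_add_single_some, Finsupp.add_apply, Finsupp.single_eq_of_ne (by simp), add_zero,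
        ordF, ordV, weight_add_single, weight_add_single, Option.elim_some, Prod.mk_add_mk,
        add_assoc]
  mul t := gen_mul_or_mul_gen_option t

/-- `gr^V(R_F(D))` has a basis of ordered monomials in `x`, `∂` and `h`; the additional variable
`none` stands for `h`. -/
def presVReesF : MonomialPresentation (grVReesF n) (Option (Fin n ⊕ Fin n)) (Fin n ⊕ Fin n) where
  q := quant
  κ := Finsupp.some
  deg μ := (ordF μ.some + μ none, ordV μ.some)
  E i := bounded ordF ordV i.1 i.2
  E' i := bounded ordF ordV i.1 (i.2 - 1)
  F_eq i := filtFV_eq i.1 i.2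
  F'_eq i := filtFV_eq i.1 (i.2 - 1)
  mem_E μ := ⟨by change ordF μ.some ≤ ordF μ.some + μ none; omega, le_rfl⟩
  notMem_E' μ h := by
    have h : ordV μ.some ≤ ordV μ.some - 1 := h.2
    omega
  injOn i := by
    rintro μ rfl ν hν h
    have h2 := congrArg Prod.fst hν
    simp only [h] at h2
    exact option_ext h (by omega)
  exists_exp i s h h' := by
    obtain ⟨h1, h2⟩ := h
    simp only [bounded, Set.mem_ofPred_eq, not_and, not_le] at h'
    refine ⟨s.optionElim (i.1 - ordF s).toNat, Prod.ext ?_ ?_, Finsupp.some_optionElim _ _⟩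
    · rw [Finsupp.some_optionElim, Finsupp.optionElim_apply_none]
      change ordF s + _ = i.1
      omega
    · rw [Finsupp.some_optionElim]
      by_contra hne
      exact absurd (h' h1) (by change ordV s ≠ i.2 at hne; omega)

theorem presVReesF_deg (μ : Option (Fin n ⊕ Fin n) →₀ ℕ) :
    presVReesF.deg μ = (ordF μ.some + μ none, ordV μ.some) := rfl

theorem compatVReesF : (presVReesF (n := n)).Compat (fun t => t.elim 1 gen)
    (fun t => t.elim (1, 0) (fun s => (wF s, wV s))) where
  mem t := by
    rcases t with _ | s
    · exact one_mem_filtFV zero_le_one le_rfl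
    · exact gen_mem_filtFV s
  one := by
    change quant (monomial (Finsupp.some 0) 1) = 1
    rw [Finsupp.some_zero, quant_monomial_zero]
  deg_zero := by
    rw [presVReesF_deg, Finsupp.some_zero, ordF, ordV, map_zero, map_zero]
    rfl
  deg_add μ t := by
    rw [presVReesF_deg, presVReesF_deg]
    rcases t with _ | s
    · rw [some_add_single_none, Finsupp.add_apply, Finsupp.single_eq_same, Option.elim_none,
        Prod.mk_add_mk, zero_add]
      push_cast
      congr 1
      ring
    · rw [some_add_single_some, Finsupp.add_apply, Finsupp.single_eq_of_ne (by simp), add_zero,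
        ordF, ordV, weight_add_single, weight_add_single, Option.elim_some, Prod.mk_add_mk,
        add_assoc]
  mul t := gen_mul_or_mul_gen_option t

/-! ### The homogenized Weyl algebra -/

theorem GradingData.hom_add_smul {ι A : Type*} [AddCommGroup ι] [DecidableEq ι] [Ring A]
    [Algebra ℂ A] (P : GradingData ι A) {i : ι} {a b : A} (ha : a ∈ P.F i) (hb : b ∈ P.F i) (c : ℂ) :
    P.hom i (a + c • b) (add_mem ha (Submodule.smul_mem _ c hb)) =
      P.hom i a ha + c • P.hom i b hb := by
  have h : P.cls (a + c • b) (add_mem ha (Submodule.smul_mem _ c hb)) =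
      P.cls a ha + c • P.cls b hb := rfl
  rw [hom, h, map_add]
  exact congrArg _ ((DirectSum.lof ℂ ι P.Piece i).map_smul c (P.cls b hb))

/-- The index of a generator `x_i`, `∂_i` or `h`, the latter being attached to `none`. -/
def hIndex (t : Option (Fin n ⊕ Fin n)) : (Fin n ⊕ Fin n) ⊕ Unit := t.elim (Sum.inr ()) Sum.inl

theorem hgen_hIndex (t : Option (Fin n ⊕ Fin n)) : hgen (hIndex t) =
    (grVReesF n).hom (t.elim (1, 0) (fun s => (wF s, wV s))) (t.elim 1 gen)
      (compatVReesF.mem t) := by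
  rcases t with _ | s <;> rfl

theorem exists_hIndex (s : (Fin n ⊕ Fin n) ⊕ Unit) : ∃ t, hIndex t = s := by
  rcases s with s | ⟨⟩
  · exact ⟨some s, rfl⟩
  · exact ⟨none, rfl⟩

theorem grEquiv_monomial (μ : Option (Fin n ⊕ Fin n) →₀ ℕ) :
    (presVReesF (n := n)).grEquiv (monomial μ 1) = presVReesF.homMon μ := by
  rw [MonomialPresentation.grEquiv_apply, MonomialPresentation.toGr_monomial, one_smul]

theorem hgen_mul_or_mul_hgen (t : Option (Fin n ⊕ Fin n)) :
    (∀ μ, hgen (hIndex t) * presVReesF.homMon μ = presVReesF.homMon (μ + Finsupp.single t 1)) ∨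
    (∀ μ, presVReesF.homMon μ * hgen (hIndex t) = presVReesF.homMon (μ + Finsupp.single t 1)) := by
  rw [hgen_hIndex]
  exact (compatVReesF.mul t).imp (fun h μ => compatVReesF.hom_mul_homMon (h μ))
    (fun h μ => compatVReesF.homMon_mul_hom (h μ))

/-- The monomial in the straightening of `∂_i * x^a ∂^b h^c` other than `x^a ∂^b h^c ∂_i`: one factor
`x_i` is replaced by `h`. -/
def contractExp (i : Fin n) (μ : Option (Fin n ⊕ Fin n) →₀ ℕ) : Option (Fin n ⊕ Fin n) →₀ ℕ :=
  μ - Finsupp.single (some (Sum.inl i)) 1 + Finsupp.single none 1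

theorem hgen_d_mul_homMon (i : Fin n) (μ : Option (Fin n ⊕ Fin n) →₀ ℕ) :
    hgen (hIndex (some (Sum.inr i))) * presVReesF.homMon μ =
      presVReesF.homMon (μ + Finsupp.single (some (Sum.inr i)) 1) +
        (μ (some (Sum.inl i)) : ℂ) • presVReesF.homMon (contractExp i μ) := by
  have hd : presVReesF.deg (μ + Finsupp.single (some (Sum.inr i)) 1) =
      (1, 1) + presVReesF.deg μ := compatVReesF.deg_add μ _
  have hmul : gen (Sum.inr i) * quant (monomial μ.some 1) =
      quant (monomial (μ + Finsupp.single (some (Sum.inr i)) 1).some 1) +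
        (μ (some (Sum.inl i)) : ℂ) •
          quant (monomial (μ.some - Finsupp.single (Sum.inl i) 1) 1) := by
    simp only [quant_monomial, one_smul]
    rw [d_mul_ordMon, some_add_single_some, Finsupp.some_apply]
  rw [hgen_hIndex]
  by_cases h : μ (some (Sum.inl i)) = 0
  · rw [h, Nat.cast_zero, zero_smul, add_zero] at hmul
    rw [h, Nat.cast_zero, zero_smul, add_zero]
    exact compatVReesF.hom_mul_homMon hmul
  · have hc : contractExp i μ + Finsupp.single (some (Sum.inl i)) 1 =
        μ + Finsupp.single none 1 := by
      rw [contractExp, add_right_comm, Finsupp.sub_add_single_one_cancel h]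
    have hcs : (contractExp i μ).some = μ.some - Finsupp.single (Sum.inl i) 1 := by
      have h1 := congrArg Finsupp.some hc
      rw [some_add_single_some, some_add_single_none] at h1
      rw [← h1, add_tsub_cancel_right]
    have hcd : presVReesF.deg (contractExp i μ) = (1, 1) + presVReesF.deg μ := by
      have h1 := congrArg presVReesF.deg hc
      rw [compatVReesF.deg_add, compatVReesF.deg_add] at h1
      have h2 : ((0, -1) : ℤ × ℤ) + presVReesF.deg (contractExp i μ) =
        (1, 0) + presVReesF.deg μ := h1
      rw [← add_left_cancel_iff (a := ((0, -1) : ℤ × ℤ)), h2, ← add_assoc]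
      rfl
    have m1 := presVReesF.q_monomial_mem (μ + Finsupp.single (some (Sum.inr i)) 1)
    have m2 := presVReesF.q_monomial_mem (contractExp i μ)
    rw [hd] at m1
    rw [hcd] at m2
    have e1 : presVReesF.homMon (μ + Finsupp.single (some (Sum.inr i)) 1) =
      (grVReesF n).hom _ _ m1 := hom_congr _ hd rfl
    have e2 : presVReesF.homMon (contractExp i μ) = (grVReesF n).hom _ _ m2 := hom_congr _ hcd rfl
    rw [e1, e2, ← GradingData.hom_add_smul, MonomialPresentation.homMon, hom_mul]
    refine hom_congr _ rfl (hmul.trans ?_)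
    change _ = quant _ + _ • quant (monomial (contractExp i μ).some 1)
    rw [hcs]
    rfl

/-- The weight of `x^a ∂^b h^c` for the weight vector `(u, v, t)`. -/
abbrev ordH (ω : HWeight n) (μ : Option (Fin n ⊕ Fin n) →₀ ℕ) : ℤ :=
  Finsupp.weight (fun t => ω.weight (hIndex t)) μ

theorem ordH_contractExp_le (ω : HWeight n) (i : Fin n) {μ : Option (Fin n ⊕ Fin n) →₀ ℕ}
    (h : μ (some (Sum.inl i)) ≠ 0) :
    ordH ω (contractExp i μ) ≤ ω.weight (hIndex (some (Sum.inr i))) + ordH ω μ := by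
  rw [ordH, ordH, contractExp, weight_add_single, weight_sub_single _ h]
  have h1 : ω.weight (hIndex (some (Sum.inl i))) = ω.u i := rfl
  have h2 : ω.weight (hIndex (some (Sum.inr i))) = ω.v i := rfl
  have h3 : ω.weight (n := n) (hIndex none) = ω.t := rfl
  rw [h1, h2, h3]
  have := ω.lt i
  omega

theorem hgen_mul_homMon (t : Option (Fin n ⊕ Fin n)) (ht : ∀ i, t ≠ some (Sum.inr i))
    (μ : Option (Fin n ⊕ Fin n) →₀ ℕ) :
    hgen (hIndex t) * presVReesF.homMon μ = presVReesF.homMon (μ + Finsupp.single t 1) := by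
  rw [hgen_hIndex]
  have h : t.elim 1 gen * quant (monomial μ.some 1) =
      quant (monomial (μ + Finsupp.single t 1).some 1) := by
    rcases t with _ | i | i
    · rw [Option.elim_none, one_mul, some_add_single_none]
    · rw [Option.elim_some, some_add_single_some, quant_monomial, quant_monomial, one_smul,
        one_smul, x_mul_ordMon]
    · exact absurd rfl (ht i)
  exact compatVReesF.hom_mul_homMon h

theorem hgen_mul_homMon_mem (ω : HWeight n) (t : Option (Fin n ⊕ Fin n))
    (μ : Option (Fin n ⊕ Fin n) →₀ ℕ) : hgen (hIndex t) * presVReesF.homMon μ ∈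
      (restrictSupport ℂ {ν | ordH ω ν ≤ ω.weight (hIndex t) + ordH ω μ}).map
        (presVReesF (n := n)).grEquiv.toLinearMap := by
  have hm : ∀ ν, ordH ω ν ≤ ω.weight (hIndex t) + ordH ω μ → presVReesF.homMon ν ∈
      (restrictSupport ℂ {ν | ordH ω ν ≤ ω.weight (hIndex t) + ordH ω μ}).map
        (presVReesF (n := n)).grEquiv.toLinearMap := fun ν hν => by
    rw [← grEquiv_monomial]
    exact Submodule.mem_map_of_mem ((monomial_mem_restrictSupport ℂ).2 (Or.inl hν))
  have hs := hm _ (weight_add_single (fun t => ω.weight (hIndex t)) μ t).le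
  by_cases ht : ∀ i, t ≠ some (Sum.inr i)
  · rw [hgen_mul_homMon t ht]
    exact hs
  · push Not at ht
    obtain ⟨i, rfl⟩ := ht
    rw [hgen_d_mul_homMon]
    refine add_mem hs ?_
    by_cases h : μ (some (Sum.inl i)) = 0
    · rw [h, Nat.cast_zero, zero_smul]
      exact zero_mem _
    · exact Submodule.smul_mem _ _ (hm _ (ordH_contractExp_le ω i h))

theorem homMon_mem_weightFilt (ω : HWeight n) (μ : Option (Fin n ⊕ Fin n) →₀ ℕ) :
    presVReesF.homMon μ ∈ weightFilt hgen ω.weight (ordH ω μ) := by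
  have h := monomial_mem_weightFilt (fun t => hgen (hIndex t)) (fun t => ω.weight (hIndex t))
    presVReesF.homMon compatVReesF.homMon_zero hgen_mul_or_mul_hgen μ
  refine Submodule.span_mono ?_ h
  rintro _ ⟨l, hl, rfl⟩
  exact ⟨l.map hIndex, by simpa [Function.comp_def] using hl, by simp [Function.comp_def]⟩

theorem weightFilt_hgen_eq (ω : HWeight n) (d : ℤ) : weightFilt hgen ω.weight d =
    (restrictSupport ℂ {μ | ordH ω μ ≤ d}).map (presVReesF (n := n)).grEquiv.toLinearMap := by
  refine weightFilt_eq_map hgen ω.weight _ _ ?_ (map_zero _) (fun s μ => ?_) (fun μ => ?_) d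
  · rw [grEquiv_monomial, compatVReesF.homMon_zero]
  · obtain ⟨t, rfl⟩ := exists_hIndex s
    rw [grEquiv_monomial]
    exact hgen_mul_homMon_mem ω t μ
  · rw [grEquiv_monomial]
    exact homMon_mem_weightFilt ω μ

/-- `gr^{(u,v,t)}(gr^V(R_F(D)))` is a polynomial ring in `x`, `ξ` and `h`. -/
def presH (ω : HWeight n) :
    MonomialPresentation (grH ω) (Option (Fin n ⊕ Fin n)) (Option (Fin n ⊕ Fin n)) where
  q := presVReesF.grEquiv
  κ := id
  deg := ordH ω
  E d := {μ | ordH ω μ ≤ d}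
  E' d := {μ | ordH ω μ ≤ d - 1}
  F_eq d := weightFilt_hgen_eq ω d
  F'_eq d := weightFilt_hgen_eq ω (d - 1)
  mem_E μ := by
    change ordH ω μ ≤ ordH ω μ
    exact le_rfl
  notMem_E' μ h := by
    have h : ordH ω μ ≤ ordH ω μ - 1 := h
    omega
  injOn i := Set.injOn_id _
  exists_exp i s h h' := by
    have h : ordH ω s ≤ i := h
    have h' : ¬ ordH ω s ≤ i - 1 := h'
    exact ⟨s, by omega, rfl⟩

theorem compatH (ω : HWeight n) :
    (presH ω).Compat (fun t => hgen (hIndex t)) (fun t => ω.weight (hIndex t)) where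
  mem t := gen_mem_weightFilt hgen ω.weight _ le_rfl
  one := by
    change presVReesF.grEquiv (monomial 0 1) = 1
    rw [grEquiv_monomial, compatVReesF.homMon_zero]
  deg_zero := map_zero _
  deg_add μ t := weight_add_single (fun t => ω.weight (hIndex t)) μ t
  mul t := by
    change (∀ μ, _ * presVReesF.grEquiv (monomial μ 1) =
        presVReesF.grEquiv (monomial (μ + Finsupp.single t 1) 1)) ∨
      (∀ μ, presVReesF.grEquiv (monomial μ 1) * _ =
        presVReesF.grEquiv (monomial (μ + Finsupp.single t 1) 1))
    simp only [grEquiv_monomial]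
    exact hgen_mul_or_mul_hgen t

/-! ### The hypotheses on the ideal in terms of symbols -/

/-- The symbols of the elements of `I`. -/
abbrev symbols (I : Submodule (Weyl n) (Weyl n)) : Submodule ℂ (MvPolynomial (Fin n ⊕ Fin n) ℂ) :=
  MonomialPresentation.genKer quant (unitCls I)

theorem smul_unitCls (I : Submodule (Weyl n) (Weyl n)) (a : Weyl n) :
    a • unitCls I = Submodule.Quotient.mk a := by
  rw [unitCls, ← Submodule.Quotient.mk_smul, smul_eq_mul, mul_one]

theorem mem_symbols {I : Submodule (Weyl n) (Weyl n)} {f : MvPolynomial (Fin n ⊕ Fin n) ℂ} :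
    f ∈ symbols I ↔ quant f ∈ I := by
  rw [MonomialPresentation.mem_genKer, smul_unitCls, Submodule.Quotient.mk_eq_zero]

theorem mk_mem_bifilt {I : Submodule (Weyl n) (Weyl n)} {f : MvPolynomial (Fin n ⊕ Fin n) ℂ}
    {d k : ℤ} : (Submodule.Quotient.mk (quant f) : QuotMod I) ∈ bifilt I d k ↔
      f ∈ symbols I ⊔ restrictSupport ℂ (bounded ordF ordV d k) := by
  rw [bifilt, mem_quotFilt, filtFV_eq, Submodule.mem_sup]
  constructor
  · rintro ⟨_, ⟨g, hg, rfl⟩, h⟩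
    refine ⟨f - g, ?_, g, hg, sub_add_cancel _ _⟩
    rw [smul_unitCls, eq_comm, Submodule.Quotient.eq] at h
    rw [mem_symbols, map_sub]
    exact h
  · rintro ⟨y, hy, g, hg, rfl⟩
    refine ⟨_, ⟨g, hg, rfl⟩, ?_⟩
    rw [smul_unitCls, eq_comm, Submodule.Quotient.eq, LinearEquiv.coe_coe, map_add,
      add_sub_cancel_right]
    exact mem_symbols.1 hy

/-- Niceness of a bifiltration, for a subspace `I` of polynomials and two functions `p`, `v` of the
exponents. -/
def Nice {k σ : Type*} [Field k] (p v : (σ →₀ ℕ) → ℤ) (I : Submodule k (MvPolynomial σ k)) : Prop :=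
  ∀ ⦃d e d' e' : ℤ⦄ ⦃f : MvPolynomial σ k⦄, f ∈ I ⊔ restrictSupport k (bounded p v d' e) →
    f ∈ I ⊔ restrictSupport k (bounded p v d e') → f ∈ I ⊔ restrictSupport k (bounded p v d e)

theorem nice_symbols {I : Submodule (Weyl n) (Weyl n)} (h : IsNicelyBifiltered I) :
    Nice ordF ordV (symbols I) := by
  intro d e d' e' f h1 h2
  rw [← mk_mem_bifilt] at h1 h2 ⊢
  have := h d e
  rw [← SetLike.mem_coe, ← this]
  exact ⟨Set.mem_iUnion.2 ⟨d', h1⟩, Set.mem_iUnion.2 ⟨e', h2⟩⟩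

/-- The weights `-w_i` of `x_i` and `w_i` of `∂_i`. -/
abbrev ordW (w : Fin n → ℤ) (μ : Fin n ⊕ Fin n →₀ ℕ) : ℤ :=
  Finsupp.weight (Sum.elim (fun i => -w i) w) μ

theorem gen_mul_quant_mem_of_mem (w : Fin n → ℤ) (s : Fin n ⊕ Fin n) (d : ℤ) {x : Weyl n}
    (hx : x ∈ (restrictSupport ℂ {μ | ordW w μ = d}).map (quant (n := n)).toLinearMap) :
    gen s * x ∈ (restrictSupport ℂ {μ | ordW w μ = Sum.elim (fun i => -w i) w s + d}).map
      (quant (n := n)).toLinearMap := by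
  refine mul_mem_map_of_monomial quant (gen s) (fun μ hμ => ?_) hx
  refine Submodule.map_mono (restrictSupport_mono ℂ fun ν hν => ?_) (gen_mul_quant_mem s μ)
  have h := weight_eq_of_mem_leftMulExps (w := Sum.elim (fun i => -w i) w) (by simp) hν
  have hμ : ordW w μ = d := hμ
  change ordW w ν = _
  rw [← hμ]
  exact h

theorem gradW_le (w : Fin n → ℤ) (j : ℤ) :
    gradW w j ≤ (restrictSupport ℂ {μ | ordW w μ = j}).map (quant (n := n)).toLinearMap := by
  refine Submodule.span_le.2 ?_
  rintro _ ⟨l, rfl, rfl⟩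
  refine prod_mem_of_step gen _
    (fun d => (restrictSupport ℂ {μ | ordW w μ = d}).map (quant (n := n)).toLinearMap) ?_
    (fun s d x hx => gen_mul_quant_mem_of_mem w s d hx) l
  exact ⟨monomial 0 1, (monomial_mem_restrictSupport ℂ).2 (Or.inl (map_zero _)),
    quant_monomial_zero⟩

/-- The projection of `D` to its homogeneous component of degree `j`. -/
def compW (w : Fin n → ℤ) (j : ℤ) : Weyl n →ₗ[ℂ] Weyl n :=
  quant.toLinearMap ∘ₗ part {μ | ordW w μ = j} ∘ₗ quant.symm.toLinearMap

theorem compW_quant (w : Fin n → ℤ) (j : ℤ) (f : MvPolynomial (Fin n ⊕ Fin n) ℂ) :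
    compW w j (quant f) = quant (part {μ | ordW w μ = j} f) := by
  simp [compW]

theorem compW_quant_of_mem {w : Fin n → ℤ} {j i : ℤ} {f : MvPolynomial (Fin n ⊕ Fin n) ℂ}
    (hf : f ∈ restrictSupport ℂ {μ | ordW w μ = j}) :
    compW w i (quant f) = if j = i then quant f else 0 := by
  rw [compW_quant]
  split_ifs with h
  · subst h
    rw [part_eq_self_iff.2 hf]
  · rw [part_eq_zero_iff.2, map_zero]
    intro μ hμ
    refine mem_restrictSupport_iff_coeff.1 hf μ fun h' => h ?_
    exact h'.symm.trans hμ

theorem compW_gen_mul (w : Fin n → ℤ) (s : Fin n ⊕ Fin n) (j : ℤ) (a : Weyl n) :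
    compW w j (gen s * a) = gen s * compW w (j - Sum.elim (fun i => -w i) w s) a := by
  obtain ⟨f, rfl⟩ := quant.surjective a
  induction f using MvPolynomial.induction_on' with
  | add f g hf hg => rw [map_add, mul_add, map_add, hf, hg, map_add, mul_add]
  | monomial μ c =>
    have hm : monomial μ c ∈ restrictSupport ℂ {ν | ordW w ν = ordW w μ} :=
      (monomial_mem_restrictSupport ℂ).2 (Or.inl rfl)
    obtain ⟨g, hg, hg2⟩ := gen_mul_quant_mem_of_mem w s (ordW w μ) ⟨_, hm, rfl⟩
    change quant g = gen s * quant (monomial μ c) at hg2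
    rw [← hg2, compW_quant_of_mem hg, compW_quant_of_mem hm, hg2, mul_ite, mul_zero]
    refine if_congr ?_ rfl rfl
    omega

/-- An ideal generated by homogeneous elements contains the homogeneous components of its
elements. -/
theorem part_mem_symbols {w : Fin n → ℤ} {I : Submodule (Weyl n) (Weyl n)} (hI : IsWHomogeneous w I)
    {f : MvPolynomial (Fin n ⊕ Fin n) ℂ} (hf : f ∈ symbols I) (j : ℤ) :
    part {μ | ordW w μ = j} f ∈ symbols I := by
  suffices h : ∀ a ∈ I, ∀ j, compW w j a ∈ I by
    rw [mem_symbols, ← compW_quant]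
    exact h _ (mem_symbols.1 hf) j
  clear hf
  intro a ha
  have ha' := ha
  rw [← hI] at ha'
  induction ha' using Submodule.span_induction with
  | zero => intro j; rw [map_zero]; exact zero_mem _
  | add x y hx hy hx' hy' =>
    intro j
    rw [map_add]
    exact add_mem (hx' (hI ▸ hx) j) (hy' (hI ▸ hy) j)
  | mem x hx =>
    intro j
    obtain ⟨hx, i, hi⟩ := hx
    obtain ⟨g, hg, rfl⟩ := gradW_le w i hi
    rw [LinearEquiv.coe_coe] at hx ⊢
    rw [compW_quant_of_mem hg]
    split_ifs
    · exact hx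
    · exact zero_mem _
  | smul b x hx hx' =>
    have hx' := hx' (hI ▸ hx)
    clear ha
    induction b using weyl_induction with
    | one => rwa [one_smul]
    | add b c hb hc =>
      intro j
      rw [add_smul, map_add]
      exact add_mem (hb j) (hc j)
    | smul c b hb =>
      intro j
      rw [smul_assoc, map_smul, ← algebraMap_smul (Weyl n) c]
      exact Submodule.smul_mem _ _ (hb j)
    | mul s b hb =>
      intro j
      rw [mul_smul, smul_eq_mul, compW_gen_mul]
      exact Submodule.smul_mem _ (gen s) (hb _)

/-! ### Spaces of initial forms -/

section InitSpace

variable {k σ τ ι ι' : Type*} [Field k]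

/-- The space of initial forms of a subspace `I` of `k[σ]`, for monomials of `k[τ]` graded by `deg`:
the degree `i` part of an element, moved to `k[σ]` by the map `κ` of exponents, lies in `I` up to
monomials in `E' i`, the monomials that are negligible in degree `i`. -/
def initSpace (κ : (τ →₀ ℕ) → (σ →₀ ℕ)) (deg : (τ →₀ ℕ) → ι) (E' : ι → Set (σ →₀ ℕ))
    (I : Submodule k (MvPolynomial σ k)) : Submodule k (MvPolynomial τ k) :=
  ⨅ i, (I ⊔ restrictSupport k (E' i)).comap (expMap κ ∘ₗ part {μ | deg μ = i})

variable {κ : (τ →₀ ℕ) → (σ →₀ ℕ)} {deg : (τ →₀ ℕ) → ι} {E' : ι → Set (σ →₀ ℕ)}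
  {I : Submodule k (MvPolynomial σ k)}

theorem mem_initSpace {f : MvPolynomial τ k} : f ∈ initSpace κ deg E' I ↔
    ∀ i, expMap κ (part {μ | deg μ = i} f) ∈ I ⊔ restrictSupport k (E' i) := by
  simp [initSpace]

theorem mem_initSpace_of_mem {i : ι} {f : MvPolynomial τ k}
    (hf : f ∈ restrictSupport k {μ | deg μ = i})
    (h : expMap κ f ∈ I ⊔ restrictSupport k (E' i)) : f ∈ initSpace κ deg E' I := by
  rw [mem_initSpace]
  intro j
  by_cases hij : i = j
  · subst hij
    rwa [part_eq_self_iff.2 hf]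
  · rw [part_eq_zero_iff.2, map_zero]
    · exact zero_mem _
    · intro μ hμ
      exact mem_restrictSupport_iff_coeff.1 hf μ fun h' => hij (h'.symm.trans hμ)

theorem initSpace_congr (e : ι ≃ ι') {deg' : (τ →₀ ℕ) → ι'} {E'' : ι' → Set (σ →₀ ℕ)}
    (hdeg : ∀ μ, deg' μ = e (deg μ)) (hE : ∀ i, E'' (e i) = E' i) :
    initSpace κ deg' E'' I = initSpace κ deg E' I := by
  ext f
  rw [mem_initSpace, mem_initSpace, ← e.forall_congr_right]
  simp only [hdeg, hE, e.apply_eq_iff_eq]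

theorem expMap_id (f : MvPolynomial σ k) : expMap id f = f := by
  induction f using MvPolynomial.induction_on' with
  | monomial μ c => exact expMap_monomial id μ c
  | add f g hf hg => rw [map_add, hf, hg]

theorem expMap_part {X : Set (σ →₀ ℕ)} {Y Z : Set (τ →₀ ℕ)} (h : ∀ μ ∈ Y, (μ ∈ Z ↔ κ μ ∈ X))
    {f : MvPolynomial τ k} (hf : f ∈ restrictSupport k Y) :
    expMap κ (part Z f) = part X (expMap κ f) := by
  classical
  rw [restrictSupport_eq_span] at hf
  induction hf using Submodule.span_induction with
  | mem x hx =>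
    obtain ⟨μ, hμ, rfl⟩ := hx
    change expMap κ (part Z (monomial μ 1)) = part X (expMap κ (monomial μ 1))
    rw [part_monomial, expMap_monomial, part_monomial]
    by_cases hZ : μ ∈ Z
    · rw [if_pos hZ, if_pos ((h μ hμ).1 hZ), expMap_monomial]
    · rw [if_neg hZ, if_neg fun hX => hZ ((h μ hμ).2 hX), map_zero]
  | zero => simp only [map_zero]
  | add x y _ _ hx hy => simp only [map_add, hx, hy]
  | smul c x _ hx => simp only [map_smul, hx]

theorem part_mem_sup {X Y : Set (σ →₀ ℕ)} (hI : ∀ f ∈ I, part X f ∈ I) {f : MvPolynomial σ k}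
    (hf : f ∈ I ⊔ restrictSupport k Y) : part X f ∈ I ⊔ restrictSupport k Y := by
  obtain ⟨y, hy, b, hb, rfl⟩ := Submodule.mem_sup.1 hf
  rw [map_add]
  exact Submodule.add_mem_sup (hI y hy)
    (restrictSupport_mono k Set.inter_subset_right (part_mem_of_mem hb))

theorem part_preimage_mem {W : (σ →₀ ℕ) → ι} (hI : ∀ f ∈ I, ∀ j, part {s | W s = j} f ∈ I)
    (Z : Set ι) {f : MvPolynomial σ k} (hf : f ∈ I) : part {s | W s ∈ Z} f ∈ I := by
  classical
  rw [part_preimage_eq_sum]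
  exact sum_mem fun j _ => hI f hf j

/-- If `I` is homogeneous for `W`, then the space of initial forms is homogeneous for every weight
that is determined by `W` in each degree. -/
theorem part_mem_initSpace {W : (σ →₀ ℕ) → ℤ} (hI : ∀ f ∈ I, ∀ j, part {s | W s = j} f ∈ I)
    {Φ : (τ →₀ ℕ) → ℤ} (Θ : ι → ℤ → ℤ) (hΦ : ∀ μ, Φ μ = Θ (deg μ) (W (κ μ))) (N : Set ℤ)
    {f : MvPolynomial τ k} (hf : f ∈ initSpace κ deg E' I) :
    part {μ | Φ μ ∈ N} f ∈ initSpace κ deg E' I := by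
  rw [mem_initSpace] at hf ⊢
  intro i
  rw [part_part, Set.inter_comm, ← part_part,
    expMap_part (Y := {μ | deg μ = i}) (X := {s | W s ∈ {j | Θ i j ∈ N}}) _ (part_mem _ f)]
  · exact part_mem_sup (fun g hg => part_preimage_mem hI _ hg) (hf i)
  · rintro μ rfl
    change Φ μ ∈ N ↔ Θ (deg μ) (W (κ μ)) ∈ N
    rw [hΦ]

end InitSpace

/-! ### Comparison of the spaces of initial forms of a nice ideal -/

section Comparison

variable {k σ : Type*} [Field k] {p v : (σ →₀ ℕ) → ℤ} {I : Submodule k (MvPolynomial σ k)}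

theorem Nice.symm (h : Nice p v I) : Nice v p I := by
  have hb : ∀ d e, bounded v p d e = bounded p v e d := fun d e => Set.ext fun _ => and_comm
  intro d e d' e' f h1 h2
  rw [hb] at h1 h2 ⊢
  exact h h2 h1

theorem exists_mem_sup_bounded (v : (σ →₀ ℕ) → ℤ) {d : ℤ} {f : MvPolynomial σ k}
    (hf : f ∈ I ⊔ restrictSupport k {μ | p μ ≤ d}) :
    ∃ e, f ∈ I ⊔ restrictSupport k (bounded p v d e) := by
  obtain ⟨y, hy, b, hb, rfl⟩ := Submodule.mem_sup.1 hf
  obtain ⟨e, he⟩ := (b.support.finite_toSet.image v).bddAbove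
  refine ⟨e, Submodule.add_mem_sup hy ?_⟩
  rw [mem_restrictSupport_iff] at hb ⊢
  exact fun μ hμ => ⟨hb hμ, he (Set.mem_image_of_mem v hμ)⟩

/-- The monomials that are negligible in bidegree `i` for `bigr`. -/
def bigrNeg (p v : (σ →₀ ℕ) → ℤ) (i : ℤ × ℤ) : Set (σ →₀ ℕ) :=
  bounded p v (i.1 - 1) i.2 ∪ bounded p v i.1 (i.2 - 1)

/-- A relation for `bigr` in bidegree `(d, e)` becomes a relation in degree `d` for `gr^F` after
subtracting terms of bidegree at most `(d, e - 1)`. -/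
theorem exists_sub_mem {d e : ℤ} {x : MvPolynomial σ k}
    (hx : x ∈ I ⊔ restrictSupport k (bigrNeg p v (d, e))) :
    ∃ r ∈ restrictSupport k {μ | p μ = d ∧ v μ ≤ e - 1},
      x - r ∈ I ⊔ restrictSupport k (bounded p v (d - 1) e) := by
  classical
  obtain ⟨y, hy, b, hb, rfl⟩ := Submodule.mem_sup.1 hx
  refine ⟨part {μ | p μ = d} b, ?_, ?_⟩
  · refine restrictSupport_mono k ?_ (part_mem_of_mem hb)
    rintro μ ⟨h1, h2⟩
    have h1 : p μ = d := h1
    rcases h2 with ⟨h2, h3⟩ | ⟨h2, h3⟩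
    · change p μ ≤ d - 1 at h2
      omega
    · exact ⟨h1, h3⟩
  · rw [add_sub_assoc]
    refine Submodule.add_mem_sup hy ?_
    rw [mem_restrictSupport_iff_coeff] at hb ⊢
    intro μ hμ
    rw [coeff_sub, coeff_part]
    split_ifs with h
    · exact sub_self _
    · rw [sub_zero]
      refine hb μ fun h2 => hμ ?_
      have h : p μ ≠ d := h
      rcases h2 with h2 | ⟨h2, h3⟩
      · exact h2
      · change p μ ≤ d at h2
        change v μ ≤ e - 1 at h3
        exact ⟨by omega, by omega⟩

/-- Niceness turns a relation in degree `d` for `gr^F`, with no control on `v`, into a relation for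
`bigr`. -/
theorem Nice.mem_of_sub_mem (h : Nice p v I) {d e e' : ℤ} {x r : MvPolynomial σ k}
    (hx : x ∈ restrictSupport k (bounded p v d e))
    (hr : r ∈ restrictSupport k (bounded p v d (e - 1)))
    (hxr : x - r ∈ I ⊔ restrictSupport k (bounded p v (d - 1) e')) :
    x ∈ I ⊔ restrictSupport k (bigrNeg p v (d, e)) := by
  have h1 : x - r ∈ I ⊔ restrictSupport k (bounded p v d e) :=
    Submodule.mem_sup_right (sub_mem hx
      (restrictSupport_mono k (bounded_mono le_rfl (sub_le_self e zero_le_one)) hr))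
  rw [← sub_add_cancel x r]
  refine add_mem ?_ (Submodule.mem_sup_right (restrictSupport_mono k Set.subset_union_right hr))
  exact sup_le_sup_left (restrictSupport_mono k Set.subset_union_left) I (h h1 hxr)

/-- For a nice `I`, taking initial forms for `p` and then for `v` amounts to taking initial forms for
both at once. -/
theorem initSpace_initSpace (h : Nice p v I) :
    initSpace id v (fun e => {μ | v μ ≤ e - 1}) (initSpace id p (fun d => {μ | p μ ≤ d - 1}) I) =
      initSpace id (fun μ => (p μ, v μ)) (bigrNeg p v) I := by
  classical
  have hpart : ∀ d e (f : MvPolynomial σ k), part {μ | p μ = d} (part {μ | v μ = e} f) =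
      part {μ | (p μ, v μ) = (d, e)} f := by
    intro d e f
    have hset : {μ | p μ = d} ∩ {μ | v μ = e} = {μ | (p μ, v μ) = (d, e)} := by
      ext μ
      simp
    rw [part_part, hset]
  ext f
  simp only [mem_initSpace, expMap_id]
  constructor
  · rintro hf ⟨d, e⟩
    obtain ⟨j, hj, r, hr, hjr⟩ := Submodule.mem_sup.1 (hf e)
    rw [mem_initSpace] at hj
    have hj := hj d
    rw [expMap_id] at hj
    obtain ⟨e', he'⟩ := exists_mem_sup_bounded v hj
    refine h.mem_of_sub_mem (r := part {μ | p μ = d} r) (e' := e') ?_ ?_ ?_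
    · refine restrictSupport_mono k ?_ (part_mem _ f)
      intro μ hμ
      obtain ⟨h1, h2⟩ := Prod.mk.inj hμ
      exact ⟨h1.le, h2.le⟩
    · refine restrictSupport_mono k ?_ (part_mem_of_mem hr)
      rintro μ ⟨h1, h2⟩
      exact ⟨le_of_eq h1, h2⟩
    · rw [← hpart, ← hjr, map_add, add_sub_cancel_right]
      exact he'
  · intro hf e
    rw [← sum_part_fiber p (part {μ | v μ = e} f)]
    refine sum_mem fun d _ => ?_
    obtain ⟨r, hr, hr2⟩ := exists_sub_mem (hf (d, e))
    rw [← hpart] at hr2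
    rw [← sub_add_cancel (part {μ | p μ = d} (part {μ | v μ = e} f)) r]
    refine Submodule.add_mem_sup ?_ (restrictSupport_mono k (fun μ hμ => hμ.2) hr)
    refine mem_initSpace_of_mem (i := d)
      (sub_mem (part_mem _ _) (restrictSupport_mono k (fun μ hμ => hμ.1) hr)) ?_
    rw [expMap_id]
    exact sup_le_sup_left (restrictSupport_mono k fun μ hμ => hμ.1) I hr2

/-- The exponent restricting to `s` whose degree, with the additional variable counted in degree `1`,
is `e`; this makes sense for `v s ≤ e`. -/
def liftExp (v : (σ →₀ ℕ) → ℤ) (e : ℤ) (s : σ →₀ ℕ) : Option σ →₀ ℕ := s.optionElim (e - v s).toNat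

theorem some_liftExp (v : (σ →₀ ℕ) → ℤ) (e : ℤ) (s : σ →₀ ℕ) : (liftExp v e s).some = s :=
  Finsupp.some_optionElim _ _

theorem liftExp_none (v : (σ →₀ ℕ) → ℤ) (e : ℤ) (s : σ →₀ ℕ) :
    liftExp v e s none = (e - v s).toNat := Finsupp.optionElim_apply_none _ _

theorem expMap_expMap_liftExp (v : (σ →₀ ℕ) → ℤ) (e : ℤ) (f : MvPolynomial σ k) :
    expMap Finsupp.some (expMap (liftExp v e) f) = f := by
  induction f using MvPolynomial.induction_on' with
  | monomial μ c => rw [expMap_monomial, expMap_monomial, some_liftExp]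
  | add f g hf hg => rw [map_add, map_add, hf, hg]

/-- For a nice `I`, the initial forms, with respect to the additional variable, of the space of
initial forms on the Rees algebra of `v` are those of `bigr` with polynomial coefficients in the
additional variable. -/
theorem initSpace_rees (h : Nice p v I) :
    initSpace id (fun μ : Option σ →₀ ℕ => -(μ none : ℤ)) (fun c => {μ | -(μ none : ℤ) ≤ c - 1})
      (initSpace Finsupp.some (fun μ => (p μ.some, v μ.some + μ none))
        (fun i => bounded p v (i.1 - 1) i.2) I) =
      initSpace Finsupp.some (fun μ => (μ none, (p μ.some, v μ.some)))
        (fun i => bigrNeg p v i.2) I := by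
  classical
  ext f
  constructor
  · rw [mem_initSpace, mem_initSpace]
    rintro hf ⟨c, d, e⟩
    obtain ⟨j, hj, r, hr, hjr⟩ := Submodule.mem_sup.1 (hf (-(c : ℤ)))
    rw [expMap_id] at hjr
    rw [mem_initSpace] at hj
    have hj := hj (d, e + c)
    have hpart : part {μ : Option σ →₀ ℕ | (p μ.some, v μ.some + μ none) = (d, e + c)}
        (part {μ | -(μ none : ℤ) = -(c : ℤ)} f) =
        part {μ | (μ none, (p μ.some, v μ.some)) = (c, (d, e))} f := by
      have hset : {μ : Option σ →₀ ℕ | (p μ.some, v μ.some + μ none) = (d, e + c)} ∩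
          {μ | -(μ none : ℤ) = -(c : ℤ)} = {μ | (μ none, (p μ.some, v μ.some)) = (c, (d, e))} := by
        ext μ
        simp only [Set.mem_inter_iff, Set.mem_ofPred_eq, Prod.mk.injEq]
        omega
      rw [part_part, hset]
    refine h.mem_of_sub_mem (r := expMap Finsupp.some
      (part {μ : Option σ →₀ ℕ | (p μ.some, v μ.some + μ none) = (d, e + c)} r))
      (e' := e + c) ?_ ?_ ?_
    · refine expMap_mem _ ?_ (part_mem _ f)
      intro μ hμ
      simp only [Set.mem_ofPred_eq, Prod.mk.injEq] at hμ
      exact ⟨hμ.2.1.le, hμ.2.2.le⟩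
    · refine expMap_mem _ ?_ (part_mem_of_mem hr)
      rintro μ ⟨h1, h2⟩
      simp only [Set.mem_ofPred_eq, Prod.mk.injEq] at h1 h2
      exact ⟨h1.1.le, by omega⟩
    · rw [← hpart, ← hjr, map_add, map_add, add_sub_cancel_right]
      exact hj
  · intro hf
    rw [mem_initSpace] at hf
    rw [mem_initSpace]
    intro c
    rw [expMap_id]
    rw [← sum_part_fiber (fun μ => (μ none, (p μ.some, v μ.some))) (part {μ | -(μ none : ℤ) = c} f)]
    refine sum_mem ?_
    rintro ⟨c', d, e⟩ _
    rw [part_part]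
    -- Only the exponents with `μ none = -c` contribute.
    by_cases hc : -(c' : ℤ) = c
    swap
    · rw [part_eq_zero_iff.2]
      · exact zero_mem _
      · rintro μ ⟨h1, h2⟩
        simp only [Set.mem_ofPred_eq, Prod.mk.injEq] at h1 h2
        omega
    have hset : {μ : Option σ →₀ ℕ | (μ none, (p μ.some, v μ.some)) = (c', (d, e))} ∩
        {μ | -(μ none : ℤ) = c} = {μ | (μ none, (p μ.some, v μ.some)) = (c', (d, e))} := by
      ext μ
      simp only [Set.mem_inter_iff, Set.mem_ofPred_eq, Prod.mk.injEq]
      omega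
    rw [hset]
    obtain ⟨r, hr, hr2⟩ := exists_sub_mem (hf (c', (d, e)))
    -- The terms of `r` have `v`-degree less than `e`, so lifting them to second degree `e + c'` takes
    -- an exponent greater than `c'` of the additional variable.
    rw [← sub_add_cancel (part _ f) (expMap (liftExp v (e + c')) r)]
    refine Submodule.add_mem_sup ?_ ?_
    · refine mem_initSpace_of_mem (i := (d, e + c')) (sub_mem ?_ ?_) ?_
      · refine restrictSupport_mono k ?_ (part_mem _ f)
        intro μ hμ
        simp only [Set.mem_ofPred_eq, Prod.mk.injEq] at hμ ⊢
        omega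
      · refine expMap_mem _ ?_ hr
        rintro s ⟨h1, h2⟩
        simp only [Set.mem_ofPred_eq, Prod.mk.injEq, some_liftExp, liftExp_none]
        omega
      · rw [map_sub, expMap_expMap_liftExp]
        exact sup_le_sup_left (restrictSupport_mono k (bounded_mono le_rfl (by omega))) I hr2
    · refine expMap_mem _ ?_ hr
      rintro s ⟨h1, h2⟩
      simp only [Set.mem_ofPred_eq, liftExp_none]
      omega

theorem coeff_optionEquivLeft (F : MvPolynomial (Option σ) k) (c : ℕ) :
    (optionEquivLeft k σ F).coeff c = expMap Finsupp.some (part {μ | μ none = c} F) := by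
  classical
  ext s
  have h1 := optionEquivLeft_coeff_some_coeff_none k σ (s.optionElim c) F
  rw [Finsupp.some_optionElim, Finsupp.optionElim_apply_none] at h1
  have hc : s.optionElim c ∈ {μ : Option σ →₀ ℕ | μ none = c} := Finsupp.optionElim_apply_none _ _
  have h2 := coeff_expMap (k := k) Finsupp.some (X := {μ : Option σ →₀ ℕ | μ none = c})
    (fun μ hμ ν hν h => option_ext h (Eq.trans hμ (Eq.symm hν))) hc (part_mem _ F)
  rw [Finsupp.some_optionElim, coeff_part, if_pos hc] at h2
  rw [h1, h2]

/-- The extension of an ideal of initial forms to polynomials in an additional variable. -/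
theorem exists_extended_ideal [Finite σ] {ι : Type*} {deg : (σ →₀ ℕ) → ι} {E' : ι → Set (σ →₀ ℕ)}
    {J : Ideal (MvPolynomial σ k)} (hJ : ∀ f, f ∈ J ↔ f ∈ initSpace id deg E' I) :
    ∃ L : Ideal (MvPolynomial (Option σ) k), L.height = J.height ∧
      ∀ F, F ∈ L ↔
        F ∈ initSpace Finsupp.some (fun μ => (μ none, deg μ.some)) (fun i => E' i.2) I := by
  refine ⟨(J.map Polynomial.C).comap (optionEquivLeft k σ).toRingEquiv, ?_, fun F => ?_⟩
  · rw [RingEquiv.height_comap, height_map_C]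
  · rw [Ideal.mem_comap, Ideal.mem_map_C_iff, mem_initSpace, Prod.forall]
    refine forall_congr' fun c => ?_
    have h := coeff_optionEquivLeft F c
    change Polynomial.coeff (optionEquivLeft k σ F) c ∈ J ↔ _
    rw [h, hJ, mem_initSpace]
    refine forall_congr' fun i => ?_
    rw [expMap_id, ← expMap_part (κ := Finsupp.some) (Y := Set.univ)
      (Z := {μ | deg μ.some = i}) (fun μ _ => Iff.rfl)
      (by rw [mem_restrictSupport_iff]; exact Set.subset_univ _), part_part]
    have hset : {μ : Option σ →₀ ℕ | deg μ.some = i} ∩ {μ | μ none = c} =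
        {μ | (μ none, deg μ.some) = (c, i)} := by
      ext μ
      simp only [Set.mem_inter_iff, Set.mem_ofPred_eq, Prod.mk.injEq]
      exact and_comm
    rw [hset]

end Comparison

/-! ### Heights of ideals of initial forms -/

section Heights

attribute [local instance] MvPolynomial.weightedGradedAlgebra

variable {k τ : Type*} [Field k] {wt : τ → ℕ} {K : Submodule k (MvPolynomial τ k)}

theorem part_weight_mem {Φ : (τ →₀ ℕ) → ℤ} (hΦ : ∀ μ, (Finsupp.weight wt μ : ℤ) = Φ μ)
    (hK : ∀ f ∈ K, ∀ j, part {μ | Φ μ = j} f ∈ K) (N : Set ℕ) {f : MvPolynomial τ k} (hf : f ∈ K) :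
    part {μ | Finsupp.weight wt μ ∈ N} f ∈ K := by
  have h := part_preimage_mem hK ((↑) '' N : Set ℤ) hf
  have hset : {μ | Φ μ ∈ ((↑) '' N : Set ℤ)} = {μ | Finsupp.weight wt μ ∈ N} := by
    ext μ
    simp [← hΦ]
  rwa [hset] at h

theorem isHomogeneous_of_initSpace {Φ : (τ →₀ ℕ) → ℤ} (hΦ : ∀ μ, (Finsupp.weight wt μ : ℤ) = Φ μ)
    (hK : ∀ f ∈ K, ∀ j, part {μ | Φ μ = j} f ∈ K) {ω : (τ →₀ ℕ) → ℤ} {J : Ideal (MvPolynomial τ k)}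
    (hJ : ∀ f, f ∈ J ↔ f ∈ initSpace id ω (fun e => {μ | ω μ ≤ e - 1}) K) :
    J.IsHomogeneous (weightedHomogeneousSubmodule k wt) := by
  refine isHomogeneous_of_part_mem wt fun f hf i => ?_
  refine part_weight_mem (K := J.restrictScalars k) hΦ (fun g hg j => ?_) {i} hf
  exact (hJ _).2 (part_mem_initSpace hK (fun _ => id) (fun _ => rfl) {j} ((hJ g).1 hg))

theorem finrank_eq_of_initSpace [Finite τ] (hwt : ∀ t, wt t ≠ 0) {Φ : (τ →₀ ℕ) → ℤ}
    (hΦ : ∀ μ, (Finsupp.weight wt μ : ℤ) = Φ μ)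
    (hK : ∀ f ∈ K, ∀ j, part {μ | Φ μ = j} f ∈ K) {ω : (τ →₀ ℕ) → ℤ} {J : Ideal (MvPolynomial τ k)}
    (hJ : ∀ f, f ∈ J ↔ f ∈ initSpace id ω (fun e => {μ | ω μ ≤ e - 1}) K) (m : ℕ) :
    Module.finrank k (K ⊓ restrictSupport k (weightLE wt m) : Submodule k (MvPolynomial τ k)) =
      Module.finrank k (J.restrictScalars k ⊓ restrictSupport k (weightLE wt m) :
        Submodule k (MvPolynomial τ k)) := by
  refine finrank_initial_eq (finite_weightLE wt hwt m) ω
    (fun f hf => part_weight_mem hΦ hK {i | i ≤ m} hf) fun f => ?_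
  refine (hJ f).trans ?_
  simp only [mem_initSpace, expMap_id]

/-- The ideals of initial forms of a weighted homogeneous space for two weights have the same height:
they have the same Hilbert function. -/
theorem height_eq_of_initSpace [Finite τ] (hwt : ∀ t, wt t ≠ 0) {Φ : (τ →₀ ℕ) → ℤ}
    (hΦ : ∀ μ, (Finsupp.weight wt μ : ℤ) = Φ μ)
    (hK : ∀ f ∈ K, ∀ j, part {μ | Φ μ = j} f ∈ K) {ω ω' : (τ →₀ ℕ) → ℤ}
    {J J' : Ideal (MvPolynomial τ k)}
    (hJ : ∀ f, f ∈ J ↔ f ∈ initSpace id ω (fun e => {μ | ω μ ≤ e - 1}) K)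
    (hJ' : ∀ f, f ∈ J' ↔ f ∈ initSpace id ω' (fun e => {μ | ω' μ ≤ e - 1}) K) :
    J.height = J'.height :=
  height_eq_of_finrank_eq wt hwt (isHomogeneous_of_initSpace hΦ hK hJ)
    (isHomogeneous_of_initSpace hΦ hK hJ') fun m =>
      (finrank_eq_of_initSpace hwt hΦ hK hJ m).symm.trans (finrank_eq_of_initSpace hwt hΦ hK hJ' m)

/-- A weighted homogeneous ideal and an ideal of initial forms of it have the same height. -/
theorem height_eq_height_of_initSpace [Finite τ] (hwt : ∀ t, wt t ≠ 0) {Φ : (τ →₀ ℕ) → ℤ}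
    (hΦ : ∀ μ, (Finsupp.weight wt μ : ℤ) = Φ μ) {ω : (τ →₀ ℕ) → ℤ} {J J' : Ideal (MvPolynomial τ k)}
    (hJ : ∀ f ∈ J, ∀ j, part {μ | Φ μ = j} f ∈ J)
    (hJ' : ∀ f, f ∈ J' ↔ f ∈ initSpace id ω (fun e => {μ | ω μ ≤ e - 1}) (J.restrictScalars k)) :
    J'.height = J.height := by
  refine height_eq_of_finrank_eq wt hwt
    (isHomogeneous_of_initSpace (K := J.restrictScalars k) hΦ hJ hJ')
    (isHomogeneous_of_part_mem wt fun f hf i => ?_)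
    (fun m => (finrank_eq_of_initSpace (K := J.restrictScalars k) hwt hΦ hJ hJ' m).symm)
  exact part_weight_mem (K := J.restrictScalars k) hΦ hJ {i} hf

end Heights

/-! ### Positive weights -/

section Weights

theorem cast_weight_of_step {τ : Type*} {wt : τ → ℕ} {Φ : (τ →₀ ℕ) → ℤ} (h0 : Φ 0 = 0)
    (hadd : ∀ μ t, Φ (μ + Finsupp.single t 1) = wt t + Φ μ) (μ : τ →₀ ℕ) :
    (Finsupp.weight wt μ : ℤ) = Φ μ := by
  induction μ using exp_induction with
  | zero => rw [map_zero, h0, Nat.cast_zero]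
  | add_single μ t ih =>
    rw [hadd, ← ih, map_add, Finsupp.weight_single, one_smul, Nat.cast_add, add_comm]

variable {w : Fin n → ℤ}

/-- A number large enough for the weights below to be positive. -/
def bigWeight (w : Fin n → ℤ) : ℤ := 1 + 2 * ∑ i, w i

theorem two_mul_lt_bigWeight (hw : ∀ i, 0 < w i) (i : Fin n) : 2 * w i < bigWeight w := by
  have := Finset.single_le_sum (f := w) (fun j _ => (hw j).le) (Finset.mem_univ i)
  rw [bigWeight]
  omega

theorem bigWeight_pos (hw : ∀ i, 0 < w i) : 0 < bigWeight w := by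
  have := Finset.sum_nonneg (s := Finset.univ) (f := w) (fun j _ => (hw j).le)
  rw [bigWeight]
  omega

/-- The combination `N * ordF + a * ordV - 2 * ordW` of the three gradings, for a large `N`. -/
def combInt (w : Fin n → ℤ) (a : ℤ) (s : Fin n ⊕ Fin n) : ℤ :=
  bigWeight w * wF s + a * wV s - 2 * (Sum.elim (fun i => -w i) w) s

/-- The weights `combInt`, as natural numbers. -/
def comb (w : Fin n → ℤ) (a : ℤ) (s : Fin n ⊕ Fin n) : ℕ := (combInt w a s).toNat

theorem combInt_pos (hw : ∀ i, 0 < w i) {a : ℤ} (h0 : 0 ≤ a) (h1 : a ≤ 1) (s : Fin n ⊕ Fin n) :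
    0 < combInt w a s := by
  rcases s with i | i
  · have := hw i
    simp only [combInt, wF, wV, Sum.elim_inl]
    omega
  · have := two_mul_lt_bigWeight hw i
    simp only [combInt, wF, wV, Sum.elim_inr]
    omega

theorem cast_comb (hw : ∀ i, 0 < w i) {a : ℤ} (h0 : 0 ≤ a) (h1 : a ≤ 1) (s : Fin n ⊕ Fin n) :
    (comb w a s : ℤ) = combInt w a s := Int.toNat_of_nonneg (combInt_pos hw h0 h1 s).le

theorem cast_weight_comb (hw : ∀ i, 0 < w i) (μ : Fin n ⊕ Fin n →₀ ℕ) :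
    (Finsupp.weight (comb w 0) μ : ℤ) = bigWeight w * ordF μ - 2 * ordW w μ := by
  refine cast_weight_of_step (Φ := fun μ => bigWeight w * ordF μ - 2 * ordW w μ) (by simp)
    (fun μ t => ?_) μ
  rw [cast_comb hw le_rfl zero_le_one, combInt, ordF, ordW, weight_add_single, weight_add_single]
  ring

/-- The weights `comb`, and `b` for the additional variable. -/
def combOption (w : Fin n → ℤ) (b : ℕ) (t : Option (Fin n ⊕ Fin n)) : ℕ := t.elim b (comb w 1)

theorem combOption_ne_zero (hw : ∀ i, 0 < w i) {b : ℕ} (hb : b ≠ 0) (t : Option (Fin n ⊕ Fin n)) :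
    combOption w b t ≠ 0 := by
  rcases t with _ | s
  · exact hb
  · change comb w 1 s ≠ 0
    have h1 := cast_comb hw zero_le_one le_rfl s
    have h2 := combInt_pos hw zero_le_one le_rfl s
    omega

theorem cast_weight_combOption (hw : ∀ i, 0 < w i) (b : ℕ) (μ : Option (Fin n ⊕ Fin n) →₀ ℕ) :
    (Finsupp.weight (combOption w b) μ : ℤ) =
      b * μ none + bigWeight w * ordF μ.some + ordV μ.some - 2 * ordW w μ.some := by
  refine cast_weight_of_step (Φ := fun μ : Option (Fin n ⊕ Fin n) →₀ ℕ =>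
    b * μ none + bigWeight w * ordF μ.some + ordV μ.some - 2 * ordW w μ.some)
    (by simp [Finsupp.some_zero]) (fun μ t => ?_) μ
  rcases t with _ | s
  · rw [some_add_single_none, Finsupp.add_apply, Finsupp.single_eq_same]
    change _ = (b : ℤ) + _
    push_cast
    ring
  · rw [some_add_single_some, Finsupp.add_apply, Finsupp.single_eq_of_ne (by simp)]
    change _ = (comb w 1 s : ℤ) + _
    rw [cast_comb hw zero_le_one le_rfl, combInt, ordF, ordV, ordW, weight_add_single,
      weight_add_single, weight_add_single]
    ring_nf

end Weights

/-! ### The codimensions -/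

section Codim

variable {w : Fin n → ℤ} {I : Submodule (Weyl n) (Weyl n)}

variable (I) in
theorem exists_ideal_F : ∃ J : Ideal (MvPolynomial (Fin n ⊕ Fin n) ℂ), J.height = codim I ∧
    ∀ f, f ∈ J ↔ f ∈ initSpace id ordF (fun d => {μ | ordF μ ≤ d - 1}) (symbols I) := by
  obtain ⟨J, h1, h2⟩ := (compatF (n := n)).exists_ideal (unitCls I)
  exact ⟨J, h1, fun f => (h2 f).trans mem_initSpace.symm⟩

variable (I) in
theorem exists_ideal_bigr : ∃ J : Ideal (MvPolynomial (Fin n ⊕ Fin n) ℂ), J.height = codimBigr I ∧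
    ∀ f, f ∈ J ↔ f ∈ initSpace id (fun μ => (ordF μ, ordV μ)) (bigrNeg ordF ordV) (symbols I) := by
  obtain ⟨J, h1, h2⟩ := (compatBigr (n := n)).exists_ideal (unitCls I)
  exact ⟨J, h1, fun f => (h2 f).trans mem_initSpace.symm⟩

variable (I) in
theorem exists_ideal_FReesV : ∃ J : Ideal (MvPolynomial (Option (Fin n ⊕ Fin n)) ℂ),
    J.height = codimGrFReesV I ∧
    ∀ f, f ∈ J ↔ f ∈ initSpace Finsupp.some (fun μ => (ordF μ.some, ordV μ.some + μ none))
      (fun i => bounded ordF ordV (i.1 - 1) i.2) (symbols I) := by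
  obtain ⟨J, h1, h2⟩ := (compatFReesV (n := n)).exists_ideal (unitCls I)
  exact ⟨J, h1, fun f => (h2 f).trans mem_initSpace.symm⟩

/-- The annihilator of the generator of `gr^V(R_F(M))`, in terms of monomials. -/
abbrev symbolsH (I : Submodule (Weyl n) (Weyl n)) :
    Submodule ℂ (MvPolynomial (Option (Fin n ⊕ Fin n)) ℂ) :=
  initSpace Finsupp.some (fun μ => (ordF μ.some + μ none, ordV μ.some))
    (fun i => bounded ordF ordV i.1 (i.2 - 1)) (symbols I)

theorem genKer_grGen : GradingData.MonomialPresentation.genKer (presVReesF (n := n)).grEquiv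
    ((grVReesF n).grGen (unitCls I)) = symbolsH I := by
  ext f
  rw [mem_initSpace]
  exact presVReesF.toGr_smul_grGen_eq_zero_iff (unitCls I) f

variable (I) in
theorem exists_ideal_H (ω : HWeight n) : ∃ J : Ideal (MvPolynomial (Option (Fin n ⊕ Fin n)) ℂ),
    J.height = codimGrVReesF I ω ∧
    ∀ f, f ∈ J ↔ f ∈ initSpace id (ordH ω) (fun e => {μ | ordH ω μ ≤ e - 1}) (symbolsH I) := by
  obtain ⟨J, h1, h2⟩ := (compatH ω).exists_ideal ((grVReesF n).grGen (unitCls I))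
  refine ⟨J, h1, fun f => (h2 f).trans ?_⟩
  rw [← genKer_grGen]
  exact mem_initSpace.symm

theorem codimBigr_eq (hw : ∀ i, 0 < w i) (hI : IsWHomogeneous w I) (hnice : IsNicelyBifiltered I) :
    codimBigr I = codim I := by
  obtain ⟨J, hJ, hJ'⟩ := exists_ideal_F I
  obtain ⟨L, hL, hL'⟩ := exists_ideal_bigr I
  rw [← hJ, ← hL]
  have hK : J.restrictScalars ℂ =
      initSpace id ordF (fun d => {μ | ordF μ ≤ d - 1}) (symbols I) := Submodule.ext hJ'
  refine height_eq_height_of_initSpace (wt := comb w 0) (ω := ordV) (fun s => ?_)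
    (cast_weight_comb hw) (fun f hf j => ?_) fun f => ?_
  · have h1 := cast_comb hw le_rfl zero_le_one s
    have h2 := combInt_pos hw le_rfl zero_le_one s
    omega
  · exact (hJ' _).2 (part_mem_initSpace (fun f hf => part_mem_symbols hI hf)
      (fun d j => bigWeight w * d - 2 * j) (fun _ => rfl) {j} ((hJ' f).1 hf))
  · rw [hL', hK, initSpace_initSpace (nice_symbols hnice)]

theorem codimGrFReesV_eq (hw : ∀ i, 0 < w i) (hI : IsWHomogeneous w I)
    (hnice : IsNicelyBifiltered I) : codimGrFReesV I = codimBigr I := by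
  obtain ⟨J, hJ, hJ'⟩ := exists_ideal_FReesV I
  obtain ⟨L₀, hL₀, hL₀'⟩ := exists_ideal_bigr I
  obtain ⟨L, hL, hL'⟩ := exists_extended_ideal hL₀'
  rw [← hJ, ← hL₀, ← hL]
  have hK : J.restrictScalars ℂ =
      initSpace Finsupp.some (fun μ => (ordF μ.some, ordV μ.some + μ none))
        (fun i => bounded ordF ordV (i.1 - 1) i.2) (symbols I) := Submodule.ext hJ'
  refine (height_eq_height_of_initSpace (wt := combOption w 1)
    (ω := fun μ : Option (Fin n ⊕ Fin n) →₀ ℕ => -(μ none : ℤ)) (combOption_ne_zero hw one_ne_zero)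
    (cast_weight_combOption hw 1) (fun f hf j => ?_) fun f => ?_).symm
  · refine (hJ' _).2 (part_mem_initSpace (fun f hf => part_mem_symbols hI hf)
      (fun d j => bigWeight w * d.1 + d.2 - 2 * j) (fun μ => ?_) {j} ((hJ' f).1 hf))
    push_cast
    ring
  · rw [hL', hK, initSpace_rees (nice_symbols hnice)]

theorem codimGrVReesF_eq (hw : ∀ i, 0 < w i) (hI : IsWHomogeneous w I)
    (hnice : IsNicelyBifiltered I) (ω : HWeight n) : codimGrVReesF I ω = codimBigr I := by
  obtain ⟨J, hJ, hJ'⟩ := exists_ideal_H I ω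
  obtain ⟨L₀, hL₀, hL₀'⟩ := exists_ideal_bigr I
  obtain ⟨L, hL, hL'⟩ := exists_extended_ideal hL₀'
  rw [← hJ, ← hL₀, ← hL]
  have hb : ∀ d e, bounded (ordV (n := n)) ordF d e = bounded ordF ordV e d :=
    fun d e => Set.ext fun _ => and_comm
  have h := initSpace_rees (nice_symbols hnice).symm
  have e1 : initSpace Finsupp.some
      (fun μ : Option (Fin n ⊕ Fin n) →₀ ℕ => (ordV μ.some, ordF μ.some + μ none))
      (fun i => bounded ordV ordF (i.1 - 1) i.2) (symbols I) = symbolsH I :=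
    initSpace_congr (Equiv.prodComm ℤ ℤ) (fun μ => rfl) (fun i => hb _ _)
  have e2 : initSpace Finsupp.some
      (fun μ : Option (Fin n ⊕ Fin n) →₀ ℕ => (μ none, (ordV μ.some, ordF μ.some)))
      (fun i => bigrNeg ordV ordF i.2) (symbols I) =
      initSpace Finsupp.some (fun μ => (μ none, (ordF μ.some, ordV μ.some)))
        (fun i => bigrNeg ordF ordV i.2) (symbols I) := by
    refine initSpace_congr ((Equiv.refl ℕ).prodCongr (Equiv.prodComm ℤ ℤ)) (fun μ => rfl)
      fun i => ?_
    change bounded ordV ordF (i.2.2 - 1) i.2.1 ∪ bounded ordV ordF i.2.2 (i.2.1 - 1) = _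
    rw [hb, hb, Set.union_comm]
    rfl
  rw [e1, e2] at h
  -- The variable `h` has weight `N`, because it contributes to the degree for `F`.
  have hN := Int.toNat_of_nonneg (bigWeight_pos hw).le
  refine height_eq_of_initSpace (wt := combOption w (bigWeight w).toNat)
    (combOption_ne_zero hw (by have := bigWeight_pos hw; omega)) (cast_weight_combOption hw _)
    (fun f hf j => ?_) hJ' (ω' := fun μ : Option (Fin n ⊕ Fin n) →₀ ℕ => -(μ none : ℤ))
    (fun f => ?_)
  · refine part_mem_initSpace (fun f hf => part_mem_symbols hI hf)
      (fun d j => bigWeight w * d.1 + d.2 - 2 * j) (fun μ => ?_) {j} hf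
    rw [hN]
    dsimp only
    ring
  · rw [hL', h]

end Codim

end BifilteredWeyl

end

theorem proposition15 (n : ℕ) (w : Fin n → ℤ) (hw : ∀ i, 0 < w i)
    (I : Submodule (BifilteredWeyl.Weyl n) (BifilteredWeyl.Weyl n))
    (hI : BifilteredWeyl.IsWHomogeneous w I)
    (hnice : BifilteredWeyl.IsNicelyBifiltered I) :
    BifilteredWeyl.codimGrFReesV I = BifilteredWeyl.codim I ∧
    (∀ ω : BifilteredWeyl.HWeight n,
      BifilteredWeyl.codimGrVReesF I ω = BifilteredWeyl.codim I) ∧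
    BifilteredWeyl.codimBigr I = BifilteredWeyl.codim I := by
  have h := BifilteredWeyl.codimBigr_eq hw hI hnice
  exact ⟨(BifilteredWeyl.codimGrFReesV_eq hw hI hnice).trans h,
    fun ω => (BifilteredWeyl.codimGrVReesF_eq hw hI hnice ω).trans h, h⟩
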